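/- **Theorem (ATM call option price).** Let $X$ be a hyperexponential Lévy process: a real Lévy process with drift $a\in\mathbb R$, Gaussian coefficient $\sigma\ge 0$ and Lévy measure $$\nu(dx)=\mathbb I(x<0)\sum_{\ell=1}^{\hat N}\hat a_\ell\hat\rho_\ell e^{\hat\rho_\ell x}\,dx+\mathbb I(x>0)\sum_{\ell=1}^{N}a_\ell\rho_\ell e^{-\rho_\ell x}\,dx,$$ where $N,\hat N\ge 0$, $a_\ell,\hat a_\ell>0$, $0<\rho_1<\dots<\rho_N$, $0<\hat\rho_1<\dots<\hat\rho_{\hat N}$; that is, $E[e^{iuX_t}]=\exp\bigl(t(iau-\tfrac{\sigma^2u^2}{2}+\int(e^{iux}-1)\,\nu(dx))\bigr)$. Let $$\psi(z)=\frac{\sigma^2z^2}{2}+az+z\sum_{\ell=1}^N\frac{a_\ell}{\rho_\ell-z}-z\sum_{\ell=1}^{\hat N}\frac{\hat a_\ell}{\hat\rho_\ell+z}$$ be its Laplace exponent. Assume the risk-neutral condition $\psi(1)=r>0$ and $\rho_1>1$ (the latter is void if $N=0$). Let $S_t=S_0e^{X_t}$ with $S_0>0$, let $K=S_0$, and $C(T)=e^{-rT}E[(S_T-K)^+]$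 for $T\ge0$; the expectation is finite. *Operations on coefficients.* For a series $f(z)=\sum_{n\ge k}f_nz^n$ with $f_k\ne0$: - Reciprocal: $r_{-k+j}[f]=\dfrac{(-1)^j}{f_k^{\,j+1}}\det\bigl(f_{k+1+m-i}\bigr)_{i,m=1}^{j}$ for $j\ge0$, where $f_i:=0$ for $i<k$ and the empty determinant is $1$. - Inversion ($k\ge1$): $l_1[f]=f_k^{-1/k}$ and, for $n\ge2$, $l_n[f]=\dfrac1{n!\,f_k^{n/k}}\sum_{m=1}^{n-1}(-1)^m\bigl(\tfrac nk\bigr)_m B_{n-1,m}\bigl(1!\tfrac{f_{k+1}}{f_k},2!\tfrac{f_{k+2}}{f_k},\dots\bigr)$, where $(x)_m=x(x+1)\cdots(x+m-1)$ and $B_{n,m}$ are the exponential partial Bell polynomials. - Products of series with non-negative indices are Cauchy products. *Coefficients for $1\le\ell\le N$.* Let $(g_{\ell,n})_{n\ge-1}$ be the Laurent coefficients of $\psi(z+\rho_\ell)$ at $z=0$: $$g_{\ell,-1}=-a_\ell\rho_\ell,\quad g_{\ell,0}=\tfrac{\sigma^2\rho_\ell^2}{2}+a\rho_\ell+\omega_{\ell,0},\quad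 g_{\ell,1}=\sigma^2\rho_\ell+a+\omega_{\ell,1},\quad g_{\ell,2}=\tfrac{\sigma^2}{2}+\omega_{\ell,2},\quad g_{\ell,n}=\omega_{\ell,n}\ (n\ge3),$$ $$\omega_{\ell,0}=\sum_{i\ne\ell}\frac{a_i\rho_\ell}{\rho_i-\rho_\ell}-\sum_i\frac{\hat a_i\rho_\ell}{\hat\rho_i+\rho_\ell}-a_\ell,\qquad \omega_{\ell,n}=\sum_{i\neq\ell}\frac{a_i\rho_i}{(\rho_i-\rho_\ell)^{n+1}}+(-1)^n\sum_i\frac{\hat a_i\hat\rho_i}{(\hat\rho_i+\rho_\ell)^{n+1}}\ (n\ge1).$$ Let $\zeta_{\ell,0}=\rho_\ell$ and $\zeta_{\ell,n}=l_n[c]$ for $n\ge1$, where $c_i=r_i[g_\ell]$, $i\ge1$ (these are the coefficients of the root $\zeta_\ell(q)=\sum_n\zeta_{\ell,n}q^{-n}$ of $\psi(z)=q$). Let $\xi_{\ell,n}=r_n[\zeta_\ell]$; let $\varsigma_{\ell,n}=r_n[\tilde\zeta_\ell]$, where $\tilde\zeta_\ell$ is $\zeta_\ell$ with $\zeta_{\ell,0}$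 replaced by $\zeta_{\ell,0}-1$; let $\zeta'_{\ell,n}=(1-n)\zeta_{\ell,n-1}$ for $n\ge2$ and $0$ for $n<2$. Let $m_{\ell,n}$ be the $n$-th coefficient of the product of the three series $\xi_\ell,\varsigma_\ell,\zeta'_\ell$. *Coefficients for $\ell=N+1$, if $\sigma>0$ (put $\kappa=2$) or if $\sigma=0$ and $a>0$ (put $\kappa=1$).* Let $(h_n)_{n\ge-\kappa}$ be the Laurent coefficients of $\psi(1/z)$ at $z=0$: $h_{-2}=\sigma^2/2$ (if $\kappa=2$), $h_{-1}=a$, $h_n=-\bigl(\sum_\ell a_\ell\rho_\ell^n+(-1)^n\sum_\ell\hat a_\ell\hat\rho_\ell^{\,n}\bigr)$ for $n\ge0$. Let $d_j=r_j[h]$ ($j\ge\kappa$), $\xi_{N+1,n}=l_n[d]$ for $n\ge1$, $\xi_{N+1,0}=0$, and $\beta_n=r_n[\xi_{N+1}]$ for $n\ge-1$, where $\xi_{N+1}$ is taken as a series starting at index $1$ (so $\zeta_{N+1}(q)=\sum_{n\ge-1}\beta_nq^{-n/\kappa}$). Let $\varsigma_{N+1,n}=r_n[\tilde\beta]$ for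 $n\ge1$, where $\tilde\beta$ is $\beta$ with $\beta_0$ replaced by $\beta_0-1$, and $\varsigma_{N+1,0}=0$; let $\zeta'_{N+1,n}=\frac{\kappa-n}{\kappa}\beta_{n-\kappa}$ for $n\ge\kappa-1$ and $0$ for $0\le n<\kappa-1$. Let $m_{N+1,n}$ be the $n$-th coefficient of the product of the three series $\xi_{N+1},\varsigma_{N+1},\zeta'_{N+1}$. *Conclusion.* (i) If $\sigma>0$, put $b_n=m_{N+1,n}+\sum_{\ell=1}^Nm_{\ell,n/2}$ for $n$ even and $b_n=m_{N+1,n}$ for $n$ odd. Then $$C(T)=e^{-rT}S_0\sum_{n=1}^\infty b_{n+2}\frac{T^{n/2}}{\Gamma(\frac n2+1)},\qquad T\ge0,$$ and the series converges for every $T\in\mathbb C$ (with $T^{n/2}=(T^{1/2})^n$). (ii) If $\sigma=0$, put $b_n=\sum_{\ell=1}^Mm_{\ell,n}$, where $M=N+1$ if $a>0$ and $M=N$ if $a\le0$. Then $$C(T)=e^{-rT}S_0\sum_{n=1}^\infty b_{n+1}\frac{T^{n}}{n!},\qquad T\ge0,$$ and the series converges for every $T\in\mathbb C$. -/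

import Mathlib

open MeasureTheory ProbabilityTheory Filter Topology
open scoped NNReal ENNReal

/-! ## Formal operations on coefficient sequences

A series `∑_{n ≥ k} f_n z^n` is represented by the sequence `f : ℕ → ℝ`, `f j = f_{k+j}`, of its
coefficients counted from the leading index `k`; the value of `k` is said where it matters. -/

noncomputable section

/-- Reciprocal of a series. If `f j` is the coefficient of `z^(k+j)` in a series with `f 0 ≠ 0`,
then `recipCoeff f j` is the coefficient of `z^(-k+j)` in its reciprocal. It is given by the
determinant of the `j × j` matrix with rows `(f_1, f_2, …, f_j)`, `(f_0, f_1, …, f_{j-1})`,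
`(0, f_0, …, f_{j-2})`, and so on. -/
def recipCoeff (f : ℕ → ℝ) (j : ℕ) : ℝ :=
  (-1) ^ j / f 0 ^ (j + 1) *
    (Matrix.of fun i l : Fin j =>
      if (i : ℕ) ≤ (l : ℕ) + 1 then f ((l : ℕ) + 1 - (i : ℕ)) else 0).det

/-- The exponential partial Bell polynomial `B_{n,m}(x_1, x_2, …)`, i.e. the sum of
`n! ∏_i (x_i / i!)^(c_i) / c_i!` over all `c_1, c_2, … ≥ 0` with `∑ c_i = m` and `∑ i c_i = n`.
The index `i : Fin n` stands for the number `i + 1`. -/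
def partialBell (n m : ℕ) (x : ℕ → ℝ) : ℝ :=
  ∑ c ∈ ((Finset.univ : Finset (Fin n)).piAntidiag m).filter
      (fun c => ∑ i : Fin n, ((i : ℕ) + 1) * c i = n),
    (n.factorial : ℝ) *
      ∏ i : Fin n, (x ((i : ℕ) + 1) / (((i : ℕ) + 1).factorial : ℝ)) ^ c i / ((c i).factorial : ℝ)

/-- Lagrange inversion. If `w = ∑_{n ≥ k} f_n z^n` with `k ≥ 1` and `f j = f_{k+j}`, `f 0 ≠ 0`, then
`invCoeff k f n` is the coefficient of `w^(n/k)` in the inverse series `z = ∑_{n ≥ 1} l_n w^(n/k)`. -/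
def invCoeff (k : ℕ) (f : ℕ → ℝ) (n : ℕ) : ℝ :=
  if n = 0 then 0
  else if n = 1 then 1 / f 0 ^ ((1 : ℝ) / (k : ℝ))
  else 1 / ((n.factorial : ℝ) * f 0 ^ ((n : ℝ) / (k : ℝ))) *
    ∑ m ∈ Finset.Icc 1 (n - 1),
      (-1) ^ m * (ascPochhammer ℝ m).eval ((n : ℝ) / (k : ℝ)) *
        partialBell (n - 1) m (fun j => (j.factorial : ℝ) * (f j / f 0))

/-- Product of two series whose coefficients are indexed from `0`. -/
def mulCoeff (f g : ℕ → ℝ) (n : ℕ) : ℝ := ∑ i ∈ Finset.range (n + 1), f i * g (n - i)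

/-! ## Hyperexponential Lévy processes -/

/-- Parameters of a hyperexponential Lévy process: `σ ≥ 0`, `a ∈ ℝ`, and `N` positive and `Nhat`
negative exponential jump components with weights `α`, `αHat > 0` and rates
`0 < ρ_1 < … < ρ_N`, `0 < ρHat_1 < … < ρHat_Nhat`. The number `ρ_{ℓ+1}` is `ρ ℓ` with `ℓ : Fin N`. -/
structure HyperexpParams where
  σ : ℝ
  a : ℝ
  N : ℕ
  Nhat : ℕ
  α : Fin N → ℝ
  ρ : Fin N → ℝ
  αHat : Fin Nhat → ℝ
  ρHat : Fin Nhat → ℝ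
  σ_nonneg : 0 ≤ σ
  α_pos : ∀ ℓ, 0 < α ℓ
  ρ_pos : ∀ ℓ, 0 < ρ ℓ
  ρ_strictMono : StrictMono ρ
  αHat_pos : ∀ ℓ, 0 < αHat ℓ
  ρHat_pos : ∀ ℓ, 0 < ρHat ℓ
  ρHat_strictMono : StrictMono ρHat

namespace HyperexpParams

variable (p : HyperexpParams)

/-- Density of the Lévy measure. -/
def levyDensity (x : ℝ) : ℝ :=
  if x < 0 then ∑ ℓ, p.αHat ℓ * p.ρHat ℓ * Real.exp (p.ρHat ℓ * x)
  else if 0 < x then ∑ ℓ, p.α ℓ * p.ρ ℓ * Real.exp (-(p.ρ ℓ * x))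
  else 0

/-- The (finite) Lévy measure. -/
def levyMeasure : Measure ℝ :=
  (volume : Measure ℝ).withDensity fun x => ENNReal.ofReal (p.levyDensity x)

/-- The Laplace exponent `ψ`, as a rational function on `ℂ`. -/
def psi (z : ℂ) : ℂ :=
  (p.σ : ℂ) ^ 2 * z ^ 2 / 2 + (p.a : ℂ) * z + z * ∑ ℓ, (p.α ℓ : ℂ) / ((p.ρ ℓ : ℂ) - z)
    - z * ∑ ℓ, (p.αHat ℓ : ℂ) / ((p.ρHat ℓ : ℂ) + z)

/-- The risk-neutral condition `ψ(1) = r > 0` and `ρ_1 > 1` (void if `N = 0`, as `ρ_{N+1} = ∞`). -/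
def RiskNeutral (r : ℝ) : Prop :=
  p.psi 1 = (r : ℂ) ∧ 0 < r ∧ ∀ h : 0 < p.N, 1 < p.ρ ⟨0, h⟩

end HyperexpParams

/-- A real-valued Lévy process on `(Ω, P)`. -/
structure IsLevyProcess {Ω : Type*} [MeasurableSpace Ω] (X : ℝ≥0 → Ω → ℝ) (P : Measure Ω) :
    Prop where
  measurable : ∀ t, Measurable (X t)
  zero : ∀ᵐ ω ∂P, X 0 ω = 0
  indepIncrements : HasIndepIncrements X P
  stationary : ∀ s t, IdentDistrib (fun ω => X (s + t) ω - X s ω) (X t) P P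
  cadlag : ∀ᵐ ω ∂P, ∀ t, ContinuousWithinAt (fun s => X s ω) (Set.Ici t) t ∧
    ∃ l, Tendsto (fun s => X s ω) (𝓝[<] t) (𝓝 l)

/-- `X` is the hyperexponential Lévy process with parameters `p`: a Lévy process with Gaussian
coefficient `σ`, drift `a` and Lévy measure `p.levyMeasure` in its Lévy-Khintchine representation
`E[e^{iuX_t}] = exp(t (i a u - σ²u²/2 + ∫ (e^{iux} - 1) ν(dx)))`. No truncation is needed since
the Lévy measure is finite. -/
def IsHyperexpProcess (p : HyperexpParams) {Ω : Type*} [MeasurableSpace Ω] (X : ℝ≥0 → Ω → ℝ)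
    (P : Measure Ω) : Prop :=
  IsLevyProcess X P ∧ ∀ (t : ℝ≥0) (u : ℝ),
    charFun (P.map (X t)) u =
      Complex.exp (((t : ℝ) : ℂ) * (Complex.I * (p.a : ℂ) * (u : ℂ) - (p.σ : ℂ) ^ 2 * (u : ℂ) ^ 2 / 2
        + ∫ x : ℝ, (Complex.exp (Complex.I * (u : ℂ) * (x : ℂ)) - 1) ∂p.levyMeasure))

/-- Payoff `(S_T - K)^+` of a European call in the model `S_t = S₀ e^{X_t}`. -/
def callPayoff {Ω : Type*} (X : ℝ≥0 → Ω → ℝ) (S₀ K : ℝ) (T : ℝ≥0) (ω : Ω) : ℝ :=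
  max 0 (S₀ * Real.exp (X T ω) - K)

/-- Price `C(T) = e^{-rT} E[(S_T - K)^+]` of a European call. -/
def callPrice {Ω : Type*} [MeasurableSpace Ω] (X : ℝ≥0 → Ω → ℝ) (P : Measure Ω) (r S₀ K : ℝ)
    (T : ℝ≥0) : ℝ :=
  Real.exp (-r * T) * ∫ ω, callPayoff X S₀ K T ω ∂P

namespace HyperexpParams

variable (p : HyperexpParams)

/-! ## Expansions of the roots of `ψ(z) = q` near `q = ∞` -/

/-- The coefficient `η_n` of `z^n`, `n ≥ 0`, in the expansion of `h(z) = ψ(1/z)` at `0`. -/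
def eta (n : ℕ) : ℝ :=
  -((∑ ℓ, p.α ℓ * p.ρ ℓ ^ n) + (-1) ^ n * ∑ ℓ, p.αHat ℓ * p.ρHat ℓ ^ n)

/-- Coefficients of `h(z) = ψ(1/z)` counted from `z^(-2)`; the relevant ones if `σ > 0`. -/
def hGauss : ℕ → ℝ
  | 0 => p.σ ^ 2 / 2
  | 1 => p.a
  | n + 2 => p.eta n

/-- Coefficients of `h(z) = ψ(1/z)` counted from `z^(-1)`, if `σ = 0`. -/
def hDrift : ℕ → ℝ
  | 0 => p.a
  | n + 1 => p.eta n

/-- The numbers `ω_{ℓ,n}`. -/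
def omega (ℓ : Fin p.N) (n : ℕ) : ℝ :=
  if n = 0 then
    (∑ i ∈ Finset.univ.erase ℓ, p.α i * p.ρ ℓ / (p.ρ i - p.ρ ℓ))
      - (∑ i, p.αHat i * p.ρ ℓ / (p.ρHat i + p.ρ ℓ)) - p.α ℓ
  else
    (∑ i ∈ Finset.univ.erase ℓ, p.α i * p.ρ i / (p.ρ i - p.ρ ℓ) ^ (n + 1))
      + (-1) ^ n * ∑ i, p.αHat i * p.ρHat i / (p.ρHat i + p.ρ ℓ) ^ (n + 1)

/-- Coefficients of `g(z; ℓ) = ψ(z + ρ_ℓ)` at `0`, counted from `z^(-1)`. -/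
def gCoeff (ℓ : Fin p.N) : ℕ → ℝ
  | 0 => -(p.α ℓ * p.ρ ℓ)
  | 1 => p.σ ^ 2 * p.ρ ℓ ^ 2 / 2 + p.a * p.ρ ℓ + p.omega ℓ 0
  | 2 => p.σ ^ 2 * p.ρ ℓ + p.a + p.omega ℓ 1
  | 3 => p.σ ^ 2 / 2 + p.omega ℓ 2
  | n + 4 => p.omega ℓ (n + 3)

/-- Coefficient of `q^(-n)`, `n ≥ 0`, in the expansion of the root `ζ_ℓ`, `1 ≤ ℓ ≤ N`. -/
def zetaCoeff (ℓ : Fin p.N) (n : ℕ) : ℝ :=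
  if n = 0 then p.ρ ℓ else invCoeff 1 (recipCoeff (p.gCoeff ℓ)) n

/-- Coefficient of `q^(-n)` in `ξ_ℓ = 1 / ζ_ℓ`. -/
def xiCoeff (ℓ : Fin p.N) (n : ℕ) : ℝ := recipCoeff (p.zetaCoeff ℓ) n

/-- Coefficient of `q^(-n)` in `ς_ℓ = 1 / (ζ_ℓ - 1)`. -/
def varsigmaCoeff (ℓ : Fin p.N) (n : ℕ) : ℝ :=
  recipCoeff (fun j => if j = 0 then p.zetaCoeff ℓ 0 - 1 else p.zetaCoeff ℓ j) n

/-- Coefficient of `q^(-n)` in the derivative `ζ_ℓ'`. -/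
def zetaDerivCoeff (ℓ : Fin p.N) (n : ℕ) : ℝ :=
  if n < 2 then 0 else (1 - (n : ℝ)) * p.zetaCoeff ℓ (n - 1)

/-- Coefficient `m_{ℓ,n}` of `q^(-n)` in `ξ_ℓ ς_ℓ ζ_ℓ'`, `1 ≤ ℓ ≤ N`. -/
def mCoeff (ℓ : Fin p.N) (n : ℕ) : ℝ :=
  mulCoeff (mulCoeff (p.xiCoeff ℓ) (p.varsigmaCoeff ℓ)) (p.zetaDerivCoeff ℓ) n

end HyperexpParams

/-! The additional positive root `ζ_{N+1}`, which tends to infinity with `q`, has an expansion in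
powers of `q^(-1/k)`, where `k = 2` if `σ > 0` and `k = 1` if `σ = 0`, `a > 0`. Below `h` is the
sequence of coefficients of `ψ(1/z)` counted from `z^(-k)`. -/

/-- Coefficient `c_n` of `q^(-n/k)` in `ξ_{N+1} = 1 / ζ_{N+1}`; it vanishes for `n = 0`. -/
def extraXiCoeff (k : ℕ) (h : ℕ → ℝ) (n : ℕ) : ℝ := invCoeff k (recipCoeff h) n

/-- Coefficients of `ζ_{N+1}` counted from `q^(1/k)`: `extraZetaCoeff k h j` belongs to
`q^(-(j-1)/k)`. -/
def extraZetaCoeff (k : ℕ) (h : ℕ → ℝ) (j : ℕ) : ℝ :=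
  recipCoeff (fun i => extraXiCoeff k h (i + 1)) j

/-- Coefficient of `q^(-n/k)` in `ς_{N+1} = 1 / (ζ_{N+1} - 1)`. -/
def extraVarsigmaCoeff (k : ℕ) (h : ℕ → ℝ) (n : ℕ) : ℝ :=
  if n = 0 then 0
  else recipCoeff (fun j => if j = 1 then extraZetaCoeff k h 1 - 1 else extraZetaCoeff k h j) (n - 1)

/-- Coefficient of `q^(-n/k)` in the derivative `ζ_{N+1}'`. -/
def extraZetaDerivCoeff (k : ℕ) (h : ℕ → ℝ) (n : ℕ) : ℝ :=
  if n + 1 < k then 0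
  else (((k : ℝ) - (n : ℝ)) / (k : ℝ)) * extraZetaCoeff k h (n + 1 - k)

/-- Coefficient `m_{N+1,n}` of `q^(-n/k)` in `ξ_{N+1} ς_{N+1} ζ_{N+1}'`. -/
def extraMCoeff (k : ℕ) (h : ℕ → ℝ) (n : ℕ) : ℝ :=
  mulCoeff (mulCoeff (extraXiCoeff k h) (extraVarsigmaCoeff k h)) (extraZetaDerivCoeff k h) n

namespace HyperexpParams

variable (p : HyperexpParams)

/-- The coefficients `b_n` in the case `σ > 0` (where `M = N + 1`). -/
def bGauss (n : ℕ) : ℝ :=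
  if Even n then (∑ ℓ, p.mCoeff ℓ (n / 2)) + extraMCoeff 2 p.hGauss n
  else extraMCoeff 2 p.hGauss n

/-- The coefficients `b_n` in the case `σ = 0` (where `M = N + 1` if `a > 0` and `M = N` if
`a ≤ 0`). -/
def bNoGauss (n : ℕ) : ℝ :=
  if 0 < p.a then (∑ ℓ, p.mCoeff ℓ n) + extraMCoeff 1 p.hDrift n
  else ∑ ℓ, p.mCoeff ℓ n

end HyperexpParams

end

/-! ## Formal power series behind the coefficient operations -/

section FormalSeries

open PowerSeries

/-! The price is `e^{-rT} S₀ E[(e^{X_T} - 1)^+]`, so the task is to expand `m(t) = E[(e^{X_t} -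
1)^+]` (`payoffMean`) in powers of `t`. This is done by computing its Laplace transform near `q = ∞`
and inverting it term by term.

Fix `c` with `1 < c < ρ_1`. On the line `z = c + iy` the payoff is the Fourier-type integral `2π
(e^x - 1)^+ = ∫ e^{zx} / (z(z-1)) dy` (`integral_payoff`). The law of `X_t` is a Gaussian law
convolved with a compound Poisson law, so `E[e^{zX_t}] = e^{tψ(z)}` for `0 ≤ Re z < ρ_1`.
Integrating over the law and then against `e^{-qt}` gives `2π ∫_0^∞ e^{-qt} m(t) dt = ∫ dy / (z
(z-1) (q - ψ(z)))` for `q > ψ(c)` (`integral_exp_mul_payoffMean`).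

Closing this contour to the right leaves the residues at the roots `ζ` of `ψ(z) = q`, each
contributing `1 / (ζ (ζ-1) ψ'(ζ))`. Differentiating `ψ(ζ(q)) = q` gives `1/ψ'(ζ) = ζ'(q)`, so the
contribution is `ξ ς ζ'` with `ξ = 1/ζ` and `ς = 1/(ζ-1)`. For large `q` there is exactly one root
near each pole `ρ_ℓ`, one further root tending to `+∞` if `σ > 0` or if `σ = 0 < a`, and no other
root to the right of `1`: away from the poles and from infinity `ψ` is bounded, hence different from
`q` (`exists_eventually_integral_eq`).

Each root is obtained by inverting an analytic function with a simple zero: `1/ψ(ρ_ℓ + z)` at a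
pole, and a `k`-th root of `1/ψ(1/z)` at infinity. Lagrange inversion expresses the coefficients of
the inverse through Bell polynomials (`lagrange_coeff`, `natCast_mul_invCoeff`), and Cramer's rule
those of a reciprocal through determinants (`recipCoeff_eq_of_mul_eq_one`). Thus the transform
equals `L(q^{-1/k})` with `L` analytic at `0` and Taylor coefficients `b_n`, which vanish for `n ≤
k`.

Finally `q^{-n/k-1}` is the transform of `t^{n/k} / Γ(n/k+1)`. The coefficients `b_n` grow at most
geometrically, so the Gamma factors make the resulting series converge everywhere. Its sum is
continuous with the same transform as `m`, and a continuous function is determined by its Laplace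
transform (`eqOn_of_laplace_eq`). -/

theorem coeff_mk_mul_mk (f g : ℕ → ℝ) (n : ℕ) :
    coeff n (PowerSeries.mk f * PowerSeries.mk g) = mulCoeff f g n := by
  rw [coeff_mul, Finset.Nat.sum_antidiagonal_eq_sum_range_succ_mk, mulCoeff]
  simp

/-- The determinants in `recipCoeff` are the coefficients of the reciprocal power series. -/
theorem recipCoeff_eq_of_mul_eq_one (f b : ℕ → ℝ)
    (h : PowerSeries.mk f * PowerSeries.mk b = 1) : b = recipCoeff f := by
  have hf0 : f 0 ≠ 0 := by
    intro h0
    have := congrArg (coeff 0) h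
    simp [h0] at this
  funext j
  -- Coefficients `0, …, j` of `f * b = 1`, read in reverse order, form an upper triangular Toeplitz
  -- system: `A` maps `(b_j, …, b_0)` to the last basis vector. Cramer's rule for the first entry
  -- yields `b_j`; the minor without last row and first column is the matrix of `recipCoeff`.
  let A : Matrix (Fin (j + 1)) (Fin (j + 1)) ℝ :=
    Matrix.of fun i l => if (i : ℕ) ≤ l then f ((l : ℕ) - i) else 0
  have hdet : A.det = f 0 ^ (j + 1) := by
    rw [Matrix.det_of_isUpperTriangular]
    · simp [A]
    · intro i l hil
      have : ¬ ((i : ℕ) ≤ l) := by simpa using hil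
      exact if_neg this
  let v : Fin (j + 1) → ℝ := fun l => b (j - l)
  have hv : A.mulVec v = Pi.single (Fin.last j) 1 := by
    funext i
    have h1 : (A.mulVec v) i =
        ∑ l ∈ Finset.range (j + 1), (if (i : ℕ) ≤ l then f (l - i) else 0) * b (j - l) := by
      rw [← Fin.sum_univ_eq_sum_range
        (fun l => (if (i : ℕ) ≤ l then f (l - i) else 0) * b (j - l))]
      rfl
    have h2 : (A.mulVec v) i = ∑ k ∈ Finset.range (j - i + 1), f k * b (j - i - k) := by
      rw [h1]
      rw [← Finset.sum_range_add_sum_Ico _ (show (i : ℕ) ≤ j + 1 by omega),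
        Finset.sum_eq_zero, zero_add, Finset.sum_Ico_eq_sum_range,
        show j + 1 - (i : ℕ) = j - i + 1 by omega]
      · refine Finset.sum_congr rfl fun k _ => ?_
        rw [if_pos (by omega), show (i : ℕ) + k - i = k by omega,
          show j - (i + k) = j - i - k by omega]
      · intro l hl
        rw [if_neg (by simpa using hl), zero_mul]
    have h3 := congrArg (coeff (j - i)) h
    rw [coeff_mk_mul_mk, mulCoeff, ← h2, coeff_one] at h3
    rw [h3, Pi.single_apply]
    congr 1
    simp only [Fin.ext_iff, Fin.val_last, eq_iff_iff]
    omega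
  have key : A.det * b j = A.adjugate 0 (Fin.last j) := by
    have h1 : (A.adjugate.mulVec (A.mulVec v)) 0 = A.det * b j := by
      rw [Matrix.mulVec_mulVec, Matrix.adjugate_mul, Matrix.smul_mulVec, Matrix.one_mulVec]
      simp [v]
    rw [← h1, hv, Matrix.mulVec_single_one]
    rfl
  rw [Matrix.adjugate_fin_succ_eq_det_submatrix, hdet] at key
  have hs : A.submatrix (Fin.last j).succAbove (0 : Fin (j + 1)).succAbove =
      Matrix.of fun i l : Fin j =>
        if (i : ℕ) ≤ (l : ℕ) + 1 then f ((l : ℕ) + 1 - (i : ℕ)) else 0 := by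
    refine Matrix.ext fun i l => ?_
    rw [Matrix.submatrix_apply, Fin.succAbove_last, Fin.succAbove_zero]
    rfl
  rw [hs] at key
  have hp : f 0 ^ (j + 1) ≠ 0 := pow_ne_zero _ hf0
  rw [recipCoeff, div_mul_eq_mul_div, eq_div_iff hp, mul_comm, key]
  simp

theorem mk_mul_mk_recipCoeff (f : ℕ → ℝ) (hf : f 0 ≠ 0) :
    PowerSeries.mk f * PowerSeries.mk (recipCoeff f) = 1 := by
  have h : PowerSeries.mk f * (PowerSeries.mk f)⁻¹ = 1 :=
    PowerSeries.mul_inv_cancel _ (by simpa using hf)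
  have h2 : PowerSeries.mk (fun n => coeff n (PowerSeries.mk f)⁻¹) = (PowerSeries.mk f)⁻¹ := by
    ext; simp
  rw [← recipCoeff_eq_of_mul_eq_one f (fun n => coeff n (PowerSeries.mk f)⁻¹) (by rw [h2, h]), h2, h]

theorem recipCoeff_zero (f : ℕ → ℝ) : recipCoeff f 0 = 1 / f 0 := by
  simp [recipCoeff]

/-- Powers of a power series without constant term in terms of partial Bell polynomials. -/
theorem coeff_pow_eq_partialBell (x : ℕ → ℝ) (u : ℝ⟦X⟧) (hu : constantCoeff u = 0)
    (n m : ℕ) (hx : ∀ j, x (j + 1) = ((j + 1).factorial : ℝ) * coeff (j + 1) u) :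
    coeff n (u ^ m) = (m.factorial : ℝ) / n.factorial * partialBell n m x := by
  -- The `n`-th coefficient of `u ^ m` depends on `u` modulo `X ^ (n + 1)` only. The truncation is a
  -- finite sum, so the multinomial theorem applies, and the condition of total weight `n` selects
  -- the terms of the Bell polynomial.
  let t : ℝ⟦X⟧ := ∑ i : Fin n, C (coeff ((i : ℕ) + 1) u) * X ^ ((i : ℕ) + 1)
  have hdvd : X ^ (n + 1) ∣ u - t := by
    rw [X_pow_dvd_iff]
    intro k hk
    rcases k with _ | k
    · have : coeff 0 t = 0 := by
        simp only [t, map_sum, coeff_C_mul, coeff_X_pow]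
        exact Finset.sum_eq_zero fun i _ => by simp
      rw [map_sub, this, coeff_zero_eq_constantCoeff, hu, sub_zero]
    · have : coeff (k + 1) t = coeff (k + 1) u := by
        simp only [t, map_sum, coeff_C_mul, coeff_X_pow]
        rw [Finset.sum_eq_single (⟨k, by omega⟩ : Fin n)]
        · simp
        · intro b _ hb
          have : k ≠ b := fun h => hb (Fin.ext h.symm)
          simp [this]
        · simp
      rw [map_sub, this, sub_self]
  have h1 : coeff n (u ^ m) = coeff n (t ^ m) := by
    have h2 := hdvd.trans (sub_dvd_pow_sub_pow u t m)
    rw [X_pow_dvd_iff] at h2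
    have := h2 n (by omega)
    rwa [map_sub, sub_eq_zero] at this
  rw [h1, Finset.sum_pow_eq_sum_piAntidiag, map_sum, partialBell, Finset.sum_filter,
    Finset.mul_sum]
  refine Finset.sum_congr rfl fun c hc => ?_
  rw [Finset.mem_piAntidiag] at hc
  have hprod : ∏ i : Fin n, (C (coeff ((i : ℕ) + 1) u) * X ^ ((i : ℕ) + 1)) ^ c i =
      C (∏ i : Fin n, (coeff ((i : ℕ) + 1) u) ^ c i) * X ^ (∑ i : Fin n, ((i : ℕ) + 1) * c i) := by
    simp only [mul_pow, Finset.prod_mul_distrib, ← pow_mul, Finset.prod_pow_eq_pow_sum, map_prod,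
      map_pow]
  have hm := Nat.multinomial_spec Finset.univ c
  rw [hc.1] at hm
  have hmul : (Nat.multinomial Finset.univ c : ℝ) =
      (m.factorial : ℝ) / ∏ i, ((c i).factorial : ℝ) := by
    rw [eq_div_iff (Finset.prod_ne_zero_iff.2 fun i _ => by positivity), ← hm]
    push_cast
    ring
  have hcast : ((Nat.multinomial Finset.univ c : ℕ) : ℝ⟦X⟧) =
      C (Nat.multinomial Finset.univ c : ℝ) := by simp
  rw [hprod, hcast, coeff_C_mul, coeff_C_mul, coeff_X_pow, hmul]
  by_cases hs : ∑ i : Fin n, ((i : ℕ) + 1) * c i = n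
  · rw [if_pos hs.symm, if_pos hs, mul_one, ← mul_assoc,
      div_mul_cancel₀ _ (by positivity : (n.factorial : ℝ) ≠ 0), Finset.prod_div_distrib,
      div_mul_eq_mul_div, mul_div_assoc]
    congr 2
    refine Finset.prod_congr rfl fun i _ => ?_
    rw [hx, mul_div_cancel_left₀ _ (by positivity)]
  · rw [if_neg (fun h => hs h.symm), if_neg hs, mul_zero, mul_zero, mul_zero]

/-- The substituted series is the formal power `(1 + u)^s`. The sum stops at `n` because `X ^ m`
divides `u ^ m`. -/
theorem coeff_subst_binomialSeries (s : ℝ) (u : ℝ⟦X⟧) (hu : constantCoeff u = 0) (n : ℕ) :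
    coeff n ((PowerSeries.binomialSeries ℝ s).subst u) =
      ∑ m ∈ Finset.range (n + 1), Ring.choose s m * coeff n (u ^ m) := by
  rw [coeff_subst' (HasSubst.of_constantCoeff_zero' hu), finsum_eq_sum_of_support_subset (s := Finset.range (n + 1))]
  · simp
  · intro m hm
    rw [Function.mem_support] at hm
    rw [Finset.coe_range, Set.mem_Iio]
    by_contra hlt
    apply hm
    have : coeff n (u ^ m) = 0 := by
      have h1 : X ^ m ∣ u ^ m := pow_dvd_pow_of_dvd (X_dvd_iff.2 hu) m
      exact X_pow_dvd_iff.1 h1 n (by omega)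
    rw [this, smul_zero]

/-- For `x = n/k` this turns the binomial coefficients of `(1 + u)^(-n/k)` into the signed
Pochhammer symbols of `invCoeff`. -/
theorem ringChoose_neg_eq (x : ℝ) (m : ℕ) :
    Ring.choose (-x) m * (m.factorial : ℝ) = (-1) ^ m * (ascPochhammer ℝ m).eval x := by
  rw [Ring.choose_neg']
  have h := Ring.factorial_nsmul_multichoose_eq_ascPochhammer x m
  rw [nsmul_eq_mul, Polynomial.ascPochhammer_smeval_eq_eval] at h
  rw [← h, Units.smul_def, zsmul_eq_mul]
  push_cast [Int.negOnePow_def]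
  simp only [zpow_natCast, Units.val_pow_eq_pow_val, Units.val_neg, Units.val_one]
  push_cast
  ring

end FormalSeries

/-! ### Lagrange inversion for formal power series -/

section Lagrange

open PowerSeries

/-- Lagrange inversion: if `z = ∑ l_i Φ^i` up to order `n` with `Φ = z U`, then
`n l_n = [z^(n-1)] U^(-n)`. -/
theorem lagrange_coeff {𝕜 : Type*} [Field 𝕜] [CharZero 𝕜] (U W : 𝕜⟦X⟧) (l : ℕ → 𝕜) (n : ℕ) (hn : 1 ≤ n)
    (hU : constantCoeff U ≠ 0)
    (h : (X : 𝕜⟦X⟧) = ∑ i ∈ Finset.range (n + 1), C (l i) * (X * U) ^ i + X ^ (n + 1) * W) :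
    (n : 𝕜) * l n = coeff (n - 1) (U⁻¹ ^ n) := by
  set V := U⁻¹ with hV
  have hUV : U * V = 1 := PowerSeries.mul_inv_cancel _ hU
  set dP := derivative 𝕜 (X * U) with hdP
  have hdP' : dP = U + X * derivative 𝕜 U := by
    rw [hdP, Derivation.leibniz, derivative_X]
    simp [add_comm]
  have hdV : U * derivative 𝕜 V = - V * derivative 𝕜 U := by
    have := congrArg (derivative 𝕜) hUV
    rw [Derivation.leibniz] at this
    simp only [smul_eq_mul, Derivation.map_one_eq_zero] at this
    linear_combination this
  have hd := congrArg (derivative 𝕜) h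
  rw [derivative_X, map_add, map_sum] at hd
  -- With `Φ = X U`, this coefficient is the formal residue of `Φ' Φ^(-m-1)`: it is `1` for `m = 0`
  -- and vanishes otherwise, the form then being exact. Hence, after differentiating `h`,
  -- multiplying by `V ^ n` and reading coefficient `n - 1`, only the term `i = n` of the sum
  -- survives.
  have hres : ∀ m : ℕ, coeff m (V ^ (m + 1) * dP) = if m = 0 then 1 else 0 := by
    intro m
    rcases m with _ | m
    · have : V ^ (0 + 1) * dP = 1 + X * (V * derivative 𝕜 U) := by
        rw [hdP']; linear_combination hUV
      rw [this]; simp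
    · have e1 : ((m : 𝕜⟦X⟧) + 1) * (V ^ (m + 2) * dP) =
          ((m : 𝕜⟦X⟧) + 1) * V ^ (m + 1) - X * derivative 𝕜 (V ^ (m + 1)) := by
        rw [hdP', Derivation.leibniz_pow]
        simp only [nsmul_eq_mul, smul_eq_mul, Nat.add_sub_cancel]
        push_cast
        have e2 : derivative 𝕜 V = - V ^ 2 * derivative 𝕜 U := by
          linear_combination V * hdV - derivative 𝕜 V * hUV
        rw [e2]
        linear_combination ((m : 𝕜⟦X⟧) + 1) * V ^ (m + 1) * hUV
      have e3 := congrArg (coeff (m + 1)) e1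
      have e4 : ((m : 𝕜⟦X⟧) + 1) = C ((m : 𝕜) + 1) := by simp
      rw [e4, map_sub, coeff_C_mul, coeff_C_mul, coeff_succ_X_mul, coeff_derivative] at e3
      rw [if_neg (by omega)]
      have e5 : ((m : 𝕜) + 1) * coeff (m + 1) (V ^ (m + 2) * dP) = 0 := by rw [e3]; ring
      rcases mul_eq_zero.1 e5 with h0 | h0
      · exact absurd h0 (Nat.cast_add_one_ne_zero m)
      · exact h0
  have hterm : ∀ i ∈ Finset.range (n + 1),
      coeff (n - 1) (V ^ n * derivative 𝕜 (C (l i) * (X * U) ^ i)) =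
        if i = n then (n : 𝕜) * l n else 0 := by
    intro i hi
    rw [Finset.mem_range] at hi
    have e1 : derivative 𝕜 (C (l i) * (X * U) ^ i) = C (i * l i) * ((X * U) ^ (i - 1) * dP) := by
      rw [Derivation.leibniz, derivative_C, Derivation.leibniz_pow]
      simp only [smul_eq_mul, nsmul_eq_mul, mul_zero, add_zero, map_mul, map_natCast]
      ring
    rcases i with _ | i
    · rw [if_neg (by omega)]; simp
    · obtain ⟨d, rfl⟩ : ∃ d, n = i + 1 + d := ⟨n - (i + 1), by omega⟩
      have e2 : V ^ (i + 1 + d) * derivative 𝕜 (C (l (i + 1)) * (X * U) ^ (i + 1)) =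
          X ^ i * (C (((i + 1 : ℕ) : 𝕜) * l (i + 1)) * (V ^ (d + 1) * dP)) := by
        rw [e1, Nat.add_sub_cancel]
        have : (U * V) ^ i = 1 := by rw [hUV, one_pow]
        rw [mul_pow] at this
        rw [mul_pow, show i + 1 + d = i + (d + 1) by omega, pow_add]
        linear_combination X ^ i * C (((i + 1 : ℕ) : 𝕜) * l (i + 1)) * V ^ (d + 1) * dP * this
      rw [e2, show i + 1 + d - 1 = d + i by omega, coeff_X_pow_mul, coeff_C_mul, hres]
      by_cases hd0 : d = 0
      · subst hd0; simp
      · rw [if_neg hd0, if_neg (by omega), mul_zero]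
  have hW : coeff (n - 1) (V ^ n * derivative 𝕜 (X ^ (n + 1) * W)) = 0 := by
    have e1 : V ^ n * derivative 𝕜 (X ^ (n + 1) * W) =
        X ^ n * (V ^ n * (X * derivative 𝕜 W + ((n : 𝕜⟦X⟧) + 1) * W)) := by
      rw [Derivation.leibniz, Derivation.leibniz_pow, derivative_X]
      simp only [smul_eq_mul, nsmul_eq_mul, Nat.add_sub_cancel]
      push_cast
      ring
    rw [e1]
    exact X_pow_dvd_iff.1 (Dvd.intro _ rfl) _ (by omega)
  have h2 := congrArg (fun s => coeff (n - 1) (V ^ n * s)) hd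
  simp only [mul_one, mul_add, map_add, Finset.mul_sum, map_sum] at h2
  rw [hW, Finset.sum_congr rfl hterm] at h2
  rw [h2]
  simp

theorem subst_binomialSeries_add (s t : ℝ) (u : ℝ⟦X⟧) (hu : constantCoeff u = 0) :
    (PowerSeries.binomialSeries ℝ (s + t)).subst u =
      (PowerSeries.binomialSeries ℝ s).subst u * (PowerSeries.binomialSeries ℝ t).subst u := by
  rw [binomialSeries_add, subst_mul (HasSubst.of_constantCoeff_zero' hu)]

theorem subst_binomialSeries_nat (n : ℕ) (u : ℝ⟦X⟧) (hu : constantCoeff u = 0) :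
    (PowerSeries.binomialSeries ℝ (n : ℝ)).subst u = (1 + u) ^ n := by
  have hs := HasSubst.of_constantCoeff_zero' hu
  rw [binomialSeries_nat, ← coe_substAlgHom hs, map_pow, map_add, map_one, substAlgHom_X]

/-- `invCoeff` is the Lagrange inversion coefficient of `z U(z)`, where `U^k = f`. -/
theorem natCast_mul_invCoeff (k : ℕ) (hk : k = 1 ∨ k = 2) (f : ℕ → ℝ) (U : ℝ⟦X⟧)
    (hUk : U ^ k = PowerSeries.mk f) (hU0 : constantCoeff U ≠ 0)
    (hU : k = 2 → 0 < constantCoeff U) (n : ℕ) (hn : 1 ≤ n) :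
    (n : ℝ) * invCoeff k f n = coeff (n - 1) (U⁻¹ ^ n) := by
  set c := constantCoeff U with hc
  have hkpos : (k : ℝ) ≠ 0 := by rcases hk with rfl | rfl <;> norm_num
  have hck : c ^ k = f 0 := by
    rw [hc, ← map_pow, hUk, ← coeff_zero_eq_constantCoeff_apply, coeff_mk]
  have hf0 : f 0 ≠ 0 := hck ▸ pow_ne_zero _ hU0
  have hpow : ∀ m : ℕ, f 0 ^ ((m : ℝ) / k) = c ^ m := by
    intro m
    rcases hk with rfl | rfl
    · rw [← hck]; simp
    · have := hU rfl
      rw [← hck, ← Real.rpow_natCast c 2, ← Real.rpow_mul this.le, mul_div_cancel₀ _ hkpos,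
        Real.rpow_natCast]
  set u : ℝ⟦X⟧ := C (f 0)⁻¹ * PowerSeries.mk f - 1 with hu
  have hu0 : constantCoeff u = 0 := by
    rw [hu, ← coeff_zero_eq_constantCoeff_apply, map_sub, coeff_C_mul]
    simp [hf0]
  have hfu : PowerSeries.mk f = C (f 0) * (1 + u) := by
    have : C (f 0) * C (f 0)⁻¹ = (1 : ℝ⟦X⟧) := by
      rw [← map_mul, mul_inv_cancel₀ hf0, map_one]
    rw [hu]
    linear_combination (- PowerSeries.mk f) * this
  -- Since `f = f 0 * (1 + u)`, the series `B = (1 + u)^(-n/k)` rescaled by `c^(-n)` has the same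
  -- `k`-th power as `U⁻¹ ^ n`.
  set B : ℝ⟦X⟧ := (PowerSeries.binomialSeries ℝ (-((n : ℝ) / k))).subst u with hB
  have hBk : B ^ k = (PowerSeries.binomialSeries ℝ (-(n : ℝ))).subst u := by
    rcases hk with rfl | rfl
    · simp [hB]
    · rw [hB, pow_two, ← subst_binomialSeries_add _ _ _ hu0]
      congr 2
      push_cast
      ring
  have hB1 : B ^ k * (1 + u) ^ n = 1 := by
    rw [hBk, ← subst_binomialSeries_nat n u hu0, ← subst_binomialSeries_add _ _ _ hu0,
      neg_add_cancel]
    have := subst_binomialSeries_nat 0 u hu0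
    simpa using this
  have hB0 : constantCoeff B = 1 := by
    rw [← coeff_zero_eq_constantCoeff_apply, hB, coeff_subst_binomialSeries _ _ hu0]
    simp
  have hUi : U * U⁻¹ = 1 := PowerSeries.mul_inv_cancel _ hU0
  set Y : ℝ⟦X⟧ := C (c ^ n)⁻¹ * B with hY
  have hcn : C (c ^ n)⁻¹ ^ k * C (f 0) ^ n = (1 : ℝ⟦X⟧) := by
    rw [← map_pow (C (R := ℝ)), ← map_pow (C (R := ℝ)), ← map_mul (C (R := ℝ)), ← hck, ← pow_mul,
      inv_pow, ← pow_mul, mul_comm k n, inv_mul_cancel₀ (pow_ne_zero _ hU0), map_one]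
  have hYk : Y ^ k * (U ^ k) ^ n = 1 := by
    rw [hUk, hfu, hY, mul_pow, mul_pow]
    linear_combination hB1 + B ^ k * (1 + u) ^ n * hcn
  have hYk' : Y ^ k = (U⁻¹ ^ n) ^ k := by
    have h1 : (U ^ k) ^ n * (U⁻¹ ^ n) ^ k = 1 := by
      rw [← pow_mul, ← pow_mul, mul_comm n k, ← mul_pow, hUi, one_pow]
    linear_combination (U⁻¹ ^ n) ^ k * hYk - Y ^ k * h1
  have hconst : constantCoeff (U⁻¹) = c⁻¹ := by simp [hc]
  -- For `k = 2` equal squares leave a sign open; positivity of both constant terms fixes it.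
  have hYU : U⁻¹ ^ n = Y := by
    rcases hk with rfl | rfl
    · simpa using hYk'.symm
    · rcases sq_eq_sq_iff_eq_or_eq_neg.1 hYk' with h | h
      · exact h.symm
      · exfalso
        have h1 := congrArg constantCoeff h
        rw [map_neg, map_pow, hconst, hY, map_mul, hB0] at h1
        have hp : 0 < (c ^ n)⁻¹ := by have := hU rfl; positivity
        rw [constantCoeff_C, inv_pow, mul_one] at h1
        linarith
  rw [hYU, hY, coeff_C_mul, hB, coeff_subst_binomialSeries _ _ hu0]
  rcases (show n = 1 ∨ 2 ≤ n by omega) with rfl | hn2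
  · have := hpow 1
    rw [Nat.cast_one] at this
    simp only [invCoeff, one_ne_zero, if_false, if_true, Nat.cast_one, this]
    simp
  · rw [invCoeff, if_neg (by omega), if_neg (by omega), hpow]
    obtain ⟨d, rfl⟩ : ∃ d, n = d + 2 := ⟨n - 2, by omega⟩
    rw [show d + 2 - 1 = d + 1 by omega]
    have hIcc : Finset.range (d + 1 + 1) = insert 0 (Finset.Icc 1 (d + 1)) := by
      ext i; simp; omega
    have hfac : ((d + 2).factorial : ℝ) = ((d + 2 : ℕ) : ℝ) * (d + 1).factorial := by
      rw [Nat.factorial_succ (d + 1)]; push_cast; ring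
    rw [hIcc, Finset.sum_insert (by simp), pow_zero, coeff_one, if_neg (by omega), mul_zero,
      zero_add, hfac, Finset.mul_sum, Finset.mul_sum, Finset.mul_sum]
    refine Finset.sum_congr rfl fun m _ => ?_
    rw [coeff_pow_eq_partialBell (fun j => (j.factorial : ℝ) * (f j / f 0)) u hu0,
      ← ringChoose_neg_eq]
    · have h1 : ((d + 2 : ℕ) : ℝ) ≠ 0 := by positivity
      have h2 : ((d + 1).factorial : ℝ) ≠ 0 := by positivity
      have h3 : c ^ (d + 2) ≠ 0 := pow_ne_zero _ hU0
      field_simp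
    · intro j
      rw [hu, map_sub, coeff_C_mul, coeff_mk, coeff_one, if_neg (by omega), sub_zero]
      field_simp

end Lagrange

/-! ## Taylor series at the origin -/

section Taylor

open PowerSeries

/-- `f` is the sum of the power series `s` near the origin. -/
def HasTaylor (f : ℂ → ℂ) (s : ℂ⟦X⟧) : Prop :=
  ∀ᶠ z in 𝓝 (0 : ℂ), HasSum (fun n => coeff n s * z ^ n) (f z)

theorem hasTaylor_iff (f : ℂ → ℂ) (s : ℂ⟦X⟧) :
    HasTaylor f s ↔
      HasFPowerSeriesAt f (FormalMultilinearSeries.ofScalars ℂ fun n => coeff n s) 0 := by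
  rw [hasFPowerSeriesAt_iff, HasTaylor]
  simp [FormalMultilinearSeries.coeff_ofScalars, mul_comm]

namespace HasTaylor

variable {f g : ℂ → ℂ} {s t : ℂ⟦X⟧}

theorem analyticAt (h : HasTaylor f s) : AnalyticAt ℂ f 0 :=
  ((hasTaylor_iff f s).1 h).analyticAt

theorem congr (h : HasTaylor f s) (hfg : f =ᶠ[𝓝 0] g) : HasTaylor g s := by
  filter_upwards [h, hfg] with z h1 h2
  rwa [← h2]

/-- The bridge between analysis and algebra: an identity between functions near `0` becomes an
identity between formal series. -/
theorem unique (h : HasTaylor f s) (h' : HasTaylor f t) : s = t := by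
  have := ((hasTaylor_iff f s).1 h).eq_formalMultilinearSeries ((hasTaylor_iff f t).1 h')
  ext n
  have h2 := congrArg (fun p => FormalMultilinearSeries.coeff p n) this
  simpa [FormalMultilinearSeries.coeff_ofScalars] using h2

theorem add (hf : HasTaylor f s) (hg : HasTaylor g t) : HasTaylor (fun z => f z + g z) (s + t) := by
  filter_upwards [hf, hg] with z h1 h2
  simpa [add_mul] using h1.add h2

theorem mul (hf : HasTaylor f s) (hg : HasTaylor g t) : HasTaylor (fun z => f z * g z) (s * t) := by
  filter_upwards [hf, hg] with z h1 h2
  have h1n := summable_norm_iff.2 h1.summable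
  have h2n := summable_norm_iff.2 h2.summable
  have h3 := summable_norm_sum_mul_antidiagonal_of_summable_norm h1n h2n
  have h4 := tsum_mul_tsum_eq_tsum_sum_antidiagonal_of_summable_norm h1n h2n
  rw [h1.tsum_eq, h2.tsum_eq] at h4
  have h5 : (fun n => coeff n (s * t) * z ^ n) = fun n =>
      ∑ kl ∈ Finset.HasAntidiagonal.antidiagonal n, coeff kl.1 s * z ^ kl.1 * (coeff kl.2 t * z ^ kl.2) := by
    funext n
    rw [coeff_mul, Finset.sum_mul]
    refine Finset.sum_congr rfl fun kl hkl => ?_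
    rw [← Finset.HasAntidiagonal.mem_antidiagonal.1 hkl, pow_add]
    ring
  rw [h4, h5]
  exact (summable_norm_iff.1 h3).hasSum

theorem zero : HasTaylor (fun _ => 0) 0 := by
  refine Eventually.of_forall fun z => ?_
  simp [hasSum_zero]

theorem const (c : ℂ) : HasTaylor (fun _ => c) (C c) := by
  refine Eventually.of_forall fun z => ?_
  convert hasSum_single (f := fun n => coeff n (C c) * z ^ n) 0 fun n hn => ?_ using 1
  · simp
  · simp [coeff_C, hn]

theorem id : HasTaylor (fun z => z) X := by
  refine Eventually.of_forall fun z => ?_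
  convert hasSum_single (f := fun n => coeff n (X : ℂ⟦X⟧) * z ^ n) 1 fun n hn => ?_ using 1
  · simp
  · simp [coeff_X, hn]

theorem pow (hf : HasTaylor f s) (n : ℕ) : HasTaylor (fun z => f z ^ n) (s ^ n) := by
  induction n with
  | zero => simpa using const 1
  | succ n ih => simpa [pow_succ] using ih.mul hf

theorem sum {ι : Type*} (S : Finset ι) {F : ι → ℂ → ℂ} {σ : ι → ℂ⟦X⟧}
    (h : ∀ i ∈ S, HasTaylor (F i) (σ i)) :
    HasTaylor (fun z => ∑ i ∈ S, F i z) (∑ i ∈ S, σ i) := by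
  classical
  induction S using Finset.induction_on with
  | empty => simpa using zero
  | insert a S ha ih =>
    simp only [Finset.sum_insert ha]
    exact (h a (by simp)).add (ih fun i hi => h i (by simp [hi]))

theorem const_mul (c : ℂ) (hf : HasTaylor f s) : HasTaylor (fun z => c * f z) (C c * s) :=
  (const c).mul hf

theorem neg (hf : HasTaylor f s) : HasTaylor (fun z => - f z) (-s) := by
  filter_upwards [hf] with z h1
  simpa using h1.neg

theorem sub (hf : HasTaylor f s) (hg : HasTaylor g t) : HasTaylor (fun z => f z - g z) (s - t) := by
  simpa [sub_eq_add_neg] using hf.add hg.neg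

theorem map_zero (hf : HasTaylor f s) : f 0 = constantCoeff s := by
  have h := (mem_of_mem_nhds hf : HasSum (fun n => coeff n s * (0 : ℂ) ^ n) (f 0))
  have h2 := hasSum_single (f := fun n => coeff n s * (0 : ℂ) ^ n) 0 fun n hn => by simp [hn]
  rw [h.unique h2]
  simp

end HasTaylor

theorem AnalyticAt.exists_hasTaylor {f : ℂ → ℂ} (h : AnalyticAt ℂ f 0) :
    HasTaylor f (PowerSeries.mk fun n => iteratedDeriv n f 0 / n.factorial) := by
  rw [hasTaylor_iff]
  simpa using h.hasFPowerSeriesAt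

namespace HasTaylor

variable {f g : ℂ → ℂ} {s t : ℂ⟦X⟧}

/-- Analyticity provides some expansion of `1/f`; its product with `s` expands the constant `1`, so
it is the formal inverse. No estimate of the coefficients is needed. -/
theorem inv (hf : HasTaylor f s) (h0 : constantCoeff s ≠ 0) :
    HasTaylor (fun z => (f z)⁻¹) s⁻¹ := by
  have hf0 : f 0 ≠ 0 := hf.map_zero ▸ h0
  have h1 := (hf.analyticAt.inv hf0).exists_hasTaylor
  set t := PowerSeries.mk fun n => iteratedDeriv n f⁻¹ 0 / (n.factorial : ℂ) with ht
  have h2 : HasTaylor (fun _ => 1) (s * t) := by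
    refine (hf.mul h1).congr ?_
    filter_upwards [hf.analyticAt.continuousAt.eventually_ne hf0] with z hz
    simp [hz]
  have h3 : s * t = 1 := by simpa using h2.unique (const 1)
  have h4 : t = s⁻¹ := by
    rw [PowerSeries.eq_inv_iff_mul_eq_one h0, mul_comm, h3]
  rw [← h4]
  exact h1

theorem deriv (hf : HasTaylor f s) : HasTaylor (_root_.deriv f) (derivative ℂ s) := by
  have h1 := hf.analyticAt.deriv.exists_hasTaylor
  have h2 := hf.unique hf.analyticAt.exists_hasTaylor
  convert h1 using 1
  ext n
  rw [coeff_derivative, h2, coeff_mk, coeff_mk, iteratedDeriv_succ', Nat.factorial_succ]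
  have : ((n : ℂ) + 1) ≠ 0 := Nat.cast_add_one_ne_zero n
  push_cast
  field_simp

/-- A power series is the partial sum of order `n` plus a remainder `z^(n+1) E(z)`. -/
theorem exists_remainder (hf : HasTaylor f s) (n : ℕ) : ∃ E : ℂ → ℂ, AnalyticAt ℂ E 0 ∧
    ∀ᶠ z in 𝓝 (0 : ℂ),
      f z = ∑ i ∈ Finset.range (n + 1), coeff i s * z ^ i + z ^ (n + 1) * E z := by
  have hsum : ∀ᶠ z in 𝓝 (0 : ℂ), Summable fun j => coeff (j + (n + 1)) s * z ^ j := by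
    filter_upwards [hf] with z hz
    rcases eq_or_ne z 0 with rfl | hz0
    · refine summable_of_ne_finset_zero (s := {0}) fun j hj => ?_
      simp at hj
      simp [hj]
    · have h1 := (summable_nat_add_iff (n + 1)).2 hz.summable
      refine (h1.mul_left (z ^ (n + 1))⁻¹).congr fun j => ?_
      have : z ^ (n + 1) ≠ 0 := pow_ne_zero _ hz0
      rw [pow_add z j (n + 1), inv_mul_eq_div, div_eq_iff this]
      ring
  have hE : HasTaylor (fun z => ∑' j, coeff (j + (n + 1)) s * z ^ j)
      (PowerSeries.mk fun j => coeff (j + (n + 1)) s) := by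
    filter_upwards [hsum] with z hz
    simpa using hz.hasSum
  refine ⟨_, hE.analyticAt, ?_⟩
  filter_upwards [hf, hsum] with z hz hz2
  rw [← hz.tsum_eq, ← hz.summable.sum_add_tsum_nat_add (n + 1), ← tsum_mul_left]
  congr 2
  ext j
  rw [pow_add]
  ring

end HasTaylor

/-- Analytic local inverse of `z ↦ z U(z)`, with Lagrange's formula for its coefficients. -/
theorem exists_localInverse {U : ℂ → ℂ} {u : ℂ⟦X⟧} (hU : HasTaylor U u)
    (hu : constantCoeff u ≠ 0) :
    ∃ (Z : ℂ → ℂ) (l : ℂ⟦X⟧), HasTaylor Z l ∧ constantCoeff l = 0 ∧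
      (∀ᶠ w in 𝓝 (0 : ℂ), Z w * U (Z w) = w) ∧ (∀ᶠ z in 𝓝 (0 : ℂ), Z (z * U z) = z) ∧
      ∀ n : ℕ, 1 ≤ n → (n : ℂ) * coeff n l = coeff (n - 1) (u⁻¹ ^ n) := by
  have hP := HasTaylor.id.mul hU
  have hPa := hP.analyticAt
  have hd : deriv (fun z => z * U z) 0 ≠ 0 := by
    rw [hP.deriv.map_zero, ← coeff_zero_eq_constantCoeff_apply, coeff_derivative]
    simpa using hu
  let Z := hPa.hasStrictDerivAt.localInverse _ _ _ hd
  have hZa : AnalyticAt ℂ Z 0 := by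
    have := hPa.analyticAt_localInverse hd
    simpa using this
  have hleft : ∀ᶠ z in 𝓝 (0 : ℂ), Z (z * U z) = z :=
    HasStrictDerivAt.eventually_left_inverse hPa.hasStrictDerivAt hd
  have hright : ∀ᶠ w in 𝓝 (0 : ℂ), Z w * U (Z w) = w := by
    have := HasStrictDerivAt.eventually_right_inverse hPa.hasStrictDerivAt hd
    simpa using this
  have hZ := hZa.exists_hasTaylor
  set l := PowerSeries.mk fun n => iteratedDeriv n Z 0 / (n.factorial : ℂ) with hl
  have hZ0 : Z 0 = 0 := by
    have := mem_of_mem_nhds hleft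
    simpa using this
  refine ⟨Z, l, hZ, by rw [← hZ.map_zero, hZ0], hright, hleft, fun n hn => ?_⟩
  -- Expanding the inverse only to order `n` avoids composing power series: in `z = Z(z U(z))` the
  -- remainder becomes `(z U)^(n+1)` times an analytic function, which is the form required by
  -- `lagrange_coeff`.
  obtain ⟨E, hE, hrem⟩ := hZ.exists_remainder n
  have hcont : Tendsto (fun z => z * U z) (𝓝 0) (𝓝 0) := by
    have := hPa.continuousAt.tendsto
    simpa using this
  have hEP : AnalyticAt ℂ (fun z => E (z * U z)) 0 := by
    refine AnalyticAt.fun_comp (g := E) (f := fun z => z * U z) ?_ hPa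
    simpa using hE
  have hET := hEP.exists_hasTaylor
  set e := PowerSeries.mk fun m => iteratedDeriv m (fun z => E (z * U z)) 0 / (m.factorial : ℂ)
  have h1 : HasTaylor (fun z => z)
      (∑ i ∈ Finset.range (n + 1), C (coeff i l) * (X * u) ^ i + (X * u) ^ (n + 1) * e) := by
    refine ((HasTaylor.sum _ fun i _ => (hP.pow i).const_mul (coeff i l)).add
      ((hP.pow (n + 1)).mul hET)).congr ?_
    filter_upwards [hcont.eventually hrem, hleft] with z hz1 hz2
    rw [← hz1, hz2]
  have h2 := HasTaylor.id.unique h1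
  refine lagrange_coeff u (u ^ (n + 1) * e) (fun i => coeff i l) n hn hu ?_
  rw [← mul_assoc, ← mul_pow]
  exact h2

end Taylor

/-! ### Real coefficient sequences as complex Taylor series -/

section RealCoefficients

open PowerSeries

/-- The complex power series with the given real coefficients. -/
noncomputable def complexSeries (c : ℕ → ℝ) : ℂ⟦X⟧ := PowerSeries.mk fun n => (c n : ℂ)

@[simp] theorem coeff_complexSeries (c : ℕ → ℝ) (n : ℕ) : coeff n (complexSeries c) = c n := by
  simp [complexSeries]

@[simp] theorem constantCoeff_complexSeries (c : ℕ → ℝ) :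
    constantCoeff (complexSeries c) = c 0 := by
  rw [← coeff_zero_eq_constantCoeff_apply, coeff_complexSeries]

theorem complexSeries_eq_map (c : ℕ → ℝ) :
    complexSeries c = PowerSeries.map Complex.ofRealHom (PowerSeries.mk c) := by
  ext n; simp

theorem complexSeries_mulCoeff (f g : ℕ → ℝ) :
    complexSeries (mulCoeff f g) = complexSeries f * complexSeries g := by
  rw [complexSeries_eq_map f, complexSeries_eq_map g, ← map_mul]
  ext n
  rw [coeff_map, coeff_mk_mul_mk]
  simp

theorem complexSeries_recipCoeff (f : ℕ → ℝ) (hf : f 0 ≠ 0) :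
    complexSeries (recipCoeff f) = (complexSeries f)⁻¹ := by
  rw [PowerSeries.eq_inv_iff_mul_eq_one (by simpa using hf), mul_comm, complexSeries_eq_map f,
    complexSeries_eq_map, ← map_mul, mk_mul_mk_recipCoeff f hf, map_one]

/-- A series with real positive constant term whose `k`-th power, `k ≤ 2`, is real, is real. -/
theorem exists_real_root (k : ℕ) (hk : k = 1 ∨ k = 2) (f : ℕ → ℝ) (u : ℂ⟦X⟧)
    (huk : u ^ k = complexSeries f) (c : ℝ) (hc : constantCoeff u = c) (hc0 : c ≠ 0) :
    ∃ v : ℝ⟦X⟧, u = PowerSeries.map Complex.ofRealHom v ∧ v ^ k = PowerSeries.mk f ∧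
      constantCoeff v = c := by
  -- Conjugating the coefficients gives another `k`-th root of the same real series. For `k = 2` the
  -- alternative `-u` is excluded by the nonzero real constant term.
  have hconj : PowerSeries.map (starRingEnd ℂ) u = u := by
    have h1 : (PowerSeries.map (starRingEnd ℂ) u) ^ k = u ^ k := by
      rw [← map_pow, huk]
      ext n
      simp
    rcases hk with rfl | rfl
    · simpa using h1
    · rcases sq_eq_sq_iff_eq_or_eq_neg.1 h1 with h | h
      · exact h
      · exfalso
        have h2 := congrArg constantCoeff h
        rw [← coeff_zero_eq_constantCoeff_apply, coeff_map, coeff_zero_eq_constantCoeff_apply,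
          map_neg, hc, Complex.conj_ofReal] at h2
        norm_cast at h2
        apply hc0
        linarith
  have hmap : u = PowerSeries.map Complex.ofRealHom (PowerSeries.mk fun n => (coeff n u).re) := by
    ext n
    have h := congrArg (coeff n) hconj
    rw [coeff_map] at h
    rw [coeff_map, coeff_mk]
    exact (Complex.conj_eq_iff_re.1 h).symm
  refine ⟨_, hmap, ?_, ?_⟩
  · have hinj : Function.Injective (PowerSeries.map Complex.ofRealHom) := by
      intro a b hab
      ext n
      have := congrArg (coeff n) hab
      simpa using this
    apply hinj
    rw [map_pow, ← hmap, huk, complexSeries_eq_map]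
  · rw [← coeff_zero_eq_constantCoeff_apply, coeff_mk, coeff_zero_eq_constantCoeff_apply, hc]
    simp

/-- The inverse of `z U(z)`, where `U^k` has the real coefficients `f`, has the coefficients
`invCoeff k f`. -/
theorem exists_localInverse_invCoeff (k : ℕ) (hk : k = 1 ∨ k = 2) (f : ℕ → ℝ) {U : ℂ → ℂ}
    {u : ℂ⟦X⟧} (hU : HasTaylor U u) (huk : u ^ k = complexSeries f) (c : ℝ)
    (hc : constantCoeff u = c) (hc0 : c ≠ 0) (hc2 : k = 2 → 0 < c) :
    ∃ Z : ℂ → ℂ, HasTaylor Z (complexSeries (invCoeff k f)) ∧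
      (∀ᶠ w in 𝓝 (0 : ℂ), Z w * U (Z w) = w) ∧ (∀ᶠ z in 𝓝 (0 : ℂ), Z (z * U z) = z) := by
  have hu : constantCoeff u ≠ 0 := by rw [hc]; exact_mod_cast hc0
  obtain ⟨Z, l, hZ, hl0, hr, hl, hcoef⟩ := exists_localInverse hU hu
  obtain ⟨v, huv, hvk, hvc⟩ := exists_real_root k hk f u huk c hc hc0
  refine ⟨Z, ?_, hr, hl⟩
  have hinv : u⁻¹ = PowerSeries.map Complex.ofRealHom v⁻¹ := by
    symm
    rw [PowerSeries.eq_inv_iff_mul_eq_one hu, huv, ← map_mul,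
      PowerSeries.inv_mul_cancel _ (by rw [hvc]; exact hc0), map_one]
  have hl' : l = complexSeries (invCoeff k f) := by
    ext n
    rw [coeff_complexSeries]
    rcases Nat.eq_zero_or_pos n with rfl | hn
    · rw [coeff_zero_eq_constantCoeff_apply, hl0]
      simp [invCoeff]
    · have h1 := hcoef n hn
      rw [hinv, ← map_pow, coeff_map,
        ← natCast_mul_invCoeff k hk f v hvk (by rw [hvc]; exact hc0) (by rw [hvc]; exact hc2) n hn] at h1
      have hn0 : (n : ℂ) ≠ 0 := by exact_mod_cast hn.ne'
      refine mul_left_cancel₀ hn0 ?_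
      rw [h1]
      simp
  rw [← hl']
  exact hZ

theorem hasTaylor_geometric (r : ℂ) :
    HasTaylor (fun z => (1 - r * z)⁻¹) (PowerSeries.mk fun n => r ^ n) := by
  have h : ∀ᶠ z in 𝓝 (0 : ℂ), ‖r * z‖ < 1 := by
    have : Tendsto (fun z : ℂ => ‖r * z‖) (𝓝 0) (𝓝 0) := by
      have : Continuous fun z : ℂ => ‖r * z‖ := by fun_prop
      simpa using this.tendsto 0
    exact this.eventually_lt_const one_pos
  filter_upwards [h] with z hz
  simpa [mul_pow] using hasSum_geometric_of_norm_lt_one hz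

theorem hasTaylor_inv_sub (d : ℂ) (hd : d ≠ 0) :
    HasTaylor (fun z => (d - z)⁻¹) (PowerSeries.mk fun n => (d ^ (n + 1))⁻¹) := by
  have h := (hasTaylor_geometric d⁻¹).const_mul d⁻¹
  convert h using 1
  · funext z
    rw [← mul_inv, mul_sub, mul_one, mul_inv_cancel_left₀ hd]
  · ext n
    rw [coeff_C_mul, coeff_mk, coeff_mk, inv_pow, pow_succ, mul_inv, mul_comm]

end RealCoefficients

/-! ### Expansion of `ψ` at its poles -/

namespace HyperexpParams

open PowerSeries

variable (p : HyperexpParams)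

/-- The function `z ψ(ρ_ℓ + z)` without the removable singularity at `0`. -/
noncomputable def poleFun (ℓ : Fin p.N) (z : ℂ) : ℂ :=
  -((p.α ℓ : ℂ) * p.ρ ℓ) + z * ((p.σ : ℂ) ^ 2 * (p.ρ ℓ + z) ^ 2 / 2 + p.a * (p.ρ ℓ + z) - p.α ℓ
    + (p.ρ ℓ + z) * ∑ i ∈ Finset.univ.erase ℓ, (p.α i : ℂ) / (p.ρ i - (p.ρ ℓ + z))
    - (p.ρ ℓ + z) * ∑ i, (p.αHat i : ℂ) / (p.ρHat i + (p.ρ ℓ + z)))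

theorem poleFun_eq (ℓ : Fin p.N) {z : ℂ} (hz : z ≠ 0) :
    p.poleFun ℓ z = z * p.psi (p.ρ ℓ + z) := by
  rw [poleFun, psi, ← Finset.add_sum_erase _ _ (Finset.mem_univ ℓ)]
  have : (p.α ℓ : ℂ) / (p.ρ ℓ - (p.ρ ℓ + z)) = -(p.α ℓ / z) := by
    rw [sub_add_cancel_left, div_neg]
  rw [this]
  field_simp
  ring

theorem rho_sub_ne {i ℓ : Fin p.N} (h : i ≠ ℓ) : (p.ρ i : ℂ) - p.ρ ℓ ≠ 0 := by
  rw [sub_ne_zero]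
  exact_mod_cast fun h' => h (p.ρ_strictMono.injective h')

theorem rhoHat_add_ne (i : Fin p.Nhat) (ℓ : Fin p.N) : (p.ρHat i : ℂ) + p.ρ ℓ ≠ 0 := by
  have := p.ρHat_pos i
  have := p.ρ_pos ℓ
  exact_mod_cast (by positivity : p.ρHat i + p.ρ ℓ ≠ 0)

/-- Writing `(ρ_ℓ + z) α_i / (ρ_i - ρ_ℓ - z) = α_i ρ_i / (ρ_i - ρ_ℓ - z) - α_i`, and similarly for
the negative jumps, leaves geometric series whose coefficients are the `ω_{ℓ,n}`. The constants
split off affect index `0` only, which is why `omega` treats it separately. -/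
theorem hasTaylor_poleFun (ℓ : Fin p.N) :
    HasTaylor (p.poleFun ℓ) (complexSeries (p.gCoeff ℓ)) := by
  have hid := HasTaylor.id
  have hρ : HasTaylor (fun z => (p.ρ ℓ : ℂ) + z) (C (p.ρ ℓ : ℂ) + X) := (HasTaylor.const _).add hid
  have h1 := ((((hρ.pow 2).const_mul ((p.σ : ℂ) ^ 2 / 2)).add (hρ.const_mul (p.a : ℂ))).sub
    (HasTaylor.const (p.α ℓ : ℂ)))
  have h2 := HasTaylor.sum (Finset.univ.erase ℓ)
    (F := fun i z => (p.α i * p.ρ i : ℂ) * ((p.ρ i - p.ρ ℓ : ℂ) - z)⁻¹ - p.α i) fun i hi =>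
    ((hasTaylor_inv_sub _ (p.rho_sub_ne (Finset.ne_of_mem_erase hi))).const_mul _).sub
      (HasTaylor.const _)
  have h3 := HasTaylor.sum (Finset.univ : Finset (Fin p.Nhat))
    (F := fun i z => (p.αHat i : ℂ) + (p.αHat i * p.ρHat i : ℂ) *
      (-(p.ρHat i + p.ρ ℓ : ℂ) - z)⁻¹) fun i _ =>
    (HasTaylor.const _).add
      ((hasTaylor_inv_sub _ (neg_ne_zero.2 (p.rhoHat_add_ne i ℓ))).const_mul _)
  have h4 := (HasTaylor.const (-((p.α ℓ : ℂ) * p.ρ ℓ))).add (hid.mul ((h1.add h2).sub h3))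
  have hne : ∀ d : ℂ, d ≠ 0 → ∀ᶠ z in 𝓝 (0 : ℂ), d - z ≠ 0 := by
    intro d hd
    have : ContinuousAt (fun z : ℂ => d - z) 0 := by fun_prop
    exact this.eventually_ne (by simpa using hd)
  have hE1 : ∀ᶠ z in 𝓝 (0 : ℂ), ∀ i ∈ Finset.univ.erase ℓ, ((p.ρ i - p.ρ ℓ : ℂ) - z) ≠ 0 :=
    (Finset.eventually_all _).2 fun i hi => hne _ (p.rho_sub_ne (Finset.ne_of_mem_erase hi))
  have hE2 : ∀ᶠ z in 𝓝 (0 : ℂ), ∀ i ∈ (Finset.univ : Finset (Fin p.Nhat)),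
      (-(p.ρHat i + p.ρ ℓ : ℂ) - z) ≠ 0 :=
    (Finset.eventually_all _).2 fun i _ => hne _ (neg_ne_zero.2 (p.rhoHat_add_ne i ℓ))
  have h5 := h4.congr (g := p.poleFun ℓ) (by
    filter_upwards [hE1, hE2] with z hz1 hz2
    rw [poleFun, Finset.mul_sum, Finset.mul_sum]
    congr 2
    congr 1
    · congr 1
      · ring
      · refine Finset.sum_congr rfl fun i hi => ?_
        have h6 := hz1 i hi
        have h7 : (p.ρ i : ℂ) - (p.ρ ℓ + z) ≠ 0 := by rwa [← sub_sub]
        rw [sub_sub]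
        field_simp
        ring
    · refine Finset.sum_congr rfl fun i hi => ?_
      have h6 := hz2 i hi
      have h7 : (p.ρHat i : ℂ) + (p.ρ ℓ + z) ≠ 0 := by
        rw [← add_assoc]
        intro h8
        apply h6
        linear_combination -h8
      have h8 : (-(p.ρHat i + p.ρ ℓ : ℂ) - z) = -((p.ρHat i : ℂ) + (p.ρ ℓ + z)) := by ring
      rw [h8, inv_neg]
      field_simp
      ring)
  convert h5 using 1
  have hsq : (C (p.ρ ℓ : ℂ) + X) ^ 2 = C ((p.ρ ℓ : ℂ) ^ 2) + C (2 * (p.ρ ℓ : ℂ)) * X + X ^ 2 := by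
    simp only [map_pow, map_mul, map_ofNat]
    ring
  have hpow : ∀ (n : ℕ) (i : Fin p.Nhat), ((-(p.ρHat i + p.ρ ℓ : ℂ)) ^ (n + 1))⁻¹ =
      - ((-1) ^ n * ((p.ρHat i + p.ρ ℓ : ℂ) ^ (n + 1))⁻¹) := by
    intro n i
    rw [neg_pow, mul_inv, pow_succ (-1 : ℂ) n, mul_inv, ← inv_pow]
    norm_num
  rw [hsq]
  ext n
  rw [coeff_complexSeries]
  rcases n with _ | _ | _ | _ | n
  · simp [gCoeff]
  · simp only [gCoeff, omega, map_add, map_sub, map_neg, map_sum, coeff_succ_X_mul, coeff_C_mul,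
      coeff_mk, coeff_C, coeff_X, coeff_X_pow, hpow]
    simp
    have e1 : ∑ i ∈ Finset.univ.erase ℓ, (p.α i : ℂ) * p.ρ ℓ / (p.ρ i - p.ρ ℓ) =
        ∑ i ∈ Finset.univ.erase ℓ, (p.α i * p.ρ i * (p.ρ i - p.ρ ℓ : ℂ)⁻¹ - p.α i) := by
      refine Finset.sum_congr rfl fun i hi => ?_
      have := p.rho_sub_ne (Finset.ne_of_mem_erase hi)
      field_simp
      ring
    have e2 : ∑ i, (p.αHat i : ℂ) * p.ρ ℓ / (p.ρHat i + p.ρ ℓ) =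
        ∑ i, (p.αHat i - p.αHat i * p.ρHat i * (p.ρHat i + p.ρ ℓ : ℂ)⁻¹) := by
      refine Finset.sum_congr rfl fun i hi => ?_
      have := p.rhoHat_add_ne i ℓ
      field_simp
      ring
    simp at e1
    rw [e1, e2]
    simp only [Finset.sum_sub_distrib, Finset.sum_add_distrib, Finset.sum_neg_distrib]
    ring
  all_goals
    simp only [gCoeff, omega, map_add, map_sub, map_neg, map_sum, coeff_succ_X_mul, coeff_C_mul,
      coeff_mk, coeff_C, coeff_X, coeff_X_pow, hpow]
    simp [div_eq_mul_inv, Finset.mul_sum, mul_comm, mul_assoc, mul_left_comm]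
    try ring

end HyperexpParams

/-! ### Roots of `ψ(z) = q` for large `q` -/

namespace HyperexpParams

open PowerSeries

variable (p : HyperexpParams)

theorem gCoeff_zero_ne (ℓ : Fin p.N) : p.gCoeff ℓ 0 ≠ 0 := by
  have := p.α_pos ℓ
  have := p.ρ_pos ℓ
  simp only [gCoeff]
  exact neg_ne_zero.2 (by positivity)

/-- The root of `ψ(z) = 1 / w` near the pole `ρ_ℓ`. -/
theorem exists_root_near_pole (ℓ : Fin p.N) :
    ∃ Z : ℂ → ℂ, HasTaylor Z (complexSeries (p.zetaCoeff ℓ)) ∧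
      (∀ᶠ w in 𝓝 (0 : ℂ), w ≠ 0 → Z w ≠ p.ρ ℓ ∧ p.psi (Z w) = w⁻¹) ∧
      (∀ᶠ z : ℂ in 𝓝 (p.ρ ℓ : ℂ), z ≠ p.ρ ℓ → Z (p.psi z)⁻¹ = z) := by
  have hg0 := p.gCoeff_zero_ne ℓ
  have hU := (p.hasTaylor_poleFun ℓ).inv (by simpa using hg0)
  rw [← complexSeries_recipCoeff _ hg0] at hU
  have hr0 : recipCoeff (p.gCoeff ℓ) 0 ≠ 0 := by
    rw [recipCoeff_zero]; exact one_div_ne_zero hg0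
  obtain ⟨Z, hZ, hr, hl⟩ := exists_localInverse_invCoeff 1 (Or.inl rfl) (recipCoeff (p.gCoeff ℓ)) hU
    (pow_one _) _ (constantCoeff_complexSeries _) hr0 (by norm_num)
  -- The simple pole of `ψ` is a simple zero of `1/ψ`, so solving `ψ = 1/w` near `ρ_ℓ` means
  -- inverting `z U(z) = w` with `U = 1 / poleFun`.
  have hval : ∀ z : ℂ, z ≠ 0 → z * (p.poleFun ℓ z)⁻¹ = (p.psi (p.ρ ℓ + z))⁻¹ := by
    intro z hz
    rw [p.poleFun_eq ℓ hz, mul_inv, mul_inv_cancel_left₀ hz]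
  refine ⟨fun w => p.ρ ℓ + Z w, ?_, ?_, ?_⟩
  · have h1 := (HasTaylor.const (p.ρ ℓ : ℂ)).add hZ
    convert h1 using 1
    ext n
    rcases n with _ | n
    · simp [zetaCoeff, invCoeff]
    · simp [zetaCoeff]
  · filter_upwards [hr] with w hw hw0
    have hZ0 : Z w ≠ 0 := by
      intro h
      rw [h, zero_mul] at hw
      exact hw0 hw.symm
    refine ⟨by simpa using hZ0, ?_⟩
    rw [hval _ hZ0] at hw
    exact inv_eq_iff_eq_inv.1 hw
  · have ht : Tendsto (fun y : ℂ => y - p.ρ ℓ) (𝓝 (p.ρ ℓ : ℂ)) (𝓝 0) := by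
      have : Continuous fun y : ℂ => y - p.ρ ℓ := by fun_prop
      simpa using this.tendsto (p.ρ ℓ : ℂ)
    filter_upwards [ht.eventually hl] with y hy hy0
    rw [hval _ (sub_ne_zero.2 hy0), add_sub_cancel] at hy
    rw [hy, add_sub_cancel]

/-- The root of `ψ(z) = w^(-k)` near infinity, in the right half-plane. -/
theorem exists_root_near_infinity (k : ℕ) (hk : k = 1 ∨ k = 2) (h : ℕ → ℝ) (h0 : 0 < h 0)
    (H : ℂ → ℂ) (hH : HasTaylor H (complexSeries h))
    (hpsi : ∀ z : ℂ, z ≠ 0 → H z = z ^ k * p.psi z⁻¹) :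
    ∃ ξ : ℂ → ℂ, HasTaylor ξ (complexSeries (extraXiCoeff k h)) ∧
      (∀ᶠ w in 𝓝 (0 : ℂ), w ≠ 0 → ξ w ≠ 0 ∧ p.psi (ξ w)⁻¹ = (w ^ k)⁻¹) ∧
      (∀ᶠ z in 𝓝 (0 : ℂ), ∀ w : ℝ, 0 < w → 0 < z.re → p.psi z⁻¹ = ((w : ℂ) ^ k)⁻¹ →
        z = ξ w) := by
  have hk0 : k ≠ 0 := by rcases hk with rfl | rfl <;> norm_num
  have hF := hH.inv (by simpa using h0.ne')
  rw [← complexSeries_recipCoeff _ h0.ne'] at hF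
  have hr0 : 0 < recipCoeff h 0 := by rw [recipCoeff_zero]; positivity
  have hF0 : (H 0)⁻¹ = (recipCoeff h 0 : ℂ) := by
    have := hF.map_zero
    simpa using this
  -- Since `H 0 = h 0` is positive, the principal `k`-th root is analytic near `0`. It satisfies `(z
  -- U(z))^k = 1/ψ(1/z)`, so the root is found by inverting `z U(z) = w`.
  set U : ℂ → ℂ := fun z => ((H z)⁻¹) ^ ((k : ℂ)⁻¹) with hUdef
  have hUk : ∀ z, U z ^ k = (H z)⁻¹ := fun z => Complex.cpow_nat_inv_pow _ hk0
  have hUa : AnalyticAt ℂ U 0 := by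
    refine hF.analyticAt.cpow analyticAt_const ?_
    rw [hF0]
    exact Complex.ofReal_mem_slitPlane.2 hr0
  have hUT := hUa.exists_hasTaylor
  set u := PowerSeries.mk fun n => iteratedDeriv n U 0 / (n.factorial : ℂ)
  set c : ℝ := recipCoeff h 0 ^ ((k : ℝ)⁻¹) with hc
  have hc0 : 0 < c := Real.rpow_pos_of_pos hr0 _
  have hU0 : U 0 = c := by
    rw [hUdef, hc, Complex.ofReal_cpow hr0.le]
    simp [hF0]
  have hu0 : constantCoeff u = c := by rw [← hUT.map_zero, hU0]
  have huk : u ^ k = complexSeries (recipCoeff h) := by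
    refine (hUT.pow k).unique (hF.congr (Eventually.of_forall fun z => (hUk z).symm))
  obtain ⟨ξ, hξ, hr, hl⟩ := exists_localInverse_invCoeff k hk (recipCoeff h) hUT huk c hu0 hc0.ne'
    (fun _ => hc0)
  have hval : ∀ z : ℂ, z ≠ 0 → (z * U z) ^ k = (p.psi z⁻¹)⁻¹ := by
    intro z hz
    rw [mul_pow, hUk, hpsi z hz, mul_inv, mul_inv_cancel_left₀ (pow_ne_zero k hz)]
  have hξ0 : ξ 0 = 0 := by rw [hξ.map_zero]; simp [invCoeff]
  refine ⟨ξ, hξ, ?_, ?_⟩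
  · filter_upwards [hr] with w hw hw0
    have hZ0 : ξ w ≠ 0 := by
      intro h
      rw [h, zero_mul] at hw
      exact hw0 hw.symm
    refine ⟨hZ0, ?_⟩
    have := hval _ hZ0
    rw [hw] at this
    rw [this, inv_inv]
  · have hξt : Tendsto ξ (𝓝 0) (𝓝 0) := by
      have := hξ.analyticAt.continuousAt.tendsto
      rwa [hξ0] at this
    have hUre : ∀ᶠ y in 𝓝 (0 : ℂ), 0 < (U (ξ y)).re := by
      have h1 : Tendsto (fun y => (U (ξ y)).re) (𝓝 0) (𝓝 c) := by
        have h2 := (Complex.continuous_re.tendsto _).comp (hUa.continuousAt.tendsto.comp hξt)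
        rw [hU0, Complex.ofReal_re] at h2
        exact h2
      exact h1.eventually_const_lt hc0
    have hzU : Tendsto (fun z => z * U z) (𝓝 0) (𝓝 0) := by
      have : ContinuousAt (fun z => z * U z) 0 := continuousAt_id.mul hUa.continuousAt
      simpa [ContinuousAt] using this
    filter_upwards [hl, hzU.eventually hr, hzU.eventually hUre] with z hz1 hz2 hz3 w hw hre hpw
    have hz0 : z ≠ 0 := by
      rintro rfl
      simp at hre
    have hs := hval z hz0
    rw [hpw, inv_inv] at hs
    have hcase : z * U z = w ∨ z * U z = -w := by
      rcases hk with rfl | rfl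
      · left; simpa using hs
      · exact sq_eq_sq_iff_eq_or_eq_neg.1 hs
    rcases hcase with hc1 | hc1
    · rw [← hc1, hz1]
    -- The second square root `z U(z) = -w` belongs to the root tending to `-∞`: as `Re U(z) > 0`,
    -- it would force `Re z ≤ 0`.
    · exfalso
      rw [hz1] at hz3
      have h1 : z = -w * (U z)⁻¹ := by
        have : U z ≠ 0 := by
          intro h
          rw [h] at hz3
          simp at hz3
        rw [← hc1, mul_inv_cancel_right₀ this]
      have h2 := congrArg Complex.re h1
      rw [← Complex.ofReal_neg, Complex.re_ofReal_mul, Complex.inv_re] at h2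
      have h3 : 0 ≤ (U z).re / Complex.normSq (U z) := div_nonneg hz3.le (Complex.normSq_nonneg _)
      nlinarith

/-- The regular part of `ψ(1/z)` at the origin. -/
noncomputable def jumpFun (z : ℂ) : ℂ :=
  -((∑ ℓ, (p.α ℓ : ℂ) * (1 - p.ρ ℓ * z)⁻¹) + ∑ ℓ, (p.αHat ℓ : ℂ) * (1 - (-p.ρHat ℓ) * z)⁻¹)

theorem hasTaylor_jumpFun : HasTaylor p.jumpFun (complexSeries p.eta) := by
  have h1 := HasTaylor.sum (Finset.univ : Finset (Fin p.N)) fun i _ =>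
    (hasTaylor_geometric (p.ρ i : ℂ)).const_mul (p.α i : ℂ)
  have h2 := HasTaylor.sum (Finset.univ : Finset (Fin p.Nhat)) fun i _ =>
    (hasTaylor_geometric (-p.ρHat i : ℂ)).const_mul (p.αHat i : ℂ)
  have h := ((h1.add h2).neg).congr (g := p.jumpFun) (Eventually.of_forall fun z => rfl)
  convert h using 1
  ext n
  simp only [coeff_complexSeries, map_neg, map_add, map_sum, coeff_C_mul, coeff_mk, eta]
  push_cast
  rw [Finset.mul_sum]
  congr 2
  refine Finset.sum_congr rfl fun i _ => ?_
  rw [neg_pow]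
  ring

/-- Only `z ≠ 0` is required: where a denominator vanishes it does so on both sides, and the
convention `x / 0 = 0` gives the same value. The resulting identities for `H` therefore hold at
every nonzero point. -/
theorem psi_inv {z : ℂ} (hz : z ≠ 0) :
    p.psi z⁻¹ = (p.σ : ℂ) ^ 2 / 2 * (z ^ 2)⁻¹ + p.a * z⁻¹ + p.jumpFun z := by
  have h1 : ∀ ℓ, z⁻¹ * ((p.α ℓ : ℂ) / (p.ρ ℓ - z⁻¹)) = -((p.α ℓ : ℂ) * (1 - p.ρ ℓ * z)⁻¹) := by
    intro ℓ
    have : (p.ρ ℓ : ℂ) - z⁻¹ = -(1 - p.ρ ℓ * z) * z⁻¹ := by field_simp; ring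
    rw [this, div_eq_mul_inv, mul_inv, inv_inv, inv_neg]
    field_simp
  have h2 : ∀ ℓ, z⁻¹ * ((p.αHat ℓ : ℂ) / (p.ρHat ℓ + z⁻¹)) =
      (p.αHat ℓ : ℂ) * (1 - (-p.ρHat ℓ) * z)⁻¹ := by
    intro ℓ
    have : (p.ρHat ℓ : ℂ) + z⁻¹ = (1 - (-p.ρHat ℓ) * z) * z⁻¹ := by field_simp; ring
    rw [this, div_eq_mul_inv, mul_inv, inv_inv]
    field_simp
  rw [psi, jumpFun, Finset.mul_sum, Finset.mul_sum, Finset.sum_congr rfl fun i _ => h1 i,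
    Finset.sum_congr rfl fun i _ => h2 i, Finset.sum_neg_distrib, inv_pow]
  ring

theorem hasTaylor_hGauss : HasTaylor
    (fun z => (p.σ : ℂ) ^ 2 / 2 + p.a * z + z ^ 2 * p.jumpFun z) (complexSeries p.hGauss) := by
  have h1 := ((HasTaylor.const ((p.σ : ℂ) ^ 2 / 2)).add (HasTaylor.id.const_mul (p.a : ℂ))).add
    ((HasTaylor.id.pow 2).mul p.hasTaylor_jumpFun)
  convert h1 using 1
  ext n
  rcases n with _ | _ | n
  · simp [hGauss]
  · rw [show (X : ℂ⟦X⟧) ^ 2 * complexSeries p.eta = X * (X * complexSeries p.eta) by ring]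
    simp [hGauss, coeff_C, coeff_succ_X_mul]
  · rw [show (X : ℂ⟦X⟧) ^ 2 * complexSeries p.eta = X * (X * complexSeries p.eta) by ring]
    simp [hGauss, coeff_succ_X_mul]

theorem hasTaylor_hDrift : HasTaylor
    (fun z => p.a + z * p.jumpFun z) (complexSeries p.hDrift) := by
  have h1 := (HasTaylor.const (p.a : ℂ)).add (HasTaylor.id.mul p.hasTaylor_jumpFun)
  convert h1 using 1
  ext n
  rcases n with _ | n
  · simp [hDrift]
  · simp [hDrift, coeff_succ_X_mul]

theorem hGauss_fun_eq {z : ℂ} (hz : z ≠ 0) :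
    (p.σ : ℂ) ^ 2 / 2 + p.a * z + z ^ 2 * p.jumpFun z = z ^ 2 * p.psi z⁻¹ := by
  rw [p.psi_inv hz]
  field_simp

theorem hDrift_fun_eq (hσ : p.σ = 0) {z : ℂ} (hz : z ≠ 0) :
    p.a + z * p.jumpFun z = z ^ 1 * p.psi z⁻¹ := by
  rw [p.psi_inv hz, hσ, Complex.ofReal_zero]
  field_simp
  ring

end HyperexpParams

/-! ### Generating series of the coefficients along each root -/

section BranchSeries

open PowerSeries

theorem complexSeries_succ (c : ℕ → ℝ) :
    complexSeries c = C (c 0 : ℂ) + X * complexSeries fun i => c (i + 1) := by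
  ext n
  rcases n with _ | n
  · simp
  · simp [coeff_succ_X_mul]

theorem extraXiCoeff_zero (k : ℕ) (h : ℕ → ℝ) : extraXiCoeff k h 0 = 0 := by
  simp [extraXiCoeff, invCoeff]

theorem extraXiCoeff_one_pos (k : ℕ) (h : ℕ → ℝ) (h0 : 0 < h 0) : 0 < extraXiCoeff k h 1 := by
  have : 0 < recipCoeff h 0 := by rw [recipCoeff_zero]; positivity
  simp only [extraXiCoeff, invCoeff, one_ne_zero, if_false, if_true]
  positivity

/-- In the variable `w = q^(-1/k)` the root is `ζ = B(w)/w`, hence `1/(ζ - 1) = w / (B(w) - w)`.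
Subtracting `1` from `ζ` changes index `1` of `B`, as the coefficients are counted from `w^(-1)`. -/
theorem complexSeries_extraVarsigmaCoeff (k : ℕ) (h : ℕ → ℝ) (h0 : extraZetaCoeff k h 0 ≠ 0) :
    complexSeries (extraVarsigmaCoeff k h) = X * (complexSeries (extraZetaCoeff k h) - X)⁻¹ := by
  rw [complexSeries_succ]
  simp only [extraVarsigmaCoeff, if_true, Complex.ofReal_zero, map_zero, zero_add,
    Nat.add_sub_cancel, Nat.succ_ne_zero, if_false]
  rw [complexSeries_recipCoeff _ (by simpa using h0)]
  congr 2
  ext n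
  rw [map_sub, coeff_complexSeries, coeff_complexSeries, coeff_X]
  by_cases hn : n = 1
  · simp [hn]
  · simp [hn]

/-- As `q = w^(-k)`, one has `d/dq = -(w^(k+1)/k) d/dw`; applied to `ζ = B(w)/w` this gives
`(w^(k-1) B - w^k B') / k`. -/
theorem complexSeries_extraZetaDerivCoeff (k : ℕ) (hk : k = 1 ∨ k = 2) (h : ℕ → ℝ) :
    complexSeries (extraZetaDerivCoeff k h) = C ((k : ℂ)⁻¹) *
      (X ^ (k - 1) * complexSeries (extraZetaCoeff k h) -
        X ^ k * derivative ℂ (complexSeries (extraZetaCoeff k h))) := by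
  ext n
  rw [coeff_C_mul, map_sub, coeff_complexSeries]
  rcases hk with rfl | rfl
  · rcases n with _ | n
    · simp [extraZetaDerivCoeff]
    · simp [extraZetaDerivCoeff, coeff_succ_X_mul, coeff_derivative]
      ring
  · rcases n with _ | _ | n
    · simp [extraZetaDerivCoeff, pow_two, mul_assoc]
    · simp [extraZetaDerivCoeff, coeff_succ_X_mul, pow_two, mul_assoc]
      norm_num
    · simp [extraZetaDerivCoeff, coeff_succ_X_mul, coeff_derivative, pow_two, mul_assoc]
      ring

end BranchSeries

/-! ### The residue `ξ ς ζ'` as an analytic function -/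

namespace HyperexpParams

open PowerSeries

variable (p : HyperexpParams)

theorem complexSeries_varsigmaCoeff (ℓ : Fin p.N) (h1 : p.ρ ℓ ≠ 1) :
    complexSeries (p.varsigmaCoeff ℓ) = (complexSeries (p.zetaCoeff ℓ) - 1)⁻¹ := by
  have h := complexSeries_recipCoeff
    (fun j => if j = 0 then p.zetaCoeff ℓ 0 - 1 else p.zetaCoeff ℓ j)
    (by simpa [zetaCoeff, sub_eq_zero] using h1)
  rw [show p.varsigmaCoeff ℓ = recipCoeff
    (fun j => if j = 0 then p.zetaCoeff ℓ 0 - 1 else p.zetaCoeff ℓ j) from rfl, h]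
  congr 1
  ext n
  rw [map_sub, coeff_complexSeries, coeff_complexSeries, coeff_one]
  by_cases hn : n = 0
  · simp [hn]
  · simp [hn]

/-- With `w = 1/q` the derivative `d/dq` is `-w^2 d/dw`. -/
theorem complexSeries_zetaDerivCoeff (ℓ : Fin p.N) :
    complexSeries (p.zetaDerivCoeff ℓ) =
      -(X ^ 2 * derivative ℂ (complexSeries (p.zetaCoeff ℓ))) := by
  ext n
  rw [map_neg, coeff_complexSeries]
  rcases n with _ | _ | n
  · simp [zetaDerivCoeff, pow_two, mul_assoc]
  · simp [zetaDerivCoeff, coeff_succ_X_mul, pow_two, mul_assoc]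
  · simp [zetaDerivCoeff, coeff_succ_X_mul, coeff_derivative, pow_two, mul_assoc]
    ring

/-- The function `ξ_ℓ ς_ℓ ζ_ℓ'` in the variable `w = 1 / q`, together with the root `ζ_ℓ`. -/
theorem exists_poleBranch (ℓ : Fin p.N) (h1 : p.ρ ℓ ≠ 1) :
    ∃ Z M : ℂ → ℂ, HasTaylor M (complexSeries (p.mCoeff ℓ)) ∧
      Tendsto Z (𝓝 0) (𝓝 (p.ρ ℓ : ℂ)) ∧
      (∀ᶠ w in 𝓝 (0 : ℂ), w ≠ 0 → Z w ≠ p.ρ ℓ ∧ p.psi (Z w) = w⁻¹ ∧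
        ∀ D, HasDerivAt p.psi D (Z w) → D ≠ 0 ∧ (Z w * (Z w - 1) * D)⁻¹ = M w) ∧
      (∀ᶠ z : ℂ in 𝓝 (p.ρ ℓ : ℂ), z ≠ p.ρ ℓ → Z (p.psi z)⁻¹ = z) := by
  obtain ⟨Z, hZ, hr, hl⟩ := p.exists_root_near_pole ℓ
  have hz0 : p.zetaCoeff ℓ 0 = p.ρ ℓ := by simp [zetaCoeff]
  have hρ := (p.ρ_pos ℓ).ne'
  have t1 := hZ.inv (by rw [constantCoeff_complexSeries, hz0]; exact_mod_cast hρ)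
  have t2 := (hZ.sub (HasTaylor.const 1)).inv (by
    rw [map_sub, constantCoeff_complexSeries, hz0, constantCoeff_C, sub_ne_zero]
    exact_mod_cast h1)
  have t3 := ((HasTaylor.id.pow 2).mul hZ.deriv).neg
  refine ⟨Z, fun w => (Z w)⁻¹ * (Z w - 1)⁻¹ * -(w ^ 2 * deriv Z w), ?_, ?_, ?_, hl⟩
  · have := (t1.mul t2).mul t3
    rw [map_one, ← p.complexSeries_varsigmaCoeff ℓ h1, ← p.complexSeries_zetaDerivCoeff,
      ← complexSeries_recipCoeff _ (by rw [hz0]; exact hρ), ← complexSeries_mulCoeff,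
      ← complexSeries_mulCoeff] at this
    exact this
  · have := hZ.analyticAt.continuousAt.tendsto
    rw [hZ.map_zero, constantCoeff_complexSeries, hz0] at this
    exact this
  · filter_upwards [hr.eventually_nhds, hZ.analyticAt.eventually_analyticAt] with w hw hwa hw0
    obtain ⟨hw1, hw2⟩ := mem_of_mem_nhds hw hw0
    refine ⟨hw1, hw2, fun D hD => ?_⟩
    -- Differentiating `ψ(Z(w)) = 1/w` gives `D Z'(w) = -w^(-2)`. Hence `D ≠ 0`, and `1/D = -w^2
    -- Z'(w)` is the derivative of the root with respect to `q`.
    have hcomp : HasDerivAt (fun y => p.psi (Z y)) (D * deriv Z w) w :=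
      hD.comp w hwa.differentiableAt.hasDerivAt
    have hinv : HasDerivAt (fun y => p.psi (Z y)) (-(w ^ 2)⁻¹) w := by
      refine (hasDerivAt_inv hw0).congr_of_eventuallyEq ?_
      filter_upwards [hw, eventually_ne_nhds hw0] with y hy hy0
      exact (hy hy0).2
    have he := hcomp.unique hinv
    have hD0 : D ≠ 0 := by
      rintro rfl
      rw [zero_mul] at he
      exact neg_ne_zero.2 (inv_ne_zero (pow_ne_zero 2 hw0)) he.symm
    refine ⟨hD0, ?_⟩
    have hDi : D⁻¹ = -(w ^ 2 * deriv Z w) := by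
      have hw2' : w ^ 2 ≠ 0 := pow_ne_zero 2 hw0
      have : D * -(w ^ 2 * deriv Z w) = 1 := by
        have : D * -(w ^ 2 * deriv Z w) = -(w ^ 2 * (D * deriv Z w)) := by ring
        rw [this, he, mul_neg, neg_neg, mul_inv_cancel₀ hw2']
      exact inv_eq_of_mul_eq_one_right this
    rw [mul_inv, mul_inv, hDi]

/-- The function `ξ ς ζ'` in the variable `w = q^(-1/k)` for the root `ζ = 1 / ξ` tending to
infinity. -/
theorem exists_extraBranch (k : ℕ) (hk : k = 1 ∨ k = 2) (h : ℕ → ℝ) (h0 : 0 < h 0)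
    (H : ℂ → ℂ) (hH : HasTaylor H (complexSeries h))
    (hpsi : ∀ z : ℂ, z ≠ 0 → H z = z ^ k * p.psi z⁻¹) :
    ∃ ξ M : ℂ → ℂ, HasTaylor M (complexSeries (extraMCoeff k h)) ∧
      (∀ B : ℝ, ∀ᶠ w : ℝ in 𝓝[>] 0, B < ((ξ w)⁻¹).re) ∧
      (∀ᶠ w in 𝓝 (0 : ℂ), w ≠ 0 → p.psi (ξ w)⁻¹ = (w ^ k)⁻¹ ∧
        ∀ D, HasDerivAt p.psi D (ξ w)⁻¹ →
          D ≠ 0 ∧ ((ξ w)⁻¹ * ((ξ w)⁻¹ - 1) * D)⁻¹ = M w) ∧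
      (∀ᶠ z in 𝓝 (0 : ℂ), ∀ w : ℝ, 0 < w → 0 < z.re → p.psi z⁻¹ = ((w : ℂ) ^ k)⁻¹ →
        z = ξ w) := by
  obtain ⟨ξ, hξ, hr, hl⟩ := p.exists_root_near_infinity k hk h h0 H hH hpsi
  have hk0 : k ≠ 0 := by rcases hk with rfl | rfl <;> norm_num
  have hkc : (k : ℂ) ≠ 0 := by exact_mod_cast hk0
  have hx0 := extraXiCoeff_zero k h
  have hx1 := extraXiCoeff_one_pos k h h0
  -- As `ξ(0) = 0`, one can write `ξ = w Y(w)` with `Y(0) > 0`. Then `B = 1/Y` is analytic and `ζ =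
  -- 1/ξ = B(w)/w`; in particular `Re ζ → +∞` as `w ↓ 0`.
  obtain ⟨Y, hYa, hY⟩ := hξ.exists_remainder 0
  simp only [zero_add, Finset.range_one, Finset.sum_singleton, coeff_complexSeries, hx0, pow_one,
    Complex.ofReal_zero, zero_mul] at hY
  have hYT : HasTaylor Y (complexSeries fun i => extraXiCoeff k h (i + 1)) := by
    have e1 := hYa.exists_hasTaylor
    set y := PowerSeries.mk fun n => iteratedDeriv n Y 0 / (n.factorial : ℂ)
    have e2 := (HasTaylor.id.mul e1).congr (g := ξ) (by
      filter_upwards [hY] with z hz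
      rw [hz])
    have e3 := e2.unique hξ
    rw [complexSeries_succ, hx0, Complex.ofReal_zero, map_zero, zero_add] at e3
    rw [← mul_left_cancel₀ X_ne_zero e3]
    exact e1
  have hBT := hYT.inv (by simpa using hx1.ne')
  rw [← complexSeries_recipCoeff _ (by simpa using hx1.ne')] at hBT
  change HasTaylor _ (complexSeries (extraZetaCoeff k h)) at hBT
  set B : ℂ → ℂ := fun z => (Y z)⁻¹ with hB
  have hb0 : extraZetaCoeff k h 0 ≠ 0 := by
    rw [extraZetaCoeff, recipCoeff_zero]
    exact one_div_ne_zero hx1.ne'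
  have t2 := HasTaylor.id.mul ((hBT.sub HasTaylor.id).inv (by simpa using hb0))
  have t3 := (((HasTaylor.id.pow (k - 1)).mul hBT).sub
    ((HasTaylor.id.pow k).mul hBT.deriv)).const_mul ((k : ℂ)⁻¹)
  refine ⟨ξ, fun w => ξ w * (w * (B w - w)⁻¹) *
    ((k : ℂ)⁻¹ * (w ^ (k - 1) * B w - w ^ k * deriv B w)), ?_, ?_, ?_, hl⟩
  · have := (hξ.mul t2).mul t3
    rw [← complexSeries_extraVarsigmaCoeff k h hb0, ← complexSeries_extraZetaDerivCoeff k hk,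
      ← complexSeries_mulCoeff, ← complexSeries_mulCoeff] at this
    exact this
  · intro b
    have hBre : ∀ᶠ w in 𝓝 (0 : ℂ), extraZetaCoeff k h 0 / 2 < (B w).re := by
      have h1 : Tendsto (fun y => (B y).re) (𝓝 0) (𝓝 (extraZetaCoeff k h 0)) := by
        have h2 := (Complex.continuous_re.tendsto _).comp hBT.analyticAt.continuousAt.tendsto
        rw [hBT.map_zero, constantCoeff_complexSeries, Complex.ofReal_re] at h2
        exact h2
      refine h1.eventually_const_lt ?_
      have : 0 < extraZetaCoeff k h 0 := by
        rw [extraZetaCoeff, recipCoeff_zero]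
        positivity
      linarith
    have hofReal : Tendsto (fun w : ℝ => (w : ℂ)) (𝓝[>] 0) (𝓝 0) := by
      have := Complex.continuous_ofReal.tendsto 0
      rw [Complex.ofReal_zero] at this
      exact this.mono_left nhdsWithin_le_nhds
    have hbig : ∀ᶠ w : ℝ in 𝓝[>] 0, b < w⁻¹ * (extraZetaCoeff k h 0 / 2) := by
      have hpos : 0 < extraZetaCoeff k h 0 / 2 := by
        rw [extraZetaCoeff, recipCoeff_zero]
        positivity
      exact (tendsto_inv_nhdsGT_zero.atTop_mul_const hpos).eventually_gt_atTop b
    filter_upwards [hofReal.eventually hBre, hofReal.eventually hY, hbig, self_mem_nhdsWithin]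
      with w h1 h2 h3 h4
    rw [h2, mul_inv, ← Complex.ofReal_inv, Complex.re_ofReal_mul]
    refine h3.trans ?_
    exact mul_lt_mul_of_pos_left h1 (inv_pos.2 h4)
  · filter_upwards [hr.eventually_nhds, hBT.analyticAt.eventually_analyticAt, hY.eventually_nhds]
      with w hw hwa hwY hw0
    obtain ⟨hw1, hw2⟩ := mem_of_mem_nhds hw hw0
    refine ⟨hw2, fun D hD => ?_⟩
    have hζ : ∀ᶠ y in 𝓝 w, (ξ y)⁻¹ = B y * y⁻¹ := by
      filter_upwards [hwY] with y hy
      rw [hy, mul_inv, mul_comm]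
    have hBd : HasDerivAt (fun y => B y * y⁻¹) (deriv B w * w⁻¹ + B w * -(w ^ 2)⁻¹) w :=
      hwa.differentiableAt.hasDerivAt.mul (hasDerivAt_inv hw0)
    have hζd := hBd.congr_of_eventuallyEq hζ
    have hcomp := hD.comp w hζd
    have hinv : HasDerivAt (fun y : ℂ => p.psi (ξ y)⁻¹) (-(k * w ^ (k - 1)) / (w ^ k) ^ 2) w := by
      refine ((hasDerivAt_pow k w).fun_inv (pow_ne_zero k hw0)).congr_of_eventuallyEq ?_
      filter_upwards [hw, eventually_ne_nhds hw0] with y hy hy0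
      exact (hy hy0).2
    have he := hcomp.unique hinv
    have hwk : w ^ k ≠ 0 := pow_ne_zero k hw0
    have hwk1 : w ^ k = w ^ (k - 1) * w := by
      rw [← pow_succ, Nat.sub_add_cancel (Nat.one_le_iff_ne_zero.2 hk0)]
    have hwk2 : w ^ (k - 1) ≠ 0 := pow_ne_zero _ hw0
    -- The chain rule for `ψ(ζ(w)) = w^(-k)` again gives `1/ψ'(ζ) = dζ/dq`, now in the form of
    -- `complexSeries_extraZetaDerivCoeff`.
    have hprod : D * ((k : ℂ)⁻¹ * (w ^ (k - 1) * B w - w ^ k * deriv B w)) = 1 := by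
      have e : D * ((k : ℂ)⁻¹ * (w ^ (k - 1) * B w - w ^ k * deriv B w)) =
          -(k : ℂ)⁻¹ * w ^ (k - 1) * w ^ 2 * (D * (deriv B w * w⁻¹ + B w * -(w ^ 2)⁻¹)) := by
        rw [hwk1]
        field_simp
        ring
      rw [e, he, hwk1]
      field_simp
    have hD0 : D ≠ 0 := by
      rintro rfl
      simp at hprod
    refine ⟨hD0, ?_⟩
    rw [mul_inv, mul_inv, inv_inv, inv_eq_of_mul_eq_one_right hprod]
    congr 2
    rw [mem_of_mem_nhds hζ]
    have : B w * w⁻¹ - 1 = (B w - w) * w⁻¹ := by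
      rw [sub_mul, mul_inv_cancel₀ hw0]
    rw [this, mul_inv, inv_inv, mul_comm]

end HyperexpParams

/-! ## Integrals over vertical lines -/

section VerticalLine

open Complex

theorem integrable_vertical_of_decay {c : ℝ} {f : ℂ → ℂ}
    (hf : Continuous fun y : ℝ => f (c + y * I)) {C R : ℝ}
    (hdecay : ∀ y : ℝ, R ≤ ‖(c + y * I : ℂ)‖ → ‖f (c + y * I)‖ ≤ C / ‖(c + y * I : ℂ)‖ ^ 2) :
    Integrable fun y : ℝ => f (c + y * I) := by
  have hnorm : ∀ y : ℝ, ‖(c + y * I : ℂ)‖ ^ 2 = c ^ 2 + y ^ 2 := by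
    intro y
    rw [← Complex.normSq_eq_norm_sq, Complex.normSq_add_mul_I]
  have hC : 0 ≤ |C| := abs_nonneg C
  refine hf.locallyIntegrable.integrable_of_isBigO_cocompact (g := fun y : ℝ => (1 + y ^ 2)⁻¹) ?_
    (integrable_inv_one_add_sq.integrableAtFilter _)
  have h1 : ∀ᶠ y : ℝ in cocompact ℝ, max R 1 ≤ ‖y‖ :=
    (tendsto_norm_cocompact_atTop (E := ℝ)).eventually_ge_atTop (max R 1)
  refine Asymptotics.IsBigO.of_bound (2 * |C|) ?_
  filter_upwards [h1] with y hy
  have hy1 : 1 ≤ y ^ 2 := by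
    have h2 : (1 : ℝ) ≤ |y| := (le_max_right _ _).trans hy
    rw [← sq_abs]
    nlinarith
  have hyle : ‖y‖ ≤ ‖(c + y * I : ℂ)‖ := by
    refine abs_le_of_sq_le_sq' ?_ (norm_nonneg _) |>.2
    rw [hnorm, Real.norm_eq_abs, sq_abs]
    nlinarith [sq_nonneg c]
  have h3 := hdecay y ((le_max_left _ _).trans (hy.trans hyle))
  rw [hnorm] at h3
  refine h3.trans ?_
  have h4 : 0 < c ^ 2 + y ^ 2 := by positivity
  have h5 : 0 < 1 + y ^ 2 := by positivity
  rw [norm_inv, Real.norm_of_nonneg h5.le, ← div_eq_mul_inv, div_le_div_iff₀ h4 h5]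
  nlinarith [le_abs_self C, sq_nonneg c, mul_nonneg hC (sq_nonneg c), mul_nonneg hC (sq_nonneg y)]

theorem continuous_vertical {c₀ c : ℝ} (hc : c₀ < c) {S : Finset ℂ} (hS : ∀ s ∈ S, c < s.re)
    {f : ℂ → ℂ} (hf : DifferentiableOn ℂ f ({z | c₀ < z.re} \ S)) :
    Continuous fun y : ℝ => f (c + y * I) := by
  refine hf.continuousOn.comp_continuous (by fun_prop) fun y => ⟨?_, fun h => ?_⟩
  · simpa using hc
  · have := hS _ h
    simp at this

/-- Cauchy's theorem on the rectangle with real parts in `[c, c + L]` and imaginary parts in `[-L,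
L]`: the other three sides have total length `4L` and `f` is at most `|C|/L^2` on them, so they
contribute at most `4|C|/L`. -/
theorem integral_vertical_eq_zero {c₀ c : ℝ} (hc₀ : 0 ≤ c₀) (hc : c₀ < c) {f : ℂ → ℂ}
    (hf : DifferentiableOn ℂ f {z | c₀ < z.re}) {C R : ℝ}
    (hdecay : ∀ z : ℂ, c₀ < z.re → R ≤ ‖z‖ → ‖f z‖ ≤ C / ‖z‖ ^ 2) :
    ∫ y : ℝ, f (c + y * I) = 0 := by
  have hcont : Continuous fun y : ℝ => f (c + y * I) :=
    continuous_vertical (S := ∅) hc (by simp) (by simpa using hf)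
  have hint := integrable_vertical_of_decay hcont fun y hy => hdecay _ (by simpa using hc) hy
  have hlim := intervalIntegral_tendsto_integral hint tendsto_neg_atTop_atBot tendsto_id
  refine tendsto_nhds_unique hlim ?_
  have hbound : ∀ᶠ L : ℝ in atTop,
      ‖∫ y in (-L)..(id L), f (c + y * I)‖ ≤ 4 * |C| / L := by
    filter_upwards [eventually_ge_atTop (max R 1)] with L hL
    have hL1 : (1 : ℝ) ≤ L := (le_max_right _ _).trans hL
    have hLR : R ≤ L := (le_max_left _ _).trans hL
    have hL0 : 0 < L := by linarith
    have hc0 : 0 < c := hc₀.trans_lt hc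
    have hb : ∀ z : ℂ, c₀ < z.re → L ≤ ‖z‖ → ‖f z‖ ≤ |C| / L ^ 2 := by
      intro z hz hzL
      refine (hdecay z hz (hLR.trans hzL)).trans ?_
      gcongr
      exact le_abs_self C
    have hrect := Complex.integral_boundary_rect_eq_zero_of_differentiableOn f
      (c + (-L : ℝ) * I) ((c + L : ℝ) + L * I) (hf.mono (by
        intro z hz
        have := hz.1
        simp only [Set.mem_preimage, add_re, ofReal_re, mul_re, I_re, mul_zero, ofReal_im, I_im,
          mul_one, sub_self, add_zero] at this
        rw [Set.uIcc_of_le (by linarith)] at this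
        exact hc.trans_le this.1))
    simp only [add_re, ofReal_re, mul_re, I_re, mul_zero, ofReal_im, I_im, mul_one, sub_self,
      add_zero, add_im, mul_im, zero_add] at hrect
    have n1 : ‖∫ x in c..c + L, f (x + (-L : ℝ) * I)‖ ≤ |C| / L ^ 2 * |c + L - c| := by
      refine intervalIntegral.norm_integral_le_of_norm_le_const fun x hx => ?_
      rw [Set.uIoc_of_le (by linarith)] at hx
      refine hb _ (by simpa using hc.trans hx.1) ?_
      have := Complex.abs_im_le_norm (x + (-L : ℝ) * I)
      simpa [abs_of_pos hL0] using this
    have n2 : ‖∫ x in c..c + L, f (x + L * I)‖ ≤ |C| / L ^ 2 * |c + L - c| := by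
      refine intervalIntegral.norm_integral_le_of_norm_le_const fun x hx => ?_
      rw [Set.uIoc_of_le (by linarith)] at hx
      refine hb _ (by simpa using hc.trans hx.1) ?_
      have := Complex.abs_im_le_norm (x + (L : ℝ) * I)
      simpa [abs_of_pos hL0] using this
    have n3 : ‖∫ y in (-L)..L, f ((c + L : ℝ) + y * I)‖ ≤ |C| / L ^ 2 * |L - -L| := by
      refine intervalIntegral.norm_integral_le_of_norm_le_const fun x hx => ?_
      refine hb _ (by simp; linarith) ?_
      have := Complex.abs_re_le_norm ((c + L : ℝ) + x * I)
      simp only [add_re, ofReal_re, mul_re, I_re, mul_zero, ofReal_im, I_im, mul_one, sub_self,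
        add_zero] at this
      rw [abs_of_pos (by linarith)] at this
      linarith
    have e1 : I * ∫ y in (-L)..L, f (c + y * I) = (∫ x in c..c + L, f (x + (-L : ℝ) * I)) -
        (∫ x in c..c + L, f (x + L * I)) + I * ∫ y in (-L)..L, f ((c + L : ℝ) + y * I) := by
      simp only [smul_eq_mul] at hrect
      linear_combination -hrect
    have e2 : ‖∫ y in (-L)..L, f (c + y * I)‖ = ‖I * ∫ y in (-L)..L, f (c + y * I)‖ := by simp
    rw [id, e2, e1]
    have e3 : ‖I * ∫ y in (-L)..L, f ((c + L : ℝ) + y * I)‖ ≤ |C| / L ^ 2 * |L - -L| := by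
      simpa using n3
    refine (norm_add_le _ _).trans ((add_le_add ((norm_sub_le _ _).trans (add_le_add n1 n2))
      e3).trans (le_of_eq ?_))
    have e4 : |L - -L| = 2 * L := by rw [abs_of_pos (by linarith)]; ring
    rw [add_sub_cancel_left, abs_of_pos hL0, e4]
    field_simp
    ring
  refine squeeze_zero_norm' hbound ?_
  exact tendsto_const_nhds.div_atTop tendsto_id

/-- The kernel with residue `1` at `s`, corrected at the reflected point. -/
noncomputable def poleKernel (c : ℝ) (s z : ℂ) : ℂ :=
  (z - s)⁻¹ - (z - (2 * c - (starRingEnd ℂ) s))⁻¹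

/-- The second pole of the kernel is the mirror image of `s` in the line. With `d = Re s - c` and `t
= y - Im s` the two factors are `it ∓ d`, so on the line the kernel is the real Poisson kernel
`-2d/(d^2 + t^2)`, of total mass `-2π`. -/
theorem poleKernel_vertical {c : ℝ} {s : ℂ} (hs : c < s.re) (y : ℝ) :
    poleKernel c s (c + y * I) =
      ((-2 / (s.re - c) * (1 + ((y - s.im) / (s.re - c)) ^ 2)⁻¹ : ℝ) : ℂ) := by
  have hd : s.re - c ≠ 0 := by linarith
  have hd' : ((s.re : ℂ) - c) ≠ 0 := by exact_mod_cast hd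
  have e1 : (c + y * I : ℂ) - s = (y - s.im : ℝ) * I - (s.re - c : ℝ) := by
    apply Complex.ext <;> simp
  have e2 : (c + y * I : ℂ) - (2 * c - (starRingEnd ℂ) s) =
      (y - s.im : ℝ) * I + (s.re - c : ℝ) := by
    apply Complex.ext
    · simp
      ring
    · simp
  rw [poleKernel, e1, e2]
  set t : ℝ := y - s.im
  set d : ℝ := s.re - c with hdd
  have hdpos : 0 < d := by rw [hdd]; linarith
  have n1 : (t : ℂ) * I - d ≠ 0 := by
    intro h
    have := congrArg re h
    simp at this
    exact hd this
  have n2 : (t : ℂ) * I + d ≠ 0 := by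
    intro h
    have := congrArg re h
    simp at this
    exact hd this
  have n3 : (1 + ((t : ℂ) / d) ^ 2) ≠ 0 := by
    have : (1 + (t / d) ^ 2 : ℝ) ≠ 0 := by positivity
    exact_mod_cast this
  have n4 : (d : ℂ) ≠ 0 := by exact_mod_cast hd
  have n5 : (d : ℂ) ^ 2 + t ^ 2 ≠ 0 := by
    have : (d ^ 2 + t ^ 2 : ℝ) ≠ 0 := by positivity
    exact_mod_cast this
  push_cast
  have e3 : (1 + ((t : ℂ) / d) ^ 2) = (d ^ 2 + t ^ 2) / d ^ 2 := by field_simp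
  rw [e3, inv_div, inv_sub_inv n1 n2, div_mul_div_comm, div_eq_div_iff (mul_ne_zero n1 n2)
    (mul_ne_zero n4 n5)]
  linear_combination (2 * d ^ 2 * (t : ℂ) ^ 2) * I_sq

theorem integral_poleKernel {c : ℝ} {s : ℂ} (hs : c < s.re) :
    Integrable (fun y : ℝ => poleKernel c s (c + y * I)) ∧
      ∫ y : ℝ, poleKernel c s (c + y * I) = -2 * Real.pi := by
  have hd : 0 < s.re - c := by linarith
  simp only [poleKernel_vertical hs]
  have h1 : Integrable fun y : ℝ => (1 + ((y - s.im) / (s.re - c)) ^ 2)⁻¹ :=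
    (integrable_inv_one_add_sq.comp_div hd.ne').comp_sub_right s.im
  refine ⟨(h1.const_mul _).ofReal, ?_⟩
  have h2 : ∫ y : ℝ, (1 + ((y - s.im) / (s.re - c)) ^ 2)⁻¹ = (s.re - c) * Real.pi := by
    rw [integral_sub_right_eq_self (fun y : ℝ => (1 + (y / (s.re - c)) ^ 2)⁻¹),
      Measure.integral_comp_div (fun y : ℝ => (1 + y ^ 2)⁻¹), integral_univ_inv_one_add_sq,
      abs_of_pos hd, smul_eq_mul]
  rw [integral_complex_ofReal, integral_const_mul, h2]
  norm_cast
  field_simp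

/-- The mirror pole cancels the `1/z` tail of `(z - s)⁻¹`, so subtracting a multiple of the kernel
preserves quadratic decay. -/
theorem norm_poleKernel_le {c : ℝ} (s z : ℂ) (hz : 2 * ‖s‖ ≤ ‖z‖)
    (hz' : 2 * ‖2 * c - (starRingEnd ℂ) s‖ ≤ ‖z‖) (h0 : 0 < ‖z‖) :
    ‖poleKernel c s z‖ ≤ 4 * ‖s - (2 * c - (starRingEnd ℂ) s)‖ / ‖z‖ ^ 2 := by
  set s' : ℂ := 2 * c - (starRingEnd ℂ) s
  have h1 : ‖z‖ / 2 ≤ ‖z - s‖ := by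
    have := norm_sub_norm_le z s
    linarith
  have h2 : ‖z‖ / 2 ≤ ‖z - s'‖ := by
    have := norm_sub_norm_le z s'
    linarith
  have p1 : 0 < ‖z - s‖ := by linarith
  have p2 : 0 < ‖z - s'‖ := by linarith
  have e : poleKernel c s z = (s - s') / ((z - s) * (z - s')) := by
    rw [poleKernel, inv_sub_inv (norm_pos_iff.1 p1) (norm_pos_iff.1 p2)]
    congr 1
    ring
  rw [e, norm_div, norm_mul, div_le_div_iff₀ (by positivity) (by positivity)]
  have h3 : ‖z‖ ^ 2 ≤ 4 * (‖z - s‖ * ‖z - s'‖) := by nlinarith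
  nlinarith [norm_nonneg (s - s')]

/-- Closing the contour to the right: an integral over a vertical line is minus the sum of the
residues at the simple poles to its right. -/
theorem integral_vertical_eq_neg_sum (c : ℝ) (A : ℂ → ℂ) (S : Finset ℂ) :
    ∀ (c₀ : ℝ) (_ : 0 ≤ c₀) (_ : c₀ < c) (_ : ∀ s ∈ S, c < s.re) (f : ℂ → ℂ)
      (_ : DifferentiableOn ℂ f ({z | c₀ < z.re} \ S))
      (_ : ∀ s ∈ S, Tendsto (fun z => (z - s) * f z) (𝓝[≠] s) (𝓝 (A s)))
      (C R : ℝ) (_ : ∀ z : ℂ, c₀ < z.re → R ≤ ‖z‖ → ‖f z‖ ≤ C / ‖z‖ ^ 2),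
      ∫ y : ℝ, f (c + y * I) = -2 * Real.pi * ∑ s ∈ S, A s := by
  classical
  -- Each step subtracts `A s` times `poleKernel c s`, which removes the pole `s` and accounts for
  -- `-2π A s`. The kernel has a new pole at the mirror point, left of the line, so the half-plane
  -- shrinks to `Re z > c₁`. Hence `c₀`, `f` and the decay constants must vary in the induction.
  induction S using Finset.induction_on with
  | empty =>
    intro c₀ hc₀ hc _ f hf _ C R hdecay
    simpa using integral_vertical_eq_zero hc₀ hc (by simpa using hf) hdecay
  | insert s S hsS ih =>
    intro c₀ hc₀ hc hS f hf hres C R hdecay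
    have hsc : c < s.re := hS s (by simp)
    set s' : ℂ := 2 * c - (starRingEnd ℂ) s with hs'
    have hs're : s'.re = 2 * c - s.re := by simp [hs']
    set c₁ := max c₀ s'.re with hc₁
    have hc₁c : c₁ < c := max_lt hc (by rw [hs're]; linarith)
    set k : ℂ → ℂ := fun z => f z - A s * poleKernel c s z with hk
    set D : Set ℂ := {z | c₁ < z.re} \ (S : Set ℂ) with hD
    have hDo : IsOpen D :=
      (isOpen_lt continuous_const Complex.continuous_re).sdiff S.finite_toSet.isClosed
    have hsD : s ∈ D := ⟨hc₁c.trans hsc, by simpa using hsS⟩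
    have hKd : ∀ z : ℂ, c₁ < z.re → z ≠ s → DifferentiableAt ℂ (poleKernel c s) z := by
      intro z hz hzs
      have h1 : z - s ≠ 0 := sub_ne_zero.2 hzs
      have h2 : z - s' ≠ 0 := by
        refine sub_ne_zero.2 fun h => ?_
        rw [h] at hz
        exact absurd hz (not_lt.2 (le_max_right _ _))
      have d1 : DifferentiableAt ℂ (fun z => (z - s)⁻¹) z :=
        (differentiableAt_id.sub_const s).inv h1
      have d2 : DifferentiableAt ℂ (fun z => (z - s')⁻¹) z :=
        (differentiableAt_id.sub_const s').inv h2
      exact d1.sub d2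
    have hkd : DifferentiableOn ℂ k (D \ {s}) := by
      intro z hz
      have h1 : DifferentiableWithinAt ℂ f (D \ {s}) z := by
        refine (hf z ⟨lt_of_le_of_lt (le_max_left c₀ _) hz.1.1, ?_⟩).mono ?_
        · simpa using ⟨hz.2, hz.1.2⟩
        · intro w hw
          exact ⟨lt_of_le_of_lt (le_max_left c₀ _) hw.1.1, by simpa using ⟨hw.2, hw.1.2⟩⟩
      exact h1.sub ((hKd z hz.1.1 hz.2).const_mul _).differentiableWithinAt
    have hKs : Tendsto (fun z => (z - s) * poleKernel c s z) (𝓝[≠] s) (𝓝 1) := by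
      have h1 : Tendsto (fun z : ℂ => 1 - (z - s) * (z - s')⁻¹) (𝓝[≠] s) (𝓝 1) := by
        have h2 : ContinuousAt (fun z : ℂ => 1 - (z - s) * (z - s')⁻¹) s := by
          have : s - s' ≠ 0 := by
            intro h
            have := congrArg re h
            rw [sub_re, hs're, zero_re] at this
            linarith
          fun_prop (disch := assumption)
        have h3 := h2.tendsto
        simp only [sub_self, zero_mul, sub_zero] at h3
        exact h3.mono_left nhdsWithin_le_nhds
      refine h1.congr' ?_
      filter_upwards [self_mem_nhdsWithin] with z hz
      rw [poleKernel, mul_sub, mul_inv_cancel₀ (sub_ne_zero.2 hz)]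
    have hks : Tendsto (fun z => (z - s) * k z) (𝓝[≠] s) (𝓝 0) := by
      have h1 := (hres s (by simp)).sub (hKs.const_mul (A s))
      rw [mul_one, sub_self] at h1
      refine h1.congr fun z => ?_
      simp only [hk]
      ring
    -- With zero residue left, the singularity of `k` at `s` is removable by Riemann's theorem; `g`
    -- is the extension, changed only at `s`, which is not on the line.
    have hlo : (fun z => k z - k s) =o[𝓝[≠] s] fun z => (z - s)⁻¹ := by
      rw [Asymptotics.isLittleO_iff_tendsto']
      · have h1 : Tendsto (fun z => (z - s) * k s) (𝓝[≠] s) (𝓝 0) := by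
          have : Continuous fun z => (z - s) * k s := by fun_prop
          have h2 := this.tendsto s
          simp only [sub_self, zero_mul] at h2
          exact h2.mono_left nhdsWithin_le_nhds
        have h2 := hks.sub h1
        rw [sub_zero] at h2
        refine h2.congr fun z => ?_
        rw [div_inv_eq_mul]
        ring
      · filter_upwards [self_mem_nhdsWithin] with z hz h
        exact absurd h (inv_ne_zero (sub_ne_zero.2 hz))
    set g := Function.update k s (limUnder (𝓝[≠] s) k) with hg
    have hgd : DifferentiableOn ℂ g D :=
      Complex.differentiableOn_update_limUnder_of_isLittleO (hDo.mem_nhds hsD) hkd hlo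
    have hgk : ∀ z, z ≠ s → g z = k z := fun z hz => Function.update_of_ne hz _ _
    have hgres : ∀ t ∈ S, Tendsto (fun z => (z - t) * g z) (𝓝[≠] t) (𝓝 (A t)) := by
      intro t ht
      have hts : t ≠ s := fun h => hsS (h ▸ ht)
      have htc : c₁ < t.re := hc₁c.trans (hS t (by simp [ht]))
      have h1 : Tendsto (fun z => (z - t) * poleKernel c s z) (𝓝[≠] t) (𝓝 0) := by
        have h2 : ContinuousAt (fun z => (z - t) * poleKernel c s z) t :=
          (continuousAt_id.sub continuousAt_const).mul (hKd t htc hts).continuousAt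
        have h3 := h2.tendsto
        simp only [sub_self, zero_mul] at h3
        exact h3.mono_left nhdsWithin_le_nhds
      have h4 := (hres t (by simp [ht])).sub (h1.const_mul (A s))
      rw [mul_zero, sub_zero] at h4
      refine h4.congr' ?_
      have h5 : ∀ᶠ z in 𝓝[≠] t, z ≠ s :=
        (eventually_ne_nhds hts).filter_mono nhdsWithin_le_nhds
      filter_upwards [h5] with z hz
      rw [hgk z hz]
      simp only [hk]
      ring
    have hline : ∀ y : ℝ, (c + y * I : ℂ) ≠ s := by
      intro y h
      have := congrArg re h
      simp at this
      linarith
    set C' := |C| + ‖A s‖ * (4 * ‖s - s'‖)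
    set R' := max R (max (2 * ‖s‖) (max (2 * ‖s'‖) 1))
    have hdecay' : ∀ z : ℂ, c₁ < z.re → R' ≤ ‖z‖ → ‖g z‖ ≤ C' / ‖z‖ ^ 2 := by
      intro z hz hzR
      have r1 : R ≤ ‖z‖ := (le_max_left _ _).trans hzR
      have r2 := (le_max_right _ _).trans hzR
      have r3 : 2 * ‖s‖ ≤ ‖z‖ := (le_max_left _ _).trans r2
      have r4 := (le_max_right _ _).trans r2
      have r5 : 2 * ‖s'‖ ≤ ‖z‖ := (le_max_left _ _).trans r4
      have r6 : 1 ≤ ‖z‖ := (le_max_right _ _).trans r4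
      have hz0 : 0 < ‖z‖ := by linarith
      have hzs : z ≠ s := by
        rintro rfl
        linarith
      rw [hgk z hzs, add_div, mul_div_assoc]
      refine (norm_sub_le _ _).trans (add_le_add ?_ ?_)
      · refine (hdecay z ((le_max_left _ _).trans_lt hz) r1).trans ?_
        gcongr
        exact le_abs_self C
      · rw [norm_mul]
        gcongr
        exact norm_poleKernel_le s z r3 r5 hz0
    have hIH := ih c₁ (hc₀.trans (le_max_left _ _)) hc₁c (fun t ht => hS t (by simp [ht])) g hgd
      hgres C' R' hdecay'
    have hgi : Integrable fun y : ℝ => g (c + y * I) :=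
      integrable_vertical_of_decay
        (continuous_vertical hc₁c (fun t ht => hS t (by simp [ht])) hgd)
        fun y hy => hdecay' _ (by simpa using hc₁c) hy
    obtain ⟨hKi, hKint⟩ := integral_poleKernel hsc
    have hfg : ∀ y : ℝ, f (c + y * I) = g (c + y * I) + A s * poleKernel c s (c + y * I) := by
      intro y
      rw [hgk _ (hline y)]
      simp only [hk]
      ring
    simp_rw [hfg]
    rw [integral_add hgi (hKi.const_mul _), integral_const_mul, hIH, hKint, Finset.sum_insert hsS]
    ring

end VerticalLine

/-! ### Residues of `1 / (z (z - 1) (q - ψ(z)))` -/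

namespace HyperexpParams

open Complex

variable (p : HyperexpParams)

theorem differentiableAt_psi {z : ℂ} (hz : 0 < z.re) (hρ : ∀ ℓ, z ≠ p.ρ ℓ) :
    DifferentiableAt ℂ p.psi z := by
  have h1 : ∀ ℓ, (p.ρ ℓ : ℂ) - z ≠ 0 := fun ℓ => sub_ne_zero.2 (hρ ℓ).symm
  have h2 : ∀ ℓ, (p.ρHat ℓ : ℂ) + z ≠ 0 := by
    intro ℓ h
    have := congrArg re h
    have := p.ρHat_pos ℓ
    simp at *
    linarith
  unfold psi
  refine DifferentiableAt.sub (DifferentiableAt.add (by fun_prop) (differentiableAt_id.mul ?_))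
    (differentiableAt_id.mul ?_)
  · exact DifferentiableAt.fun_sum fun ℓ _ =>
      (differentiableAt_const _).div ((differentiableAt_const _).sub differentiableAt_id) (h1 ℓ)
  · exact DifferentiableAt.fun_sum fun ℓ _ =>
      (differentiableAt_const _).div ((differentiableAt_const _).add differentiableAt_id) (h2 ℓ)

/-- A pole of `ψ` is a zero of `1/(q - ψ)`, hence a removable point with residue `0`. It still
counts among the singularities, because at `ρ_ℓ` itself the convention `α / 0 = 0` gives `psi` a
spurious value. -/
theorem tendsto_sub_mul_inv_pole (q : ℝ) (ℓ : Fin p.N) (h1 : 1 < p.ρ ℓ) :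
    Tendsto (fun z => (z - p.ρ ℓ) * (z * (z - 1) * (q - p.psi z))⁻¹) (𝓝[≠] (p.ρ ℓ : ℂ)) (𝓝 0) := by
  have hα : (p.α ℓ : ℂ) ≠ 0 := by exact_mod_cast (p.α_pos ℓ).ne'
  have hρ : (p.ρ ℓ : ℂ) ≠ 0 := by exact_mod_cast (p.ρ_pos ℓ).ne'
  have hρ1 : (p.ρ ℓ : ℂ) - 1 ≠ 0 := by
    rw [sub_ne_zero]; exact_mod_cast h1.ne'
  have hcont : ContinuousAt (fun z : ℂ => p.poleFun ℓ (z - p.ρ ℓ)) (p.ρ ℓ : ℂ) := by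
    refine ContinuousAt.comp (g := p.poleFun ℓ) (f := fun z : ℂ => z - p.ρ ℓ) ?_ (by fun_prop)
    rw [sub_self]
    exact (p.hasTaylor_poleFun ℓ).analyticAt.continuousAt
  have hval : p.poleFun ℓ 0 = -((p.α ℓ : ℂ) * p.ρ ℓ) := by simp [poleFun]
  have h2 : ContinuousAt (fun z : ℂ => (z - p.ρ ℓ) ^ 2 *
      (z * (z - 1) * (q * (z - p.ρ ℓ) - p.poleFun ℓ (z - p.ρ ℓ)))⁻¹) (p.ρ ℓ : ℂ) := by
    refine ContinuousAt.mul (by fun_prop) (ContinuousAt.inv₀ ?_ ?_)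
    · exact ContinuousAt.mul (by fun_prop) (ContinuousAt.sub (by fun_prop) hcont)
    · rw [sub_self, hval]
      simp [hα, hρ, hρ1]
  have h3 := h2.tendsto
  simp only [sub_self, ne_eq, OfNat.ofNat_ne_zero, not_false_eq_true, zero_pow, zero_mul] at h3
  refine (h3.mono_left nhdsWithin_le_nhds).congr' ?_
  filter_upwards [self_mem_nhdsWithin] with z hz
  have hz' : z - p.ρ ℓ ≠ 0 := sub_ne_zero.2 hz
  rw [p.poleFun_eq ℓ hz', add_sub_cancel]
  have : z * (z - 1) * (q * (z - p.ρ ℓ) - (z - p.ρ ℓ) * p.psi z) =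
      (z - p.ρ ℓ) * (z * (z - 1) * (q - p.psi z)) := by ring
  rw [this, mul_inv, pow_two]
  field_simp

/-- The integral of `1 / (z (z - 1) (q - ψ(z)))` over a vertical line, by residues at the roots of
`ψ(z) = q`. -/
theorem integral_vertical_inv_sub_psi (c : ℝ) (hc : 1 < c) (hρ : ∀ ℓ, c < p.ρ ℓ) (q : ℝ)
    {ι : Type*} [Fintype ι] (ζ : ι → ℂ) (hinj : Function.Injective ζ) (hre : ∀ i, c < (ζ i).re)
    (hnp : ∀ i ℓ, ζ i ≠ p.ρ ℓ)
    (hroot : ∀ i, p.psi (ζ i) = q)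
    (hall : ∀ z : ℂ, 1 < z.re → (∀ ℓ, z ≠ p.ρ ℓ) → p.psi z = q → ∃ i, z = ζ i)
    (hder : ∀ i, deriv p.psi (ζ i) ≠ 0)
    (R : ℝ) (hfar : ∀ z : ℂ, 1 < z.re → R ≤ ‖z‖ → 1 ≤ ‖q - p.psi z‖) :
    ∫ y : ℝ, ((c + y * I) * ((c + y * I) - 1) * (q - p.psi (c + y * I)) : ℂ)⁻¹ =
      2 * Real.pi * ∑ i, (ζ i * (ζ i - 1) * deriv p.psi (ζ i))⁻¹ := by
  classical
  set P : Finset ℂ := Finset.univ.image fun ℓ => (p.ρ ℓ : ℂ) with hP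
  set Q : Finset ℂ := Finset.univ.image ζ with hQ
  have hPQ : Disjoint P Q := by
    rw [Finset.disjoint_left]
    intro s hs hs'
    simp only [hP, hQ, Finset.mem_image, Finset.mem_univ, true_and] at hs hs'
    obtain ⟨ℓ, rfl⟩ := hs
    obtain ⟨i, hi⟩ := hs'
    exact hnp i ℓ hi
  set A : ℂ → ℂ := fun s => if s ∈ P then 0 else -(s * (s - 1) * deriv p.psi s)⁻¹ with hA
  have hre1 : ∀ z : ℂ, 1 < z.re → z * (z - 1) ≠ 0 := by
    intro z hz
    refine mul_ne_zero ?_ (sub_ne_zero.2 ?_)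
    · rintro rfl
      norm_num at hz
    · rintro rfl
      norm_num at hz
  have hmem : ∀ s ∈ P ∪ Q, c < s.re := by
    intro s hs
    simp only [hP, hQ, Finset.mem_union, Finset.mem_image, Finset.mem_univ, true_and] at hs
    rcases hs with ⟨ℓ, rfl⟩ | ⟨i, rfl⟩
    · simpa using hρ ℓ
    · exact hre i
  have hdiff : DifferentiableOn ℂ (fun z => (z * (z - 1) * (q - p.psi z))⁻¹)
      ({z | 1 < z.re} \ ((P ∪ Q : Finset ℂ) : Set ℂ)) := by
    intro z hz
    have hz1 : 1 < z.re := hz.1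
    have hz2 := hz.2
    simp only [hP, hQ, Finset.coe_union, Set.mem_union, Finset.coe_image, Finset.coe_univ,
      Set.image_univ, Set.mem_range, not_or, not_exists] at hz2
    have hzρ : ∀ ℓ, z ≠ p.ρ ℓ := fun ℓ h => hz2.1 ℓ h.symm
    have hd := p.differentiableAt_psi (by linarith) hzρ
    refine DifferentiableAt.differentiableWithinAt (DifferentiableAt.fun_inv ?_ ?_)
    · fun_prop
    · refine mul_ne_zero (hre1 z hz1) (sub_ne_zero.2 fun h => ?_)
      obtain ⟨i, hi⟩ := hall z hz1 hzρ h.symm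
      exact hz2.2 i hi.symm
  have hres : ∀ s ∈ P ∪ Q, Tendsto (fun z => (z - s) * (z * (z - 1) * (q - p.psi z))⁻¹)
      (𝓝[≠] s) (𝓝 (A s)) := by
    intro s hs
    rw [Finset.mem_union] at hs
    rcases hs with hs | hs
    · have hAs : A s = 0 := by simp only [hA, if_pos hs]
      rw [hAs]
      simp only [hP, Finset.mem_image, Finset.mem_univ, true_and] at hs
      obtain ⟨ℓ, rfl⟩ := hs
      exact p.tendsto_sub_mul_inv_pole q ℓ (hc.trans (hρ ℓ))
    · have hAs : A s = -(s * (s - 1) * deriv p.psi s)⁻¹ := by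
        simp only [hA, if_neg (Finset.disjoint_right.1 hPQ hs)]
      rw [hAs]
      simp only [hQ, Finset.mem_image, Finset.mem_univ, true_and] at hs
      obtain ⟨i, rfl⟩ := hs
      have hi1 : 1 < (ζ i).re := hc.trans (hre i)
      have hd := (p.differentiableAt_psi (by linarith) (hnp i)).hasDerivAt
      have h1 := hasDerivAt_iff_tendsto_slope.1 hd
      have h2 : Tendsto (fun z => z * (z - 1)) (𝓝[≠] ζ i) (𝓝 (ζ i * (ζ i - 1))) := by
        have : Continuous fun z : ℂ => z * (z - 1) := by fun_prop
        exact (this.tendsto _).mono_left nhdsWithin_le_nhds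
      have h3 := ((h2.mul h1).inv₀ (mul_ne_zero (hre1 _ hi1) (hder i))).neg
      refine h3.congr' ?_
      filter_upwards [self_mem_nhdsWithin] with z hz
      have hz' : z - ζ i ≠ 0 := sub_ne_zero.2 hz
      have e : z * (z - 1) * (q - p.psi z) =
          -(z * (z - 1) * ((p.psi z - q) / (z - ζ i))) * (z - ζ i) := by
        field_simp
        ring
      rw [slope_def_field, hroot i, e, mul_inv _ (z - ζ i), inv_neg, mul_comm (z - ζ i),
        inv_mul_cancel_right₀ hz']
  have hdecay : ∀ z : ℂ, 1 < z.re → max R 2 ≤ ‖z‖ →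
      ‖(z * (z - 1) * (q - p.psi z))⁻¹‖ ≤ 2 / ‖z‖ ^ 2 := by
    intro z hz hzR
    have r1 := hfar z hz ((le_max_left _ _).trans hzR)
    have r2 : 2 ≤ ‖z‖ := (le_max_right _ _).trans hzR
    have r3 : ‖z‖ / 2 ≤ ‖z - 1‖ := by
      have := norm_sub_norm_le z 1
      rw [norm_one] at this
      linarith
    have p1 : 0 < ‖z - 1‖ := by linarith
    have p2 : 0 < ‖q - p.psi z‖ := by linarith
    rw [norm_inv, norm_mul, norm_mul, inv_eq_one_div, div_le_div_iff₀ (by positivity)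
      (by positivity)]
    have r4 : ‖z‖ * (‖z‖ / 2) ≤ ‖z‖ * ‖z - 1‖ := by gcongr
    have r5 : ‖z‖ * ‖z - 1‖ * 1 ≤ ‖z‖ * ‖z - 1‖ * ‖q - p.psi z‖ := by gcongr
    nlinarith
  have hmain := integral_vertical_eq_neg_sum c A (P ∪ Q) 1 zero_le_one hc hmem
    (fun z => (z * (z - 1) * (q - p.psi z))⁻¹) hdiff hres 2 (max R 2) hdecay
  rw [hmain, Finset.sum_union hPQ, Finset.sum_eq_zero (s := P) fun s hs => by
    simp only [hA, if_pos hs], zero_add, hQ, Finset.sum_image fun i _ j _ h => hinj h]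
  have : ∀ i, A (ζ i) = -(ζ i * (ζ i - 1) * deriv p.psi (ζ i))⁻¹ := by
    intro i
    have hi : ζ i ∉ P := Finset.disjoint_right.1 hPQ (by simp [hQ])
    simp only [hA, if_neg hi]
  simp only [this, Finset.sum_neg_distrib]
  ring

/-- Away from its poles and in a bounded part of the half-plane, `ψ` is bounded. -/
theorem exists_bound_psi (V : Fin p.N → Set ℂ) (hV : ∀ ℓ, V ℓ ∈ 𝓝 (p.ρ ℓ : ℂ)) (R : ℝ) :
    ∃ B : ℝ, ∀ z : ℂ, 1 < z.re → ‖z‖ ≤ R → (∀ ℓ, z ∉ V ℓ) → ‖p.psi z‖ ≤ B := by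
  set K : Set ℂ := (Metric.closedBall 0 R ∩ {z | 1 ≤ z.re}) \ ⋃ ℓ, interior (V ℓ) with hK
  have hKc : IsCompact K := by
    refine IsCompact.diff ?_ (isOpen_iUnion fun ℓ => isOpen_interior)
    exact (isCompact_closedBall 0 R).inter_right (isClosed_le continuous_const continuous_re)
  have hcont : ContinuousOn p.psi K := by
    intro z hz
    have hz1 : 1 ≤ z.re := hz.1.2
    refine (p.differentiableAt_psi (by linarith) fun ℓ h => ?_).continuousAt.continuousWithinAt
    refine hz.2 (Set.mem_iUnion.2 ⟨ℓ, ?_⟩)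
    rw [h]
    exact mem_interior_iff_mem_nhds.2 (hV ℓ)
  obtain ⟨B, hB⟩ := hKc.exists_bound_of_continuousOn hcont
  refine ⟨B, fun z hz hzR hzV => hB z ⟨⟨by simpa using hzR, hz.le⟩, fun h => ?_⟩⟩
  obtain ⟨ℓ, hℓ⟩ := Set.mem_iUnion.1 h
  exact hzV ℓ (interior_subset hℓ)

/-- The vertical integral as the sum of the contributions of the roots near the poles and of the
roots `η j` tending to infinity. -/
theorem exists_eventually_integral_eq (c : ℝ) (hc : 1 < c) (hρ : ∀ ℓ, c < p.ρ ℓ)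
    {J : Type} [Fintype J] [Subsingleton J] (η V : J → ℝ → ℂ)
    (hη : ∀ j, ∀ᶠ q : ℝ in atTop, p.psi (η j q) = q ∧
      ∀ D, HasDerivAt p.psi D (η j q) → D ≠ 0 ∧ (η j q * (η j q - 1) * D)⁻¹ = V j q)
    (hηre : ∀ j, ∀ B : ℝ, ∀ᶠ q : ℝ in atTop, B < (η j q).re)
    (hfar : ∃ R : ℝ, ∀ᶠ q : ℝ in atTop, ∀ z : ℂ, 1 < z.re → R ≤ ‖z‖ → p.psi z = q →
      ∃ j, z = η j q)
    (hdec : ∀ᶠ q : ℝ in atTop, ∃ R : ℝ, ∀ z : ℂ, 1 < z.re → R ≤ ‖z‖ → 1 ≤ ‖q - p.psi z‖) :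
    ∃ M : Fin p.N → ℂ → ℂ, (∀ ℓ, HasTaylor (M ℓ) (complexSeries (p.mCoeff ℓ))) ∧
      ∀ᶠ q : ℝ in atTop,
        ∫ y : ℝ, ((c + y * I) * ((c + y * I) - 1) * (q - p.psi (c + y * I)) : ℂ)⁻¹ =
          2 * Real.pi * (∑ ℓ, M ℓ (q : ℂ)⁻¹ + ∑ j, V j q) := by
  have hρ1 : ∀ ℓ, 1 < p.ρ ℓ := fun ℓ => hc.trans (hρ ℓ)
  choose Z M hM hZt hZ hZl using fun ℓ => p.exists_poleBranch ℓ (hρ1 ℓ).ne'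
  refine ⟨M, hM, ?_⟩
  obtain ⟨R, hR⟩ := hfar
  -- Near `ρ_ℓ` every root of `ψ(z) = q` is the branch `Z ℓ`. Outside these neighbourhoods and
  -- inside radius `R`, `ψ` is bounded by `B`, so there is no root once `q > B`; beyond `R` the
  -- hypothesis `hfar` applies.
  set W : Fin p.N → Set ℂ := fun ℓ => {z | z ≠ p.ρ ℓ → Z ℓ (p.psi z)⁻¹ = z}
  obtain ⟨B, hB⟩ := p.exists_bound_psi W hZl R
  have hw : Tendsto (fun q : ℝ => (q : ℂ)⁻¹) atTop (𝓝 0) := by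
    have h := (continuous_ofReal.tendsto 0).comp tendsto_inv_atTop_zero
    simpa [Function.comp_def] using h
  have e1 : ∀ᶠ q : ℝ in atTop, ∀ ℓ, Z ℓ (q : ℂ)⁻¹ ≠ p.ρ ℓ ∧ p.psi (Z ℓ (q : ℂ)⁻¹) = q ∧
      ∀ D, HasDerivAt p.psi D (Z ℓ (q : ℂ)⁻¹) → D ≠ 0 ∧
        (Z ℓ (q : ℂ)⁻¹ * (Z ℓ (q : ℂ)⁻¹ - 1) * D)⁻¹ = M ℓ (q : ℂ)⁻¹ := by
    refine eventually_all.2 fun ℓ => ?_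
    filter_upwards [hw.eventually (hZ ℓ), eventually_gt_atTop 0] with q hq hq0
    have := hq (inv_ne_zero (by exact_mod_cast hq0.ne'))
    rwa [inv_inv] at this
  have hlim : ∀ ℓ, Tendsto (fun q : ℝ => Z ℓ (q : ℂ)⁻¹) atTop (𝓝 (p.ρ ℓ : ℂ)) :=
    fun ℓ => (hZt ℓ).comp hw
  have e2 : ∀ᶠ q : ℝ in atTop, ∀ ℓ, ∀ ℓ', ℓ ≠ ℓ' → Z ℓ (q : ℂ)⁻¹ ≠ Z ℓ' (q : ℂ)⁻¹ := by
    refine eventually_all.2 fun ℓ => eventually_all.2 fun ℓ' => ?_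
    by_cases h : ℓ = ℓ'
    · exact Eventually.of_forall fun q h' => absurd h h'
    · have hne : (p.ρ ℓ : ℂ) ≠ p.ρ ℓ' := sub_ne_zero.1 (p.rho_sub_ne h)
      filter_upwards [((hlim ℓ).sub (hlim ℓ')).eventually_ne (sub_ne_zero.2 hne)] with q hq _
      exact sub_ne_zero.1 hq
  have e3 : ∀ᶠ q : ℝ in atTop, ∀ ℓ, ∀ ℓ', Z ℓ (q : ℂ)⁻¹ ≠ p.ρ ℓ' := by
    refine eventually_all.2 fun ℓ => eventually_all.2 fun ℓ' => ?_
    by_cases h : ℓ = ℓ'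
    · subst h
      filter_upwards [e1] with q hq
      exact (hq ℓ).1
    · have hne : (p.ρ ℓ : ℂ) ≠ p.ρ ℓ' := sub_ne_zero.1 (p.rho_sub_ne h)
      exact (hlim ℓ).eventually_ne hne
  have e4 : ∀ᶠ q : ℝ in atTop, ∀ ℓ, c < (Z ℓ (q : ℂ)⁻¹).re := by
    refine eventually_all.2 fun ℓ => ?_
    have h := (continuous_re.tendsto _).comp (hlim ℓ)
    rw [ofReal_re] at h
    exact h.eventually_const_lt (hρ ℓ)
  -- The abscissa `ρ_ℓ + 1` separates the roots near the poles from those tending to infinity, so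
  -- that no root is counted twice.
  have e5 : ∀ᶠ q : ℝ in atTop, ∀ ℓ, (Z ℓ (q : ℂ)⁻¹).re < p.ρ ℓ + 1 := by
    refine eventually_all.2 fun ℓ => ?_
    have h := (continuous_re.tendsto _).comp (hlim ℓ)
    rw [ofReal_re] at h
    exact h.eventually_lt_const (lt_add_one _)
  have e6 : ∀ᶠ q : ℝ in atTop, ∀ j, ∀ ℓ, p.ρ ℓ + 1 < (η j q).re :=
    eventually_all.2 fun j => eventually_all.2 fun ℓ => hηre j _
  have e7 : ∀ᶠ q : ℝ in atTop, ∀ j, c < (η j q).re := eventually_all.2 fun j => hηre j c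
  filter_upwards [e1, e2, e3, e4, e5, e6, e7, hR, hdec, eventually_all.2 hη,
    eventually_gt_atTop B] with q h1 h2 h3 h4 h5 h6 h7 h8 h9 h10 h11
  obtain ⟨R', hR'⟩ := h9
  set ζ : Fin p.N ⊕ J → ℂ := Sum.elim (fun ℓ => Z ℓ (q : ℂ)⁻¹) (fun j => η j q) with hζ
  have hre : ∀ i, c < (ζ i).re := by
    rintro (ℓ | j)
    · exact h4 ℓ
    · exact h7 j
  have hnp : ∀ i ℓ, ζ i ≠ p.ρ ℓ := by
    rintro (ℓ' | j) ℓ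
    · exact h3 ℓ' ℓ
    · intro h
      have h' := congrArg re h
      have := h6 j ℓ
      simp only [hζ, Sum.elim_inr, ofReal_re] at h'
      linarith
  have hder : ∀ i, HasDerivAt p.psi (deriv p.psi (ζ i)) (ζ i) := fun i =>
    (p.differentiableAt_psi (by linarith [hre i]) (hnp i)).hasDerivAt
  have hmain := p.integral_vertical_inv_sub_psi c hc hρ q ζ ?_ hre hnp ?_ ?_ ?_ R' hR'
  · rw [hmain, Fintype.sum_sum_type]
    congr 2
    · exact Finset.sum_congr rfl fun ℓ _ => ((h1 ℓ).2.2 _ (hder (Sum.inl ℓ))).2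
    · exact Finset.sum_congr rfl fun j _ => ((h10 j).2 _ (hder (Sum.inr j))).2
  · rintro (ℓ | j) (ℓ' | j') h
    · by_contra hne
      exact h2 ℓ ℓ' (fun h' => hne (by rw [h'])) h
    · have h' := congrArg re h
      have := h5 ℓ
      have := h6 j' ℓ
      simp only [hζ, Sum.elim_inl, Sum.elim_inr] at h'
      linarith
    · have h' := congrArg re h
      have := h5 ℓ'
      have := h6 j ℓ'
      simp only [hζ, Sum.elim_inl, Sum.elim_inr] at h'
      linarith
    · rw [Subsingleton.elim j j']
  · rintro (ℓ | j)
    · exact (h1 ℓ).2.1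
    · exact (h10 j).1
  · intro z hz hzρ hzq
    by_cases hzR : R ≤ ‖z‖
    · obtain ⟨j, hj⟩ := h8 z hz hzR hzq
      exact ⟨Sum.inr j, hj⟩
    · by_cases hzW : ∀ ℓ, z ∉ W ℓ
      · exfalso
        have := hB z hz (not_le.1 hzR).le hzW
        rw [hzq, norm_real] at this
        exact absurd ((Real.le_norm_self q).trans this) (not_le.2 h11)
      · push Not at hzW
        obtain ⟨ℓ, hℓ⟩ := hzW
        have := hℓ (hzρ ℓ)
        rw [hzq] at this
        exact ⟨Sum.inl ℓ, this.symm⟩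
  · rintro (ℓ | j)
    · exact ((h1 ℓ).2.2 _ (hder (Sum.inl ℓ))).1
    · exact ((h10 j).2 _ (hder (Sum.inr j))).1

end HyperexpParams

/-! ### The vertical integral as a power series in `q^(-1/k)` -/

theorem exists_forall_norm_ge_inv {P : ℂ → Prop} (h : ∀ᶠ y in 𝓝 (0 : ℂ), P y) :
    ∃ R : ℝ, ∀ z : ℂ, R ≤ ‖z‖ → P z⁻¹ := by
  have h1 := tendsto_inv₀_cobounded.eventually h
  obtain ⟨R, -, hR⟩ := hasBasis_cobounded_norm.eventually_iff.1 h1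
  exact ⟨R, fun z hz => hR hz⟩

theorem tendsto_rpow_neg_inv_nhdsGT (k : ℕ) (hk : k ≠ 0) :
    Tendsto (fun q : ℝ => q ^ (-(1 / (k : ℝ)))) atTop (𝓝[>] 0) := by
  refine tendsto_nhdsWithin_iff.2 ⟨tendsto_rpow_neg_atTop (by positivity), ?_⟩
  filter_upwards [eventually_gt_atTop 0] with q hq
  exact Real.rpow_pos_of_pos hq _

theorem rpow_neg_inv_pow (k : ℕ) (hk : k ≠ 0) {q : ℝ} (hq : 0 ≤ q) :
    (q ^ (-(1 / (k : ℝ)))) ^ k = q⁻¹ := by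
  rw [Real.rpow_neg hq, inv_pow, one_div, Real.rpow_inv_natCast_pow hq hk]

namespace HyperexpParams

open Complex

variable (p : HyperexpParams)

/-- The vertical integral when there is an additional root tending to infinity. -/
theorem exists_integral_eq_extra (c : ℝ) (hc : 1 < c) (hρ : ∀ ℓ, c < p.ρ ℓ)
    (k : ℕ) (hk : k = 1 ∨ k = 2) (h : ℕ → ℝ) (h0 : 0 < h 0)
    (H : ℂ → ℂ) (hH : HasTaylor H (complexSeries h))
    (hpsi : ∀ z : ℂ, z ≠ 0 → H z = z ^ k * p.psi z⁻¹) :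
    ∃ (M : Fin p.N → ℂ → ℂ) (E : ℂ → ℂ),
      (∀ ℓ, HasTaylor (M ℓ) (complexSeries (p.mCoeff ℓ))) ∧
      HasTaylor E (complexSeries (extraMCoeff k h)) ∧
      ∀ᶠ q : ℝ in atTop,
        ∫ y : ℝ, ((c + y * I) * ((c + y * I) - 1) * (q - p.psi (c + y * I)) : ℂ)⁻¹ =
          2 * Real.pi * (∑ ℓ, M ℓ (q : ℂ)⁻¹ + E ((q ^ (-(1 / (k : ℝ))) : ℝ) : ℂ)) := by
  have hk0 : k ≠ 0 := by rcases hk with rfl | rfl <;> norm_num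
  obtain ⟨ξ, E, hE, hre, hr, hl⟩ := p.exists_extraBranch k hk h h0 H hH hpsi
  have hw := tendsto_rpow_neg_inv_nhdsGT k hk0
  have hwc : Tendsto (fun q : ℝ => ((q ^ (-(1 / (k : ℝ))) : ℝ) : ℂ)) atTop (𝓝 0) := by
    have := (continuous_ofReal.tendsto 0).comp (tendsto_nhdsWithin_iff.1 hw).1
    rwa [ofReal_zero] at this
  have hpow : ∀ q : ℝ, 0 < q → (((q ^ (-(1 / (k : ℝ))) : ℝ) : ℂ) ^ k)⁻¹ = q := by
    intro q hq
    rw [← ofReal_pow, rpow_neg_inv_pow k hk0 hq.le, ofReal_inv, inv_inv]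
  have hmain := p.exists_eventually_integral_eq c hc hρ (J := Unit)
    (fun _ q => (ξ ((q ^ (-(1 / (k : ℝ))) : ℝ) : ℂ))⁻¹)
    (fun _ q => E ((q ^ (-(1 / (k : ℝ))) : ℝ) : ℂ)) ?_ ?_ ?_ ?_
  · obtain ⟨M, hM, hq⟩ := hmain
    refine ⟨M, E, hM, hE, ?_⟩
    simpa using hq
  · intro _
    filter_upwards [hwc.eventually hr, eventually_gt_atTop 0] with q hq hq0
    have hne : ((q ^ (-(1 / (k : ℝ))) : ℝ) : ℂ) ≠ 0 := by
      exact_mod_cast (Real.rpow_pos_of_pos hq0 _).ne'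
    have := hq hne
    rwa [hpow q hq0] at this
  · intro _ B
    exact hw.eventually (hre B)
  · obtain ⟨R, hR⟩ := exists_forall_norm_ge_inv hl
    refine ⟨R, ?_⟩
    filter_upwards [eventually_gt_atTop 0] with q hq z hz hzR hzq
    refine ⟨(), ?_⟩
    have hz0 : z ≠ 0 := by
      rintro rfl
      norm_num at hz
    have hre' : 0 < (z⁻¹).re := by
      rw [inv_re]
      exact div_pos (by linarith) (normSq_pos.2 hz0)
    have := hR z hzR _ (Real.rpow_pos_of_pos hq (-(1 / (k : ℝ)))) hre'
      (by rw [inv_inv, hzq, hpow q hq])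
    exact inv_eq_iff_eq_inv.1 this
  · have hH0 : ∀ᶠ y in 𝓝 (0 : ℂ), h 0 / 2 < ‖H y‖ := by
      have h1 := hH.analyticAt.continuousAt.norm.tendsto
      rw [hH.map_zero, constantCoeff_complexSeries, norm_real, Real.norm_of_nonneg h0.le] at h1
      exact h1.eventually_const_lt (by linarith)
    obtain ⟨R, hR⟩ := exists_forall_norm_ge_inv hH0
    -- Chosen so that `|ψ(z)| = |z|^k |H(1/z)| ≥ |z| h_0 / 2 ≥ |q| + 1`. The radius may depend on
    -- `q`, since it serves only the decay for the contour at fixed `q`.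
    refine Eventually.of_forall fun q => ⟨max R (max 1 (2 * (|q| + 1) / h 0)), fun z _ hzR => ?_⟩
    have r1 : R ≤ ‖z‖ := (le_max_left _ _).trans hzR
    have r2 : 1 ≤ ‖z‖ := ((le_max_left _ _).trans (le_max_right _ _)).trans hzR
    have r3 : 2 * (|q| + 1) / h 0 ≤ ‖z‖ := ((le_max_right _ _).trans (le_max_right _ _)).trans hzR
    have hz0 : z ≠ 0 := by
      rintro rfl
      norm_num at r2
    have e1 := hpsi z⁻¹ (inv_ne_zero hz0)
    rw [inv_inv] at e1
    have e2 : ‖p.psi z‖ = ‖z‖ ^ k * ‖H z⁻¹‖ := by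
      rw [e1, norm_mul, norm_pow, norm_inv, inv_pow, mul_inv_cancel_left₀ (by positivity)]
    have e3 : ‖z‖ ≤ ‖z‖ ^ k := le_self_pow₀ r2 hk0
    have e4 : |q| + 1 ≤ ‖p.psi z‖ := by
      rw [div_le_iff₀ h0] at r3
      rw [e2]
      have := (hR z r1).le
      have : ‖z‖ * (h 0 / 2) ≤ ‖z‖ ^ k * ‖H z⁻¹‖ := by gcongr
      linarith
    have e5 := norm_sub_norm_le (p.psi z) q
    rw [norm_real, Real.norm_eq_abs, norm_sub_rev] at e5
    linarith

/-- The vertical integral when no root tends to infinity. -/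
theorem exists_integral_eq_of_nonpos (c : ℝ) (hc : 1 < c) (hρ : ∀ ℓ, c < p.ρ ℓ)
    (hσ : p.σ = 0) (ha : p.a ≤ 0) :
    ∃ M : Fin p.N → ℂ → ℂ, (∀ ℓ, HasTaylor (M ℓ) (complexSeries (p.mCoeff ℓ))) ∧
      ∀ᶠ q : ℝ in atTop,
        ∫ y : ℝ, ((c + y * I) * ((c + y * I) - 1) * (q - p.psi (c + y * I)) : ℂ)⁻¹ =
          2 * Real.pi * ∑ ℓ, M ℓ (q : ℂ)⁻¹ := by
  have hb : ∃ B : ℝ, ∀ᶠ y in 𝓝 (0 : ℂ), ‖p.jumpFun y‖ < B :=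
    ⟨_, p.hasTaylor_jumpFun.analyticAt.continuousAt.norm.tendsto.eventually_lt_const
      (lt_add_one _)⟩
  obtain ⟨B, hB⟩ := hb
  obtain ⟨R, hR⟩ := exists_forall_norm_ge_inv hB
  -- For `a ≤ 0` the drift term has nonpositive real part in the half-plane and the jump part is
  -- bounded near infinity. Thus `ψ(z) = q` has no far root when `q ≥ B + 1`.
  have hpsi : ∀ z : ℂ, 1 < z.re → R ≤ ‖z‖ → (p.psi z).re ≤ B := by
    intro z hz hzR
    have hz0 : z ≠ 0 := by
      rintro rfl
      norm_num at hz
    have e := p.psi_inv (inv_ne_zero hz0)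
    rw [inv_inv, hσ] at e
    have e2 : p.psi z = (p.a : ℂ) * z + p.jumpFun z⁻¹ := by rw [e]; simp
    rw [e2, add_re, re_ofReal_mul]
    have h1 := (re_le_norm (p.jumpFun z⁻¹)).trans (hR z hzR).le
    nlinarith
  have hfar : ∀ q : ℝ, B + 1 ≤ q → ∀ z : ℂ, 1 < z.re → R ≤ ‖z‖ → 1 ≤ ‖q - p.psi z‖ := by
    intro q hq z hz hzR
    have h1 := re_le_norm (q - p.psi z)
    have h2 := hpsi z hz hzR
    rw [sub_re, ofReal_re] at h1
    linarith
  have hmain := p.exists_eventually_integral_eq c hc hρ (J := Empty) (fun j => j.elim)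
    (fun j => j.elim) (fun j => j.elim) (fun j => j.elim) ⟨R, ?_⟩ ?_
  · simpa using hmain
  · filter_upwards [eventually_ge_atTop (B + 1)] with q hq z hz hzR hzq
    have := hfar q hq z hz hzR
    rw [hzq, sub_self, norm_zero] at this
    norm_num at this
  · filter_upwards [eventually_ge_atTop (B + 1)] with q hq
    exact ⟨R, hfar q hq⟩

open PowerSeries in
-- The branches at the poles are series in `1/q = w^2` with `w = q^(-1/2)`, so they contribute to
-- even indices only, with index halved.
theorem exists_integral_eq_gauss (c : ℝ) (hc : 1 < c) (hρ : ∀ ℓ, c < p.ρ ℓ) (hσ : 0 < p.σ) :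
    ∃ L : ℂ → ℂ, HasTaylor L (complexSeries p.bGauss) ∧ ∀ᶠ q : ℝ in atTop,
      ∫ y : ℝ, ((c + y * I) * ((c + y * I) - 1) * (q - p.psi (c + y * I)) : ℂ)⁻¹ =
        2 * Real.pi * L ((q ^ (-(1 / ((2 : ℕ) : ℝ))) : ℝ) : ℂ) := by
  obtain ⟨M, E, hM, hE, hq⟩ := p.exists_integral_eq_extra c hc hρ 2 (Or.inr rfl) p.hGauss
    (by simp only [hGauss]; positivity) _ p.hasTaylor_hGauss fun z hz => p.hGauss_fun_eq hz
  have hsq : ∀ ℓ, HasTaylor (fun w => M ℓ (w ^ 2))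
      (PowerSeries.mk fun n => if Even n then (p.mCoeff ℓ (n / 2) : ℂ) else 0) := by
    intro ℓ
    have ht : Tendsto (fun w : ℂ => w ^ 2) (𝓝 0) (𝓝 0) := by
      have : Continuous fun w : ℂ => w ^ 2 := by fun_prop
      simpa using this.tendsto 0
    filter_upwards [ht.eventually (hM ℓ)] with w hw
    have hinj : Function.Injective fun n : ℕ => 2 * n := fun a b hab => by simpa using hab
    rw [← hinj.hasSum_iff]
    · convert hw using 2 with n
      simp [pow_mul]
    · intro n hn
      have : ¬ Even n := by
        rintro ⟨m, hm⟩
        exact hn ⟨m, by simp only; omega⟩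
      simp [this]
  refine ⟨fun w => ∑ ℓ, M ℓ (w ^ 2) + E w, ?_, ?_⟩
  · have := (HasTaylor.sum (Finset.univ : Finset (Fin p.N)) fun ℓ _ => hsq ℓ).add hE
    convert this using 1
    ext n
    rw [coeff_complexSeries, map_add, map_sum, coeff_complexSeries]
    by_cases hn : Even n
    · simp [bGauss, hn]
    · simp [bGauss, hn]
  · filter_upwards [hq, eventually_ge_atTop 0] with q hq hq0
    rw [hq]
    congr 2
    refine Finset.sum_congr rfl fun ℓ _ => ?_
    rw [← ofReal_pow, rpow_neg_inv_pow 2 two_ne_zero hq0, ofReal_inv]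

open PowerSeries in
theorem exists_integral_eq_noGauss (c : ℝ) (hc : 1 < c) (hρ : ∀ ℓ, c < p.ρ ℓ) (hσ : p.σ = 0) :
    ∃ L : ℂ → ℂ, HasTaylor L (complexSeries p.bNoGauss) ∧ ∀ᶠ q : ℝ in atTop,
      ∫ y : ℝ, ((c + y * I) * ((c + y * I) - 1) * (q - p.psi (c + y * I)) : ℂ)⁻¹ =
        2 * Real.pi * L ((q ^ (-(1 / ((1 : ℕ) : ℝ))) : ℝ) : ℂ) := by
  have hw : ∀ q : ℝ, 0 ≤ q → ((q ^ (-(1 / ((1 : ℕ) : ℝ))) : ℝ) : ℂ) = (q : ℂ)⁻¹ := by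
    intro q hq
    have := rpow_neg_inv_pow 1 one_ne_zero hq
    rw [pow_one] at this
    rw [this, ofReal_inv]
  by_cases ha : 0 < p.a
  · obtain ⟨M, E, hM, hE, hq⟩ := p.exists_integral_eq_extra c hc hρ 1 (Or.inl rfl) p.hDrift
      ha _ p.hasTaylor_hDrift fun z hz => p.hDrift_fun_eq hσ hz
    refine ⟨fun w => ∑ ℓ, M ℓ w + E w, ?_, ?_⟩
    · have := (HasTaylor.sum (Finset.univ : Finset (Fin p.N)) fun ℓ _ => hM ℓ).add hE
      convert this using 1
      ext n
      rw [coeff_complexSeries, map_add, map_sum, coeff_complexSeries]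
      simp [bNoGauss, ha]
    · filter_upwards [hq, eventually_ge_atTop 0] with q hq hq0
      rw [hq, hw q hq0]
  · obtain ⟨M, hM, hq⟩ := p.exists_integral_eq_of_nonpos c hc hρ hσ (not_lt.1 ha)
    refine ⟨fun w => ∑ ℓ, M ℓ w, ?_, ?_⟩
    · have := HasTaylor.sum (Finset.univ : Finset (Fin p.N)) fun ℓ _ => hM ℓ
      convert this using 1
      ext n
      rw [coeff_complexSeries, map_sum]
      simp [bNoGauss, ha]
    · filter_upwards [hq, eventually_ge_atTop 0] with q hq hq0
      rw [hq, hw q hq0]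

end HyperexpParams

/-! ## Exponential moments of compound Poisson laws -/

section CompoundPoisson

/-- The exponential moment `∫ e^{cx} μ(dx)` with values in `[0, ∞]`. -/
noncomputable def lmgf (μ : Measure ℝ) (c : ℝ) : ℝ≥0∞ := ∫⁻ x, ENNReal.ofReal (Real.exp (c * x)) ∂μ

theorem integrable_cexp_iff {μ : Measure ℝ} {z : ℂ} :
    Integrable (fun x : ℝ => Complex.exp (z * x)) μ ↔ lmgf μ z.re < ∞ := by
  have h : AEStronglyMeasurable (fun x : ℝ => Complex.exp (z * x)) μ := by
    apply Continuous.aestronglyMeasurable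
    fun_prop
  have e : ∀ x : ℝ, ‖Complex.exp (z * x)‖ₑ = ENNReal.ofReal (Real.exp (z.re * x)) := by
    intro x
    rw [← ofReal_norm, Complex.norm_exp]
    simp
  simp only [Integrable, h, true_and, HasFiniteIntegral, lmgf, e]

theorem integrable_exp_iff {μ : Measure ℝ} {c : ℝ} :
    Integrable (fun x : ℝ => Real.exp (c * x)) μ ↔ lmgf μ c < ∞ := by
  have h : AEStronglyMeasurable (fun x : ℝ => Real.exp (c * x)) μ := by
    apply Continuous.aestronglyMeasurable
    fun_prop
  have e : ∀ x : ℝ, ‖Real.exp (c * x)‖ₑ = ENNReal.ofReal (Real.exp (c * x)) := by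
    intro x
    rw [← ofReal_norm, Real.norm_of_nonneg (Real.exp_pos _).le]
  simp only [Integrable, h, true_and, HasFiniteIntegral, lmgf, e]

/-- Tonelli needs no integrability. Working in `[0, ∞]` first settles the finiteness that Fubini
requires in the complex version. -/
theorem lmgf_conv (μ ν : Measure ℝ) [SFinite ν] (c : ℝ) :
    lmgf (μ ∗ ν) c = lmgf μ c * lmgf ν c := by
  rw [lmgf, Measure.lintegral_conv (by fun_prop)]
  simp only [mul_add, Real.exp_add, ENNReal.ofReal_mul (Real.exp_pos _).le]
  simp only [lintegral_const_mul' _ _ ENNReal.ofReal_ne_top]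
  rw [lintegral_mul_const _ (by fun_prop)]
  rfl

theorem complexMGF_id_conv {μ ν : Measure ℝ} [SFinite μ] [SFinite ν] {z : ℂ}
    (hμ : lmgf μ z.re < ∞) (hν : lmgf ν z.re < ∞) :
    complexMGF id (μ ∗ ν) z = complexMGF id μ z * complexMGF id ν z := by
  simp only [complexMGF, id]
  rw [integral_conv (integrable_cexp_iff.2 (by rw [lmgf_conv]; exact ENNReal.mul_lt_top hμ hν))]
  simp only [Complex.ofReal_add, mul_add, Complex.exp_add, integral_const_mul]
  rw [integral_mul_const]

/-- The `n`-fold convolution of a measure. -/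
noncomputable def convPow (ν : Measure ℝ) : ℕ → Measure ℝ
  | 0 => Measure.dirac 0
  | n + 1 => convPow ν n ∗ ν

instance (ν : Measure ℝ) [SFinite ν] (n : ℕ) : SFinite (convPow ν n) := by
  induction n with
  | zero => unfold convPow; infer_instance
  | succ n ih => unfold convPow; infer_instance

theorem lmgf_convPow (ν : Measure ℝ) [SFinite ν] (c : ℝ) (n : ℕ) :
    lmgf (convPow ν n) c = lmgf ν c ^ n := by
  induction n with
  | zero => simp [convPow, lmgf]
  | succ n ih => rw [convPow, lmgf_conv, ih, pow_succ]

theorem complexMGF_id_convPow {ν : Measure ℝ} [SFinite ν] {z : ℂ} (h : lmgf ν z.re < ∞) (n : ℕ) :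
    complexMGF id (convPow ν n) z = complexMGF id ν z ^ n := by
  induction n with
  | zero => simp [convPow, complexMGF]
  | succ n ih =>
    rw [convPow, complexMGF_id_conv _ h, ih, pow_succ]
    rw [lmgf_convPow]
    exact ENNReal.pow_lt_top h

/-- The law at time `t` of the compound Poisson process with Lévy measure `ν`. -/
noncomputable def compoundPoisson (ν : Measure ℝ) (t : ℝ) : Measure ℝ :=
  Measure.sum fun n : ℕ =>
    ENNReal.ofReal (Real.exp (-(t * ν.real Set.univ)) * (t ^ n / n.factorial)) • convPow ν n

/-- Exponential moments multiply under convolution, so the Poisson mixture sums to an exponential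
series. -/
theorem lmgf_compoundPoisson_lt_top {ν : Measure ℝ} [SFinite ν] {c t : ℝ} (ht : 0 ≤ t)
    (h : lmgf ν c < ∞) : lmgf (compoundPoisson ν t) c < ∞ := by
  have e : ∀ n : ℕ, lmgf (ENNReal.ofReal (Real.exp (-(t * ν.real Set.univ)) *
      (t ^ n / n.factorial)) • convPow ν n) c =
      ENNReal.ofReal (Real.exp (-(t * ν.real Set.univ)) *
        ((t * (lmgf ν c).toReal) ^ n / n.factorial)) := by
    intro n
    rw [lmgf, lintegral_smul_measure, smul_eq_mul]
    have := lmgf_convPow ν c n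
    rw [lmgf] at this
    have e3 : lmgf ν c ^ n = ENNReal.ofReal ((lmgf ν c).toReal ^ n) := by
      rw [ENNReal.ofReal_pow ENNReal.toReal_nonneg, ENNReal.ofReal_toReal h.ne]
    rw [this, e3, ← ENNReal.ofReal_mul (by positivity)]
    congr 1
    ring
  have e2 : lmgf (compoundPoisson ν t) c = ∑' n : ℕ, lmgf (ENNReal.ofReal
      (Real.exp (-(t * ν.real Set.univ)) * (t ^ n / n.factorial)) • convPow ν n) c := by
    rw [lmgf, compoundPoisson, lintegral_sum_measure]
    rfl
  rw [e2]
  simp_rw [e]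
  rw [← ENNReal.ofReal_tsum_of_nonneg]
  · exact ENNReal.ofReal_lt_top
  · intro n
    positivity
  · exact (Real.summable_pow_div_factorial _).mul_left _

theorem isFiniteMeasure_iff_lmgf {μ : Measure ℝ} : IsFiniteMeasure μ ↔ lmgf μ 0 < ∞ := by
  rw [isFiniteMeasure_iff]
  simp [lmgf]

theorem complexMGF_id_compoundPoisson {ν : Measure ℝ} [SFinite ν] {z : ℂ} {t : ℝ} (ht : 0 ≤ t)
    (h : lmgf ν z.re < ∞) : complexMGF id (compoundPoisson ν t) z =
      Complex.exp (t * (complexMGF id ν z - ν.real Set.univ)) := by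
  have h1 := integrable_cexp_iff.2 (lmgf_compoundPoisson_lt_top ht h)
  have h2 := hasSum_integral_measure h1
  have e : ∀ n : ℕ, ∫ x : ℝ, Complex.exp (z * x) ∂(ENNReal.ofReal
      (Real.exp (-(t * ν.real Set.univ)) * (t ^ n / n.factorial)) • convPow ν n) =
      Complex.exp (-(t * ν.real Set.univ)) * ((t * complexMGF id ν z) ^ n / n.factorial) := by
    intro n
    rw [integral_smul_measure, ENNReal.toReal_ofReal (by positivity)]
    have := complexMGF_id_convPow h n
    simp only [complexMGF, id] at this ⊢
    rw [this, Complex.real_smul]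
    push_cast
    ring
  simp_rw [e] at h2
  have h3 := (NormedSpace.expSeries_div_hasSum_exp (𝔸 := ℂ) (t * complexMGF id ν z)).mul_left
    (Complex.exp (-(t * ν.real Set.univ)))
  have h4 := h2.unique h3
  simp only [complexMGF, id] at h4 ⊢
  rw [compoundPoisson, h4, ← Complex.exp_eq_exp_ℂ, ← Complex.exp_add]
  congr 1
  ring

end CompoundPoisson

/-! ### The law of the process and its exponential moments -/

namespace HyperexpParams

variable (p : HyperexpParams)

theorem levyDensity_nonneg (x : ℝ) : 0 ≤ p.levyDensity x := by
  unfold levyDensity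
  have h1 := fun ℓ => (p.α_pos ℓ).le
  have h2 := fun ℓ => (p.ρ_pos ℓ).le
  have h3 := fun ℓ => (p.αHat_pos ℓ).le
  have h4 := fun ℓ => (p.ρHat_pos ℓ).le
  split_ifs
  · exact Finset.sum_nonneg fun ℓ _ => mul_nonneg (mul_nonneg (h3 ℓ) (h4 ℓ)) (Real.exp_pos _).le
  · exact Finset.sum_nonneg fun ℓ _ => mul_nonneg (mul_nonneg (h1 ℓ) (h2 ℓ)) (Real.exp_pos _).le
  · exact le_rfl

@[fun_prop]
theorem measurable_levyDensity : Measurable p.levyDensity := by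
  unfold levyDensity
  refine Measurable.ite measurableSet_Iio (by fun_prop) ?_
  exact Measurable.ite measurableSet_Ioi (by fun_prop) measurable_const

theorem levyDensity_smul_cexp (z : ℂ) (x : ℝ) :
    p.levyDensity x • Complex.exp (z * x) =
      (Set.Iio (0 : ℝ)).indicator
        (fun x : ℝ => ∑ ℓ, (p.αHat ℓ * p.ρHat ℓ : ℂ) * Complex.exp ((p.ρHat ℓ + z) * x)) x +
      (Set.Ioi (0 : ℝ)).indicator
        (fun x : ℝ => ∑ ℓ, (p.α ℓ * p.ρ ℓ : ℂ) * Complex.exp (-(p.ρ ℓ - z) * x)) x := by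
  unfold levyDensity
  rcases lt_trichotomy x 0 with h | h | h
  · rw [if_pos h, Set.indicator_of_mem (Set.mem_Iio.2 h), Set.indicator_of_notMem (by simpa using h.le), add_zero,
      Finset.sum_smul]
    refine Finset.sum_congr rfl fun ℓ _ => ?_
    rw [Complex.real_smul, add_mul, Complex.exp_add]
    push_cast
    ring
  · simp [h]
  · rw [if_neg h.not_gt, if_pos h, Set.indicator_of_notMem (by simpa using h.le),
      Set.indicator_of_mem (Set.mem_Ioi.2 h), zero_add, Finset.sum_smul]
    refine Finset.sum_congr rfl fun ℓ _ => ?_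
    have : -((p.ρ ℓ : ℂ) - z) * x = -(p.ρ ℓ * x) + z * x := by ring
    rw [Complex.real_smul, this, Complex.exp_add]
    push_cast
    ring

theorem integrable_integral_levyDensity_smul_cexp {z : ℂ} (h0 : 0 ≤ z.re)
    (hρ : ∀ ℓ, z.re < p.ρ ℓ) :
    Integrable (fun x : ℝ => p.levyDensity x • Complex.exp (z * x)) ∧
    ∫ x : ℝ, p.levyDensity x • Complex.exp (z * x) =
      ∑ ℓ, (p.α ℓ * p.ρ ℓ : ℂ) / (p.ρ ℓ - z) + ∑ ℓ, (p.αHat ℓ * p.ρHat ℓ : ℂ) / (p.ρHat ℓ + z) := by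
  have a1 : ∀ ℓ, 0 < ((p.ρHat ℓ : ℂ) + z).re := by
    intro ℓ
    have := p.ρHat_pos ℓ
    simp
    linarith
  have a2 : ∀ ℓ, (-((p.ρ ℓ : ℂ) - z)).re < 0 := by
    intro ℓ
    have := hρ ℓ
    simp
    linarith
  have i1 : ∀ ℓ, IntegrableOn (fun x : ℝ => Complex.exp ((p.ρHat ℓ + z) * x)) (Set.Iio 0) :=
    fun ℓ => (integrableOn_exp_mul_complex_Iic (a1 ℓ) 0).mono_set Set.Iio_subset_Iic_self
  have i2 : ∀ ℓ, IntegrableOn (fun x : ℝ => Complex.exp (-(p.ρ ℓ - z) * x)) (Set.Ioi 0) :=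
    fun ℓ => integrableOn_exp_mul_complex_Ioi (a2 ℓ) 0
  have j1 : IntegrableOn (fun x : ℝ => ∑ ℓ, (p.αHat ℓ * p.ρHat ℓ : ℂ) *
      Complex.exp ((p.ρHat ℓ + z) * x)) (Set.Iio 0) :=
    integrable_finsetSum _ fun ℓ _ => (i1 ℓ).const_mul _
  have j2 : IntegrableOn (fun x : ℝ => ∑ ℓ, (p.α ℓ * p.ρ ℓ : ℂ) *
      Complex.exp (-(p.ρ ℓ - z) * x)) (Set.Ioi 0) :=
    integrable_finsetSum _ fun ℓ _ => (i2 ℓ).const_mul _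
  simp_rw [levyDensity_smul_cexp]
  have k1 := j1.integrable_indicator measurableSet_Iio
  have k2 := j2.integrable_indicator measurableSet_Ioi
  refine ⟨k1.add k2, ?_⟩
  rw [integral_add k1 k2, integral_indicator measurableSet_Iio, integral_indicator measurableSet_Ioi,
    integral_finsetSum _ fun ℓ _ => (i1 ℓ).const_mul _,
    integral_finsetSum _ fun ℓ _ => (i2 ℓ).const_mul _, add_comm]
  congr 1
  · refine Finset.sum_congr rfl fun ℓ _ => ?_
    rw [integral_const_mul, integral_exp_mul_complex_Ioi (a2 ℓ)]
    rw [Complex.ofReal_zero, mul_zero, Complex.exp_zero, neg_div_neg_eq, mul_one_div]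
  · refine Finset.sum_congr rfl fun ℓ _ => ?_
    rw [integral_const_mul, ← integral_Iic_eq_integral_Iio, integral_exp_mul_complex_Iic (a1 ℓ)]
    simp [div_eq_mul_inv]

theorem lmgf_levyMeasure_lt_top {c : ℝ} (h0 : 0 ≤ c) (hρ : ∀ ℓ, c < p.ρ ℓ) :
    lmgf p.levyMeasure c < ∞ := by
  have h := (p.integrable_integral_levyDensity_smul_cexp (z := c) (by simpa) (by simpa)).1
  have h2 : Integrable (fun x : ℝ => Complex.exp ((c : ℂ) * x)) p.levyMeasure := by
    rw [levyMeasure, integrable_withDensity_iff_integrable_smul' (by fun_prop) (by simp)]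
    simpa only [ENNReal.toReal_ofReal (p.levyDensity_nonneg _)] using h
  simpa using integrable_cexp_iff.1 h2

theorem complexMGF_id_levyMeasure {z : ℂ} (h0 : 0 ≤ z.re) (hρ : ∀ ℓ, z.re < p.ρ ℓ) :
    complexMGF id p.levyMeasure z =
      ∑ ℓ, (p.α ℓ * p.ρ ℓ : ℂ) / (p.ρ ℓ - z) + ∑ ℓ, (p.αHat ℓ * p.ρHat ℓ : ℂ) / (p.ρHat ℓ + z) := by
  rw [← (p.integrable_integral_levyDensity_smul_cexp h0 hρ).2, complexMGF, levyMeasure,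
    integral_withDensity_eq_integral_toReal_smul (by fun_prop) (by simp)]
  simp only [ENNReal.toReal_ofReal (p.levyDensity_nonneg _), id]

instance : IsFiniteMeasure p.levyMeasure :=
  isFiniteMeasure_iff_lmgf.2 (p.lmgf_levyMeasure_lt_top le_rfl p.ρ_pos)

theorem levyMeasure_real_univ : (p.levyMeasure.real Set.univ : ℂ) = ∑ ℓ, (p.α ℓ : ℂ) +
    ∑ ℓ, (p.αHat ℓ : ℂ) := by
  have h := p.complexMGF_id_levyMeasure (z := 0) le_rfl p.ρ_pos
  simp only [complexMGF, zero_mul, Complex.exp_zero, integral_const, sub_zero, add_zero] at h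
  rw [Complex.real_smul, mul_one] at h
  rw [h]
  congr 1 <;> refine Finset.sum_congr rfl fun ℓ _ => ?_
  · have : (p.ρ ℓ : ℂ) ≠ 0 := by exact_mod_cast (p.ρ_pos ℓ).ne'
    field_simp
  · have : (p.ρHat ℓ : ℂ) ≠ 0 := by exact_mod_cast (p.ρHat_pos ℓ).ne'
    field_simp

/-- The law at time `t` of the hyperexponential Lévy process. -/
noncomputable def law (t : ℝ) : Measure ℝ :=
  gaussianReal (p.a * t) (Real.toNNReal (p.σ ^ 2 * t)) ∗ compoundPoisson p.levyMeasure t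

theorem isFiniteMeasure_compoundPoisson {t : ℝ} (ht : 0 ≤ t) :
    IsFiniteMeasure (compoundPoisson p.levyMeasure t) :=
  isFiniteMeasure_iff_lmgf.2
    (lmgf_compoundPoisson_lt_top ht (p.lmgf_levyMeasure_lt_top le_rfl p.ρ_pos))

theorem lmgf_gaussianReal_lt_top (m : ℝ) (v : ℝ≥0) (c : ℝ) : lmgf (gaussianReal m v) c < ∞ :=
  integrable_exp_iff.1 (integrable_exp_mul_gaussianReal c)

theorem lmgf_law_lt_top {t c : ℝ} (ht : 0 ≤ t) (h0 : 0 ≤ c) (hρ : ∀ ℓ, c < p.ρ ℓ) :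
    lmgf (p.law t) c < ∞ := by
  have := p.isFiniteMeasure_compoundPoisson ht
  rw [law, lmgf_conv]
  exact ENNReal.mul_lt_top (lmgf_gaussianReal_lt_top _ _ _)
    (lmgf_compoundPoisson_lt_top ht (p.lmgf_levyMeasure_lt_top h0 hρ))

theorem complexMGF_id_law {t : ℝ} {z : ℂ} (ht : 0 ≤ t) (h0 : 0 ≤ z.re) (hρ : ∀ ℓ, z.re < p.ρ ℓ) :
    complexMGF id (p.law t) z = Complex.exp (t * (p.a * z + p.σ ^ 2 * z ^ 2 / 2 +
      (complexMGF id p.levyMeasure z - p.levyMeasure.real Set.univ))) := by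
  have := p.isFiniteMeasure_compoundPoisson ht
  have hν := p.lmgf_levyMeasure_lt_top h0 hρ
  rw [law, complexMGF_id_conv (lmgf_gaussianReal_lt_top _ _ _) (lmgf_compoundPoisson_lt_top ht hν),
    complexMGF_id_gaussianReal, complexMGF_id_compoundPoisson ht hν, ← Complex.exp_add]
  have : ((p.σ ^ 2 * t).toNNReal : ℂ) = p.σ ^ 2 * t := by
    have : (((p.σ ^ 2 * t).toNNReal : ℝ) : ℂ) = ((p.σ ^ 2 * t : ℝ) : ℂ) := by
      rw [Real.coe_toNNReal _ (by positivity)]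
    simpa using this
  rw [this]
  congr 1
  push_cast
  ring

/-- By `αρ/(ρ - z) = zα/(ρ - z) + α` and its analogue for negative jumps, subtracting the total mass
of the Lévy measure leaves the partial fractions of `psi`. -/
theorem psi_eq_complexMGF {z : ℂ} (h0 : 0 ≤ z.re) (hρ : ∀ ℓ, z.re < p.ρ ℓ) :
    p.psi z = p.a * z + p.σ ^ 2 * z ^ 2 / 2 +
      (complexMGF id p.levyMeasure z - p.levyMeasure.real Set.univ) := by
  rw [p.complexMGF_id_levyMeasure h0 hρ, p.levyMeasure_real_univ, psi]
  have a1 : ∀ ℓ, ((p.ρHat ℓ : ℂ) + z) ≠ 0 := by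
    intro ℓ h
    have h1 := congrArg Complex.re h
    have := p.ρHat_pos ℓ
    simp at h1
    linarith
  have a2 : ∀ ℓ, ((p.ρ ℓ : ℂ) - z) ≠ 0 := by
    intro ℓ h
    have h1 := congrArg Complex.re h
    have := hρ ℓ
    simp at h1
    linarith
  have e1 : ∑ ℓ, (p.α ℓ * p.ρ ℓ : ℂ) / (p.ρ ℓ - z) =
      z * ∑ ℓ, (p.α ℓ : ℂ) / (p.ρ ℓ - z) + ∑ ℓ, (p.α ℓ : ℂ) := by
    rw [Finset.mul_sum, ← Finset.sum_add_distrib]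
    refine Finset.sum_congr rfl fun ℓ _ => ?_
    have := a2 ℓ
    field_simp
    ring
  have e2 : ∑ ℓ, (p.αHat ℓ * p.ρHat ℓ : ℂ) / (p.ρHat ℓ + z) =
      -(z * ∑ ℓ, (p.αHat ℓ : ℂ) / (p.ρHat ℓ + z)) + ∑ ℓ, (p.αHat ℓ : ℂ) := by
    rw [Finset.mul_sum, ← Finset.sum_neg_distrib, ← Finset.sum_add_distrib]
    refine Finset.sum_congr rfl fun ℓ _ => ?_
    have := a1 ℓ
    field_simp
    ring
  rw [e1, e2]
  ring

/-- The characteristic function is prescribed on the imaginary axis only. Identifying the law with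
an explicit convolution carries `E[e^{zX_t}] = e^{tψ(z)}` to the strip `0 ≤ Re z < ρ_1` without
analytic continuation. -/
theorem map_eq_law {Ω : Type*} [MeasurableSpace Ω] {P : Measure Ω} [IsProbabilityMeasure P]
    {X : ℝ≥0 → Ω → ℝ} (hX : IsHyperexpProcess p X P) (t : ℝ≥0) : P.map (X t) = p.law t := by
  have h1 : IsProbabilityMeasure (P.map (X t)) :=
    Measure.isProbabilityMeasure_map (hX.1.measurable t).aemeasurable
  have := p.isFiniteMeasure_compoundPoisson t.coe_nonneg
  have h2 : IsFiniteMeasure (p.law t) :=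
    isFiniteMeasure_iff_lmgf.2 (p.lmgf_law_lt_top t.coe_nonneg le_rfl p.ρ_pos)
  refine Measure.ext_of_charFun ?_
  ext u
  rw [hX.2 t u, ← complexMGF_id_mul_I, p.complexMGF_id_law t.coe_nonneg (by simp) (by simpa using p.ρ_pos)]
  congr 1
  have h3 : Integrable (fun x : ℝ => Complex.exp (Complex.I * u * x)) p.levyMeasure :=
    integrable_cexp_iff.2 (by simpa using p.lmgf_levyMeasure_lt_top le_rfl p.ρ_pos)
  rw [integral_sub h3 (integrable_const _), integral_const, complexMGF, Complex.real_smul, mul_one,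
    mul_comm Complex.I (u : ℂ)]
  simp only [id]
  linear_combination (-(t : ℝ) * (p.σ : ℂ) ^ 2 * (u : ℂ) ^ 2 / 2) * Complex.I_sq

/-- The exponential moments of the process. -/
theorem lmgf_map_lt_top {Ω : Type*} [MeasurableSpace Ω] {P : Measure Ω} [IsProbabilityMeasure P]
    {X : ℝ≥0 → Ω → ℝ} (hX : IsHyperexpProcess p X P) (t : ℝ≥0) {c : ℝ} (h0 : 0 ≤ c)
    (hρ : ∀ ℓ, c < p.ρ ℓ) : lmgf (P.map (X t)) c < ∞ := by
  rw [p.map_eq_law hX]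
  exact p.lmgf_law_lt_top t.coe_nonneg h0 hρ

end HyperexpParams

/-! ## The payoff of a call as a vertical integral -/

section Payoff

open Complex

theorem norm_inv_mul_le {u v w : ℂ} {C : ℝ} (hC : 0 ≤ C) (h1 : ‖u‖ ≤ C) (h0 : 0 < ‖w‖) {a b : ℂ}
    (ha : ‖w‖ / 2 ≤ ‖a‖) (hb : ‖w‖ / 2 ≤ ‖b‖) (hv : v = u * (a * b)⁻¹) :
    ‖v‖ ≤ 4 * C / ‖w‖ ^ 2 := by
  have p1 : 0 < ‖a‖ := by linarith
  have p2 : 0 < ‖b‖ := by linarith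
  rw [hv, norm_mul, norm_inv, norm_mul, ← div_eq_mul_inv, div_le_div_iff₀ (by positivity)
    (by positivity)]
  have h3 : ‖w‖ ^ 2 ≤ 4 * (‖a‖ * ‖b‖) := by nlinarith
  nlinarith [norm_nonneg u, mul_nonneg p1.le p2.le]

theorem half_norm_le_norm_sub {z w : ℂ} (h : 2 * ‖w‖ ≤ ‖z‖) : ‖z‖ / 2 ≤ ‖z - w‖ := by
  have := norm_sub_norm_le z w
  linarith

theorem vertical_ne {c : ℝ} (hc : 1 < c) (y : ℝ) :
    (c + y * I : ℂ) ≠ 0 ∧ (c + y * I : ℂ) - 1 ≠ 0 := by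
  constructor <;> intro h <;> have := congrArg re h <;> simp at this <;> linarith

theorem continuous_payoffKernel {c : ℝ} (hc : 1 < c) :
    Continuous fun y : ℝ => ((c + y * I) * ((c + y * I) - 1) : ℂ)⁻¹ :=
  Continuous.inv₀ (by fun_prop) fun y => mul_ne_zero (vertical_ne hc y).1 (vertical_ne hc y).2

theorem integrable_payoffKernel {c : ℝ} (hc : 1 < c) :
    Integrable fun y : ℝ => ((c + y * I) * ((c + y * I) - 1) : ℂ)⁻¹ := by
  refine integrable_vertical_of_decay (f := fun z => (z * (z - 1))⁻¹) (continuous_payoffKernel hc)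
    (C := 4 * 1) (R := 2) fun y hy => ?_
  refine norm_inv_mul_le (u := 1) (a := c + y * I) zero_le_one (by simp) (by linarith) (by linarith)
    (half_norm_le_norm_sub (w := 1) (by simpa using hy)) (by rw [one_mul])

/-- For `x ≤ 0` the factor `e^{zx}` is bounded on the right half-plane, and there is no pole to the
right of the line. -/
theorem integral_payoff_of_nonpos {c x : ℝ} (hc : 1 < c) (hx : x ≤ 0) :
    ∫ y : ℝ, cexp ((c + y * I) * x) * ((c + y * I) * ((c + y * I) - 1))⁻¹ = 0 := by
  refine integral_vertical_eq_zero (c₀ := 1) (f := fun z => cexp (z * x) * (z * (z - 1))⁻¹)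
    zero_le_one hc ?_ (C := 4 * 1) (R := 2) ?_
  · intro z hz
    have h1 : z ≠ 0 := by rintro rfl; simp at hz; linarith
    have h2 : z - 1 ≠ 0 := by
      intro h
      have := congrArg re h
      have hz : 1 < z.re := hz
      simp at this
      linarith
    exact DifferentiableAt.differentiableWithinAt
      (DifferentiableAt.mul (by fun_prop) (DifferentiableAt.inv (by fun_prop) (mul_ne_zero h1 h2)))
  · intro z hz hR
    refine norm_inv_mul_le zero_le_one ?_ (by linarith) (by linarith)
      (half_norm_le_norm_sub (w := 1) (by simpa using hR)) rfl
    rw [Complex.norm_exp]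
    simp only [mul_re, ofReal_re, ofReal_im, mul_zero, sub_zero, Real.exp_le_one_iff]
    nlinarith

theorem tendsto_sub_mul_inv_of_ne {s t : ℂ} {g : ℂ → ℂ} (hg : ContinuousAt g s) (hst : s ≠ t) :
    Tendsto (fun z => (z - s) * (g z * ((z - s) * (z - t))⁻¹)) (𝓝[≠] s) (𝓝 (g s * (s - t)⁻¹)) := by
  have h1 : ContinuousAt (fun z => g z * (z - t)⁻¹) s :=
    hg.mul (ContinuousAt.inv₀ (by fun_prop) (sub_ne_zero.2 hst))
  refine (h1.tendsto.mono_left nhdsWithin_le_nhds).congr' ?_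
  filter_upwards [self_mem_nhdsWithin] with z hz
  have : z - s ≠ 0 := sub_ne_zero.2 hz
  rw [mul_inv]
  field_simp

/-- For `x ≥ 0` the contour must be closed to the left. The reflection `u = 2c - z` reduces this to
closing to the right: the poles `0` and `1` move to `2c` and `2c - 1`, with residues `1` and `-e^x`.
-/
theorem integral_payoff_of_nonneg {c x : ℝ} (hc : 1 < c) (hx : 0 ≤ x) :
    ∫ y : ℝ, cexp ((c + y * I) * x) * ((c + y * I) * ((c + y * I) - 1))⁻¹ =
      2 * Real.pi * (Real.exp x - 1) := by
  classical
  set f : ℂ → ℂ := fun u => cexp ((2 * c - u) * x) * ((u - 2 * c) * (u - (2 * c - 1)))⁻¹ with hf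
  have e1 : ∀ y : ℝ, cexp ((c + (-y : ℝ) * I) * x) *
      ((c + (-y : ℝ) * I) * ((c + (-y : ℝ) * I) - 1))⁻¹ = f (c + y * I) := by
    intro y
    rw [hf]
    congr 2
    · congr 1
      push_cast
      ring
    · push_cast
      ring
  rw [← integral_neg_eq_self]
  simp_rw [e1]
  have hne : (2 * c : ℂ) ≠ 2 * c - 1 := by
    intro h
    have := congrArg re h
    simp at this
    linarith
  have hg : Continuous fun u : ℂ => cexp ((2 * c - u) * x) := by fun_prop
  have hS : ∀ s ∈ ({(2 * c : ℂ), (2 * c - 1 : ℂ)} : Finset ℂ), c < s.re := by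
    intro s hs
    simp only [Finset.mem_insert, Finset.mem_singleton] at hs
    rcases hs with rfl | rfl <;> simp <;> linarith
  rw [integral_vertical_eq_neg_sum c (fun s => if s = 2 * c then 1 else -cexp x)
    ({(2 * c : ℂ), (2 * c - 1 : ℂ)} : Finset ℂ) 0 le_rfl (by linarith) hS f ?_ ?_
    (4 * Real.exp (2 * c * x)) (4 * c + 2) ?_]
  · rw [Finset.sum_pair hne, if_pos rfl, if_neg hne.symm]
    push_cast
    ring
  · intro z hz
    have hz2 := hz.2
    simp only [Finset.coe_insert, Finset.coe_singleton, Set.mem_insert_iff, Set.mem_singleton_iff,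
      not_or] at hz2
    exact DifferentiableAt.differentiableWithinAt (DifferentiableAt.mul (by fun_prop)
      (DifferentiableAt.inv (by fun_prop)
        (mul_ne_zero (sub_ne_zero.2 hz2.1) (sub_ne_zero.2 hz2.2))))
  · intro s hs
    simp only [Finset.mem_insert, Finset.mem_singleton] at hs
    rcases hs with rfl | rfl
    · have := tendsto_sub_mul_inv_of_ne hg.continuousAt hne
      simpa [hf] using this
    · have := tendsto_sub_mul_inv_of_ne hg.continuousAt hne.symm
      rw [if_neg hne.symm]
      simp only [hf]
      convert this using 2
      · rw [mul_comm (_ - _ : ℂ) (_ - (2 * c - 1) : ℂ)]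
      · simp
  · intro z hz hR
    refine norm_inv_mul_le (Real.exp_pos _).le ?_ (by linarith) (half_norm_le_norm_sub ?_)
      (half_norm_le_norm_sub ?_) rfl
    · rw [Complex.norm_exp, Real.exp_le_exp]
      simp
      nlinarith
    · rw [norm_mul, Complex.norm_real, Real.norm_of_nonneg (by linarith)]
      simp
      linarith
    · have : (2 * c - 1 : ℂ) = ((2 * c - 1 : ℝ) : ℂ) := by push_cast; rfl
      rw [this, Complex.norm_real, Real.norm_of_nonneg (by linarith)]
      linarith

theorem integral_payoff {c : ℝ} (hc : 1 < c) (x : ℝ) :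
    ∫ y : ℝ, cexp ((c + y * I) * x) * ((c + y * I) * ((c + y * I) - 1))⁻¹ =
      2 * Real.pi * (max 0 (Real.exp x - 1) : ℝ) := by
  rcases le_total x 0 with hx | hx
  · have h2 : Real.exp x - 1 ≤ 0 := by simpa using hx
    rw [integral_payoff_of_nonpos hc hx, max_eq_left h2]
    simp
  · have h2 : 0 ≤ Real.exp x - 1 := by simpa using hx
    rw [integral_payoff_of_nonneg hc hx, max_eq_right h2]
    push_cast
    rfl

theorem integrable_payoff {c : ℝ} (hc : 1 < c) {μ : Measure ℝ} [IsFiniteMeasure μ]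
    (hμ : lmgf μ c < ∞) : Integrable (fun x => max 0 (Real.exp x - 1)) μ := by
  refine Integrable.mono' ((integrable_exp_iff.2 hμ).add (integrable_const (0 : ℝ))) ?_
    (ae_of_all _ fun x => ?_)
  · apply Continuous.aestronglyMeasurable
    fun_prop
  · rw [Real.norm_of_nonneg (le_max_left _ _)]
    simp only [Pi.add_apply, add_zero]
    refine max_le (Real.exp_pos _).le ?_
    rcases le_total x 0 with hx | hx
    · have : Real.exp x ≤ 1 := by simpa using hx
      linarith [Real.exp_pos (c * x)]
    · have : Real.exp x ≤ Real.exp (c * x) := Real.exp_le_exp.2 (by nlinarith)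
      linarith

/-- The expected payoff of a call as a vertical integral. -/
theorem integral_payoff_eq {c : ℝ} (hc : 1 < c) {μ : Measure ℝ} [IsFiniteMeasure μ]
    (hμ : lmgf μ c < ∞) :
    2 * Real.pi * ((∫ x, max 0 (Real.exp x - 1) ∂μ : ℝ) : ℂ) =
      ∫ y : ℝ, complexMGF id μ (c + y * I) * ((c + y * I) * ((c + y * I) - 1))⁻¹ := by
  have h1 : Integrable (Function.uncurry fun (x y : ℝ) =>
      cexp ((c + y * I) * x) * ((c + y * I) * ((c + y * I) - 1))⁻¹) (μ.prod volume) := by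
    have h2 := ((integrable_exp_iff.2 hμ).ofReal (𝕜 := ℂ)).mul_prod (integrable_payoffKernel hc)
    have hk := continuous_payoffKernel hc
    refine h2.mono ?_ (ae_of_all _ fun w => ?_)
    · apply Continuous.aestronglyMeasurable
      simp only [Function.uncurry_def]
      exact Continuous.mul (by fun_prop) (hk.comp continuous_snd)
    · simp only [Function.uncurry_def, norm_mul, Complex.norm_exp]
      refine le_of_eq ?_
      congr 1
      rw [RCLike.norm_ofReal, abs_of_pos (Real.exp_pos _)]
      simp
  have h3 := integral_integral_swap h1
  simp only [integral_payoff hc, integral_mul_const] at h3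
  rw [integral_const_mul, integral_complex_ofReal] at h3
  exact h3

end Payoff

/-! ### The Laplace transform of the expected payoff -/

namespace HyperexpParams

open Complex

variable (p : HyperexpParams)

/-- This is `|E[e^{zX_1}]| ≤ E[e^{cX_1}]` after taking logarithms. It bounds `e^{tψ}` uniformly on
the line, so the Laplace integral converges for `q > ψ(c)`. -/
theorem re_psi_le {c : ℝ} (h0 : 0 ≤ c) (hρ : ∀ ℓ, c < p.ρ ℓ) (y : ℝ) :
    (p.psi (c + y * I)).re ≤ (p.psi c).re := by
  have h1 := p.complexMGF_id_law (t := 1) (z := c + y * I) zero_le_one (by simpa) (by simpa)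
  have h2 := p.complexMGF_id_law (t := 1) (z := c) zero_le_one (by simpa) (by simpa)
  rw [← p.psi_eq_complexMGF (by simpa) (by simpa), ofReal_one, one_mul] at h1 h2
  have h3 := norm_complexMGF_le_mgf (X := id) (μ := p.law 1) (z := c + y * I)
  have h4 : mgf id (p.law 1) c = Real.exp (p.psi c).re := by
    rw [complexMGF_ofReal] at h2
    have h5 := congrArg norm h2
    rwa [Complex.norm_exp, Complex.norm_real, Real.norm_of_nonneg mgf_nonneg] at h5
  have h6 : (c + y * I : ℂ).re = c := by simp
  rw [h1, h6, h4, Complex.norm_exp, Real.exp_le_exp] at h3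
  exact h3

theorem continuous_psi_vertical {c : ℝ} (h0 : 0 ≤ c) (hρ : ∀ ℓ, c < p.ρ ℓ) :
    Continuous fun y : ℝ => p.psi (c + y * I) := by
  have h1 : ∀ ℓ, ∀ y : ℝ, (p.ρ ℓ : ℂ) - (c + y * I) ≠ 0 := by
    intro ℓ y h
    have := congrArg re h
    have := hρ ℓ
    simp at *
    linarith
  have h2 : ∀ ℓ, ∀ y : ℝ, (p.ρHat ℓ : ℂ) + (c + y * I) ≠ 0 := by
    intro ℓ y h
    have := congrArg re h
    have := p.ρHat_pos ℓ
    simp at *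
    linarith
  unfold psi
  refine Continuous.sub (Continuous.add (by fun_prop) (Continuous.mul (by fun_prop) ?_))
    (Continuous.mul (by fun_prop) ?_)
  · exact continuous_finsetSum _ fun ℓ _ => Continuous.div (by fun_prop) (by fun_prop) (h1 ℓ)
  · exact continuous_finsetSum _ fun ℓ _ => Continuous.div (by fun_prop) (by fun_prop) (h2 ℓ)

/-- The expected payoff of a call at the money, normalised by the spot price. -/
noncomputable def payoffMean (t : ℝ) : ℝ := ∫ x, max 0 (Real.exp x - 1) ∂p.law t

theorem payoffMean_eq {c t : ℝ} (hc : 1 < c) (hρ : ∀ ℓ, c < p.ρ ℓ) (ht : 0 ≤ t) :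
    2 * Real.pi * (p.payoffMean t : ℂ) =
      ∫ y : ℝ, cexp (t * p.psi (c + y * I)) * ((c + y * I) * ((c + y * I) - 1))⁻¹ := by
  have h0 : 0 ≤ c := by linarith
  have hfin : IsFiniteMeasure (p.law t) :=
    isFiniteMeasure_iff_lmgf.2 (p.lmgf_law_lt_top ht le_rfl p.ρ_pos)
  rw [payoffMean, integral_payoff_eq hc (p.lmgf_law_lt_top ht h0 hρ)]
  refine integral_congr_ae (ae_of_all _ fun y => ?_)
  simp only
  rw [p.complexMGF_id_law ht (by simpa) (by simpa), ← p.psi_eq_complexMGF (by simpa) (by simpa)]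

theorem norm_payoff_integrand_le {c t : ℝ} (hc : 1 < c) (hρ : ∀ ℓ, c < p.ρ ℓ) (ht : 0 ≤ t) (y : ℝ) :
    ‖cexp (t * p.psi (c + y * I)) * ((c + y * I) * ((c + y * I) - 1))⁻¹‖ ≤
      Real.exp (t * (p.psi c).re) * ‖((c + y * I) * ((c + y * I) - 1) : ℂ)⁻¹‖ := by
  rw [norm_mul, Complex.norm_exp]
  gcongr
  simp only [mul_re, ofReal_re, ofReal_im, zero_mul, sub_zero]
  exact mul_le_mul_of_nonneg_left (p.re_psi_le (by linarith) hρ y) ht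

theorem exists_norm_payoffMean_le {c : ℝ} (hc : 1 < c) (hρ : ∀ ℓ, c < p.ρ ℓ) :
    ∃ C : ℝ, ∀ t : ℝ, 0 ≤ t → |p.payoffMean t| ≤ C * Real.exp ((p.psi c).re * t) := by
  refine ⟨(2 * Real.pi)⁻¹ * ∫ y : ℝ, ‖((c + y * I) * ((c + y * I) - 1) : ℂ)⁻¹‖, fun t ht => ?_⟩
  have h1 := congrArg norm (p.payoffMean_eq hc hρ ht)
  have h2 := norm_integral_le_of_norm_le ((integrable_payoffKernel hc).norm.const_mul
    (Real.exp (t * (p.psi c).re))) (ae_of_all _ (p.norm_payoff_integrand_le hc hρ ht))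
  rw [← h1, integral_const_mul] at h2
  have h3 : ‖2 * Real.pi * (p.payoffMean t : ℂ)‖ = 2 * Real.pi * |p.payoffMean t| := by
    simp [abs_of_pos Real.pi_pos]
  rw [h3] at h2
  rw [mul_assoc, inv_mul_eq_div, le_div_iff₀ (by positivity), mul_comm _ t]
  linarith

/-- Dominated convergence in the vertical integral. Continuity matters because equal Laplace
transforms give equality only almost everywhere. -/
theorem continuousOn_payoffMean {c : ℝ} (hc : 1 < c) (hρ : ∀ ℓ, c < p.ρ ℓ) :
    ContinuousOn p.payoffMean (Set.Ici 0) := by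
  have h0 : 0 ≤ c := by linarith
  have hψ := p.continuous_psi_vertical h0 hρ
  have hK := continuous_payoffKernel hc
  have h1 : ContinuousOn (fun t : ℝ => ∫ y : ℝ, cexp (t * p.psi (c + y * I)) *
      ((c + y * I) * ((c + y * I) - 1))⁻¹) (Set.Ici 0) := by
    intro t ht
    refine continuousWithinAt_of_dominated (F := fun t y : ℝ =>
      cexp (t * p.psi (c + y * I)) * ((c + y * I) * ((c + y * I) - 1))⁻¹) (bound := fun y => Real.exp ((t + 1) * |(p.psi c).re|) *
      ‖((c + y * I) * ((c + y * I) - 1) : ℂ)⁻¹‖) ?_ ?_ ?_ ?_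
    · refine Eventually.of_forall fun s => Continuous.aestronglyMeasurable ?_
      fun_prop
    · have h2 : ∀ᶠ s in 𝓝[Set.Ici 0] t, s < t + 1 :=
        (eventually_lt_nhds (by linarith)).filter_mono nhdsWithin_le_nhds
      filter_upwards [self_mem_nhdsWithin, h2] with s hs hst
      refine ae_of_all _ fun y => (p.norm_payoff_integrand_le hc hρ hs y).trans ?_
      have hs : (0 : ℝ) ≤ s := hs
      refine mul_le_mul_of_nonneg_right (Real.exp_le_exp.2 ?_) (norm_nonneg _)
      exact (mul_le_mul_of_nonneg_left (le_abs_self _) hs).trans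
        (mul_le_mul_of_nonneg_right hst.le (abs_nonneg _))
    · exact (integrable_payoffKernel hc).norm.const_mul _
    · refine ae_of_all _ fun y => Continuous.continuousWithinAt ?_
      fun_prop
  have h2 : ContinuousOn (fun t : ℝ => (2 * Real.pi * (p.payoffMean t : ℂ)).re) (Set.Ici 0) :=
    (Complex.continuous_re.comp_continuousOn h1).congr fun t ht => by
      simp only [Function.comp, p.payoffMean_eq hc hρ ht]
  have h3 : ∀ t : ℝ, p.payoffMean t =
      (2 * Real.pi)⁻¹ * (2 * Real.pi * (p.payoffMean t : ℂ)).re := by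
    intro t
    have : (2 * Real.pi * (p.payoffMean t : ℂ)) = ((2 * Real.pi * p.payoffMean t : ℝ) : ℂ) := by
      push_cast; rfl
    rw [this, ofReal_re]
    have := Real.pi_pos
    field_simp
  exact (continuousOn_const.mul h2).congr fun t _ => h3 t

/-- The Laplace transform of the expected payoff. -/
theorem integral_exp_mul_payoffMean {c q : ℝ} (hc : 1 < c) (hρ : ∀ ℓ, c < p.ρ ℓ)
    (hq : (p.psi c).re < q) :
    2 * Real.pi * ((∫ t in Set.Ioi (0 : ℝ), Real.exp (-(q * t)) * p.payoffMean t : ℝ) : ℂ) =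
      ∫ y : ℝ, ((c + y * I) * ((c + y * I) - 1) * (q - p.psi (c + y * I)) : ℂ)⁻¹ := by
  have h0 : 0 ≤ c := by linarith
  have hψ := p.continuous_psi_vertical h0 hρ
  have hK := continuous_payoffKernel hc
  have h1 : Integrable (Function.uncurry fun (t y : ℝ) => cexp (-(q - p.psi (c + y * I)) * t) *
      ((c + y * I) * ((c + y * I) - 1))⁻¹) ((volume.restrict (Set.Ioi 0)).prod volume) := by
    have h2 : Integrable (fun t : ℝ => Real.exp (-(q - (p.psi c).re) * t))
      (volume.restrict (Set.Ioi 0)) := integrableOn_exp_mul_Ioi (by linarith) 0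
    have h3 := (h2.ofReal (𝕜 := ℂ)).mul_prod (integrable_payoffKernel hc)
    refine h3.mono ?_ ?_
    · apply Continuous.aestronglyMeasurable
      simp only [Function.uncurry_def]
      have := hψ.comp (continuous_snd (X := ℝ))
      simp only [Function.comp_def] at this
      exact Continuous.mul (by fun_prop) (hK.comp continuous_snd)
    · have h4 : ∀ᵐ w : ℝ × ℝ ∂((volume.restrict (Set.Ioi 0)).prod volume), w.1 ∈ Set.Ioi 0 :=
        Measure.quasiMeasurePreserving_fst.ae (ae_restrict_mem measurableSet_Ioi)
      filter_upwards [h4] with w hw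
      have hw : 0 < w.1 := hw
      simp only [Function.uncurry_def, norm_mul]
      gcongr
      rw [Complex.norm_exp, RCLike.norm_ofReal, abs_of_pos (Real.exp_pos _), Real.exp_le_exp]
      simp only [mul_re, ofReal_re, ofReal_im, mul_zero, sub_zero, neg_re, sub_re]
      have := p.re_psi_le h0 hρ w.2
      nlinarith
  have h5 := integral_integral_swap h1
  rw [← integral_complex_ofReal, ← integral_const_mul]
  calc _ = ∫ t in Set.Ioi (0 : ℝ), ∫ y : ℝ, cexp (-(q - p.psi (c + y * I)) * t) *
        ((c + y * I) * ((c + y * I) - 1))⁻¹ := by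
        refine setIntegral_congr_fun measurableSet_Ioi fun t ht => ?_
        have ht : 0 < t := ht
        have e : (2 * Real.pi * ((Real.exp (-(q * t)) * p.payoffMean t : ℝ) : ℂ)) =
            cexp (-(q * t)) * (2 * Real.pi * (p.payoffMean t : ℂ)) := by
          push_cast
          ring
        rw [e, p.payoffMean_eq hc hρ ht.le, ← integral_const_mul]
        refine integral_congr_ae (ae_of_all _ fun y => ?_)
        simp only
        rw [← mul_assoc, ← Complex.exp_add]
        congr 2
        ring
    _ = _ := by
        rw [h5]
        refine integral_congr_ae (ae_of_all _ fun y => ?_)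
        have hre : (-((q : ℂ) - p.psi (c + y * I))).re < 0 := by
          have := p.re_psi_le h0 hρ y
          simp only [neg_re, sub_re, ofReal_re]
          linarith
        simp only
        rw [integral_mul_const, integral_exp_mul_complex_Ioi hre, ofReal_zero, mul_zero,
          Complex.exp_zero, neg_div_neg_eq, mul_inv _ (_ - p.psi _), one_div, mul_comm]

end HyperexpParams

/-! ## Uniqueness of Laplace transforms -/

section LaplaceUniqueness

open scoped ContDiff

theorem integral_polynomial_exp_neg_mul {w : ℝ → ℝ} {μ : Measure ℝ}
    (hw : ∀ n : ℕ, Integrable (fun t => Real.exp (-t) ^ n * w t) μ)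
    (h0 : ∀ n : ℕ, ∫ t, Real.exp (-t) ^ n * w t ∂μ = 0) (P : Polynomial ℝ) :
    Integrable (fun t => P.eval (Real.exp (-t)) * w t) μ ∧
      ∫ t, P.eval (Real.exp (-t)) * w t ∂μ = 0 := by
  have e : ∀ t, P.eval (Real.exp (-t)) * w t =
      ∑ n ∈ Finset.range (P.natDegree + 1), P.coeff n * (Real.exp (-t) ^ n * w t) := by
    intro t
    rw [Polynomial.eval_eq_sum_range, Finset.sum_mul]
    exact Finset.sum_congr rfl fun n _ => by ring
  simp_rw [e]
  refine ⟨integrable_finsetSum _ fun n _ => (hw n).const_mul _, ?_⟩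
  rw [integral_finsetSum _ fun n _ => (hw n).const_mul _]
  exact Finset.sum_eq_zero fun n _ => by rw [integral_const_mul, h0, mul_zero]

/-- The substitution `x = e^{-t}` maps `[0, ∞)` to `(0, 1]`. At the added point `x = 0` the limit is
`0` by compact support, and it agrees with the value there because `Real.log 0 = 0` and `g 0 = 0`.
-/
theorem continuousOn_comp_neg_log {g : ℝ → ℝ} (hg : Continuous g) (hs : HasCompactSupport g)
    (hU : tsupport g ⊆ Set.Ioi 0) : ContinuousOn (fun x => g (-Real.log x)) (Set.Icc 0 1) := by
  intro x hx
  rcases hx.1.eq_or_lt with rfl | h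
  · have h0 : g (-Real.log 0) = 0 := by
      rw [Real.log_zero, neg_zero]
      exact image_eq_zero_of_notMem_tsupport fun h => lt_irrefl (0 : ℝ) (hU h)
    have h1 : Tendsto g atTop (𝓝 0) := by
      have h2 := hs.is_zero_at_infty
      exact h2.mono_left atTop_le_cocompact
    have h2 : Tendsto (fun x => g (-Real.log x)) (𝓝[>] 0) (𝓝 0) :=
      h1.comp (tendsto_neg_atBot_atTop.comp Real.tendsto_log_nhdsGT_zero)
    have h3 : ContinuousWithinAt (fun x => g (-Real.log x)) (Set.Ioi 0) 0 := by
      rw [ContinuousWithinAt, h0]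
      exact h2
    have h4 := continuousWithinAt_insert_self.2 h3
    exact h4.mono fun y hy => by
      rcases hy.1.eq_or_lt with rfl | h
      · exact Set.mem_insert _ _
      · exact Set.mem_insert_of_mem _ h
  · exact (hg.continuousAt.comp (Real.continuousAt_log h.ne').neg).continuousWithinAt

/-- By Weierstrass, a test function on `(0, ∞)` is uniformly close to a polynomial in `e^{-t}`, and
`w` integrates to zero against all of these. -/
theorem ae_eq_zero_of_integral_exp_neg_pow {w : ℝ → ℝ}
    (hw : ∀ n : ℕ, IntegrableOn (fun t => Real.exp (-t) ^ n * w t) (Set.Ioi 0))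
    (h0 : ∀ n : ℕ, ∫ t in Set.Ioi (0 : ℝ), Real.exp (-t) ^ n * w t = 0) :
    ∀ᵐ t : ℝ, t ∈ Set.Ioi (0 : ℝ) → w t = 0 := by
  have hwi : IntegrableOn w (Set.Ioi 0) := by simpa using hw 0
  refine isOpen_Ioi.ae_eq_zero_of_integral_contDiff_smul_eq_zero hwi.locallyIntegrableOn
    fun g hg hs hU => ?_
  have hgc : Continuous g := hg.continuous
  have e1 : ∫ t, g t • w t = ∫ t in Set.Ioi (0 : ℝ), g t * w t := by
    rw [← setIntegral_eq_integral_of_forall_compl_eq_zero (s := Set.Ioi (0 : ℝ)) fun t ht => by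
      rw [image_eq_zero_of_notMem_tsupport fun h => ht (hU h), zero_smul]]
    rfl
  rw [e1]
  set A := ∫ t in Set.Ioi (0 : ℝ), |w t| with hA
  have hA0 : 0 ≤ A := integral_nonneg fun t => abs_nonneg _
  have hgw : IntegrableOn (fun t => g t * w t) (Set.Ioi 0) := by
    obtain ⟨C, hC⟩ := hs.exists_bound_of_continuous hgc
    exact hwi.bdd_mul hgc.aestronglyMeasurable (ae_of_all _ hC)
  have key : ∀ ε : ℝ, 0 < ε → |∫ t in Set.Ioi (0 : ℝ), g t * w t| ≤ ε * A := by
    intro ε hε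
    obtain ⟨P, hP⟩ := exists_polynomial_near_of_continuousOn 0 1 _
      (continuousOn_comp_neg_log hgc hs hU) ε hε
    obtain ⟨i1, i2⟩ := integral_polynomial_exp_neg_mul hw h0 P
    have e2 : ∫ t in Set.Ioi (0 : ℝ), g t * w t =
        ∫ t in Set.Ioi (0 : ℝ), (g t * w t - P.eval (Real.exp (-t)) * w t) := by
      rw [integral_sub hgw i1, i2, sub_zero]
    rw [e2, ← Real.norm_eq_abs, hA, ← integral_const_mul]
    refine norm_integral_le_of_norm_le (hwi.abs.const_mul ε) ?_
    filter_upwards [ae_restrict_mem measurableSet_Ioi] with t ht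
    have ht : 0 < t := ht
    have h1 := hP (Real.exp (-t)) ⟨(Real.exp_pos _).le, by simpa using ht.le⟩
    rw [Real.log_exp, neg_neg, abs_sub_comm] at h1
    rw [← sub_mul, norm_mul, Real.norm_eq_abs, Real.norm_eq_abs]
    gcongr
  have h2 : |∫ t in Set.Ioi (0 : ℝ), g t * w t| ≤ 0 := by
    refine le_of_forall_pos_le_add fun δ hδ => ?_
    refine (key (δ / (A + 1)) (by positivity)).trans ?_
    rw [zero_add, div_mul_eq_mul_div, div_le_iff₀ (by positivity)]
    nlinarith
  exact abs_nonpos_iff.1 h2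

/-- A continuous function on `[0, ∞)` is determined by its Laplace transform near infinity. -/
theorem eqOn_of_laplace_eq {f g : ℝ → ℝ} (hf : ContinuousOn f (Set.Ici 0))
    (hg : ContinuousOn g (Set.Ici 0))
    (hfi : ∀ᶠ q : ℝ in atTop, IntegrableOn (fun t => Real.exp (-(q * t)) * f t) (Set.Ioi 0))
    (hgi : ∀ᶠ q : ℝ in atTop, IntegrableOn (fun t => Real.exp (-(q * t)) * g t) (Set.Ioi 0))
    (h : ∀ᶠ q : ℝ in atTop, ∫ t in Set.Ioi (0 : ℝ), Real.exp (-(q * t)) * f t =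
      ∫ t in Set.Ioi (0 : ℝ), Real.exp (-(q * t)) * g t) : Set.EqOn f g (Set.Ici 0) := by
  obtain ⟨q, hq⟩ := eventually_atTop.1 (hfi.and (hgi.and h))
  -- Equality of the transforms at `q, q + 1, q + 2, …` says that all moments in `e^{-t}` of
  -- `e^{-qt} (f - g)` vanish.
  have e : ∀ (n : ℕ) (t : ℝ), Real.exp (-t) ^ n * (Real.exp (-(q * t)) * (f t - g t)) =
      Real.exp (-((q + n) * t)) * f t - Real.exp (-((q + n) * t)) * g t := by
    intro n t
    rw [← Real.exp_nat_mul, ← mul_assoc, ← Real.exp_add, ← mul_sub]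
    congr 2
    ring
  have hqn : ∀ n : ℕ, q ≤ q + n := fun n => by simp
  have h1 := ae_eq_zero_of_integral_exp_neg_pow (w := fun t => Real.exp (-(q * t)) * (f t - g t))
    (fun n => by
      simp_rw [e]
      exact (hq _ (hqn n)).1.sub (hq _ (hqn n)).2.1)
    (fun n => by
      simp_rw [e]
      rw [integral_sub (hq _ (hqn n)).1 (hq _ (hqn n)).2.1, (hq _ (hqn n)).2.2, sub_self])
  have h2 : f =ᵐ[volume.restrict (Set.Ici 0)] g := by
    rw [← restrict_Ioi_eq_restrict_Ici, EventuallyEq, ae_restrict_iff' measurableSet_Ioi]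
    filter_upwards [h1] with t ht htt
    have := ht htt
    simpa [Real.exp_ne_zero, sub_eq_zero] using this
  exact Measure.eqOn_of_ae_eq h2 hf hg (by simp)

end LaplaceUniqueness

/-! ## Term-by-term Laplace transforms -/

section LaplaceSeries

theorem HasTaylor.exists_summable {L : ℂ → ℂ} {b : ℕ → ℝ} (h : HasTaylor L (complexSeries b)) :
    ∃ r : ℝ, 0 < r ∧ (∀ w : ℝ, |w| ≤ r → HasSum (fun n => (b n : ℂ) * (w : ℂ) ^ n) (L w)) ∧
      Summable fun n => |b n| * r ^ n := by
  obtain ⟨ε, hε, hb⟩ := Metric.eventually_nhds_iff.1 h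
  have h1 : ∀ w : ℝ, |w| ≤ ε / 2 → HasSum (fun n => (b n : ℂ) * (w : ℂ) ^ n) (L w) := by
    intro w hw
    have := hb (y := (w : ℂ)) (by
      rw [dist_zero_right, Complex.norm_real, Real.norm_eq_abs]
      linarith)
    simpa using this
  refine ⟨ε / 2, by positivity, h1, ?_⟩
  have h2 := (h1 (ε / 2) (by rw [abs_of_pos (by positivity)])).summable.norm
  refine h2.congr fun n => ?_
  rw [norm_mul, norm_pow, Complex.norm_real, Complex.norm_real, Real.norm_eq_abs,
    Real.norm_of_nonneg (by positivity : 0 ≤ ε / 2)]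

theorem summable_pow_div_Gamma (k : ℕ) (hk : k = 1 ∨ k = 2) {y : ℝ} (hy : 0 ≤ y) :
    Summable fun n : ℕ => y ^ n / Real.Gamma ((n : ℝ) / k + 1) := by
  rcases hk with rfl | rfl
  · simpa [Real.Gamma_nat_eq_factorial] using Real.summable_pow_div_factorial y
  · refine Summable.even_add_odd ?_ ?_
    · refine (Real.summable_pow_div_factorial (y ^ 2)).congr fun m => ?_
      have : ((2 * m : ℕ) : ℝ) / (2 : ℕ) + 1 = m + 1 := by push_cast; field_simp
      rw [this, Real.Gamma_nat_eq_factorial, ← pow_mul]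
    -- The shift brings the Gamma arguments into `[2, ∞)`, where Gamma is increasing, so the odd
    -- terms are dominated by `1/(m+1)!`.
    · rw [← summable_nat_add_iff 1]
      refine Summable.of_nonneg_of_le (fun m => ?_) (fun m => ?_)
        (((summable_nat_add_iff 1).2 (Real.summable_pow_div_factorial (y ^ 2))).mul_left y)
      · have : 0 < Real.Gamma (((2 * (m + 1) + 1 : ℕ) : ℝ) / (2 : ℕ) + 1) :=
          Real.Gamma_pos_of_pos (by positivity)
        positivity
      · have h1 : Real.Gamma (((m + 1 : ℕ) : ℝ) + 1) ≤
            Real.Gamma (((2 * (m + 1) + 1 : ℕ) : ℝ) / (2 : ℕ) + 1) := by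
          refine Real.Gamma_strictMonoOn_Ici.monotoneOn ?_ ?_ ?_
          · simp only [Set.mem_Ici]
            push_cast
            linarith [(Nat.cast_nonneg m : (0 : ℝ) ≤ m)]
          · simp only [Set.mem_Ici]
            push_cast
            linarith [(Nat.cast_nonneg m : (0 : ℝ) ≤ m)]
          · push_cast
            linarith
        rw [Real.Gamma_nat_eq_factorial] at h1
        rw [pow_succ, pow_mul, ← mul_div_assoc, mul_comm y]
        gcongr

/-- The bound `|b_n| ≤ C r^(-n)` costs a geometric factor only, which the Gamma function absorbs:
convergence holds for every `y` although the original series has only a local radius. -/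
theorem summable_coeff_mul_pow_div_Gamma (k : ℕ) (hk : k = 1 ∨ k = 2) {b : ℕ → ℝ} {r : ℝ}
    (hr : 0 < r) (hb : Summable fun n => |b n| * r ^ n) {y : ℝ} (hy : 0 ≤ y) :
    Summable fun n : ℕ => |b (n + 1 + k)| * y ^ (n + 1) /
      Real.Gamma (((n + 1 : ℕ) : ℝ) / k + 1) := by
  obtain ⟨C, hC⟩ : ∃ C, ∀ n, |b n| * r ^ n ≤ C := by
    obtain ⟨C, hC⟩ := hb.tendsto_atTop_zero.bddAbove_range
    exact ⟨C, fun n => hC ⟨n, rfl⟩⟩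
  have h1 := ((summable_nat_add_iff 1).2 (summable_pow_div_Gamma k hk
    (div_nonneg hy hr.le))).mul_left (C / r ^ k)
  have hG : ∀ n : ℕ, 0 < Real.Gamma (((n + 1 : ℕ) : ℝ) / k + 1) :=
    fun n => Real.Gamma_pos_of_pos (by positivity)
  refine Summable.of_nonneg_of_le (fun n => ?_) (fun n => ?_) h1
  · have := hG n
    positivity
  · have h3 : |b (n + 1 + k)| ≤ C / r ^ (n + 1 + k) := by
      rw [le_div_iff₀ (by positivity)]
      exact hC (n + 1 + k)
    have h4 : |b (n + 1 + k)| * y ^ (n + 1) ≤ C / r ^ k * (y / r) ^ (n + 1) := by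
      refine (mul_le_mul_of_nonneg_right h3 (by positivity)).trans (le_of_eq ?_)
      rw [div_pow, pow_add]
      field_simp
    rw [← mul_div_assoc]
    exact div_le_div_of_nonneg_right h4 (hG n).le

/-- The function with Laplace transform `∑ b_n q^(-n/k)`, if `b_n = 0` for `n ≤ k`. -/
noncomputable def gammaSeries (k : ℕ) (b : ℕ → ℝ) (t : ℝ) : ℝ :=
  ∑' n : ℕ, b (n + 1 + k) * t ^ (((n + 1 : ℕ) : ℝ) / k) / Real.Gamma (((n + 1 : ℕ) : ℝ) / k + 1)

theorem rpow_div_eq (k m : ℕ) {t : ℝ} (ht : 0 ≤ t) :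
    t ^ ((m : ℝ) / k) = (t ^ (1 / (k : ℝ))) ^ m := by
  rw [← Real.rpow_natCast, ← Real.rpow_mul ht, one_div_mul_eq_div]

theorem continuousOn_gammaSeries (k : ℕ) (hk : k = 1 ∨ k = 2) {b : ℕ → ℝ} {r : ℝ} (hr : 0 < r)
    (hb : Summable fun n => |b n| * r ^ n) : ContinuousOn (gammaSeries k b) (Set.Ici 0) := by
  intro t ht
  have ht : 0 ≤ t := ht
  have hy : 0 ≤ (t + 1) ^ (1 / (k : ℝ)) := by positivity
  have h1 : ContinuousOn (gammaSeries k b) (Set.Icc 0 (t + 1)) := by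
    refine continuousOn_tsum (fun n => ?_) (summable_coeff_mul_pow_div_Gamma k hk hr hb hy)
      fun n s hs => ?_
    · have : Continuous fun s : ℝ => s ^ (((n + 1 : ℕ) : ℝ) / k) :=
        Real.continuous_rpow_const (by positivity)
      fun_prop
    · have hG : 0 < Real.Gamma (((n + 1 : ℕ) : ℝ) / k + 1) :=
        Real.Gamma_pos_of_pos (by positivity)
      have hs0 := hs.1
      rw [norm_div, norm_mul, Real.norm_of_nonneg hG.le, Real.norm_eq_abs,
        Real.norm_of_nonneg (by positivity), rpow_div_eq k _ hs0]
      gcongr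
      exact hs.2
  refine (h1 t ⟨ht, by linarith⟩).mono_of_mem_nhdsWithin ?_
  rw [mem_nhdsWithin]
  exact ⟨Set.Iio (t + 1), isOpen_Iio, by simp, fun s hs => ⟨hs.2, le_of_lt hs.1⟩⟩

theorem integrableOn_exp_mul_rpow {q s : ℝ} (hq : 0 < q) (hs : 0 < s) :
    IntegrableOn (fun t : ℝ => Real.exp (-(q * t)) * t ^ s) (Set.Ioi 0) := by
  have h1 := integrableOn_rpow_mul_exp_neg_mul_rpow (p := 1) (s := s) (b := q) (by linarith)
    one_pos hq
  refine h1.congr_fun (fun t _ => ?_) measurableSet_Ioi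
  simp only [Real.rpow_one]
  rw [mul_comm, neg_mul]

theorem integral_exp_mul_rpow_div_Gamma {q s : ℝ} (hq : 0 < q) (hs : 0 < s) :
    ∫ t in Set.Ioi (0 : ℝ), Real.exp (-(q * t)) * (t ^ s / Real.Gamma (s + 1)) =
      q ^ (-(s + 1)) := by
  have hG : 0 < Real.Gamma (s + 1) := Real.Gamma_pos_of_pos (by positivity)
  have h1 := Real.integral_rpow_mul_exp_neg_mul_Ioi (a := s + 1) (r := q) (by positivity) hq
  rw [add_sub_cancel_right] at h1
  have h2 : ∀ t : ℝ, Real.exp (-(q * t)) * (t ^ s / Real.Gamma (s + 1)) =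
      t ^ s * Real.exp (-(q * t)) * (Real.Gamma (s + 1))⁻¹ := fun t => by
    rw [div_eq_mul_inv]; ring
  simp_rw [h2]
  rw [integral_mul_const, h1, mul_assoc, mul_inv_cancel₀ hG.ne', mul_one, one_div,
    Real.inv_rpow hq.le, Real.rpow_neg hq.le]

theorem rpow_neg_div_add_one (k m : ℕ) (hk : k ≠ 0) {q : ℝ} (hq : 0 < q) :
    q ^ (-((m : ℝ) / k + 1)) = (q ^ (-(1 / (k : ℝ)))) ^ (m + k) := by
  rw [← Real.rpow_natCast, ← Real.rpow_mul hq.le]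
  congr 1
  push_cast
  field_simp

/-- The Laplace transform of `gammaSeries`. -/
theorem laplace_gammaSeries (k : ℕ) (hk : k = 1 ∨ k = 2) {b : ℕ → ℝ} {r : ℝ} (hr : 0 < r)
    (hb : Summable fun n => |b n| * r ^ n) {q : ℝ} (hq : 0 < q)
    (hqr : q ^ (-(1 / (k : ℝ))) ≤ r) :
    IntegrableOn (fun t => Real.exp (-(q * t)) * gammaSeries k b t) (Set.Ioi 0) ∧
      HasSum (fun n => b (n + 1 + k) * (q ^ (-(1 / (k : ℝ)))) ^ (n + 1 + k))
        (∫ t in Set.Ioi (0 : ℝ), Real.exp (-(q * t)) * gammaSeries k b t) := by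
  have hk0 : k ≠ 0 := by rcases hk with rfl | rfl <;> norm_num
  have hkpos : (0 : ℝ) < k := by positivity
  set F : ℕ → ℝ → ℝ := fun n t => b (n + 1 + k) * (Real.exp (-(q * t)) *
    (t ^ (((n + 1 : ℕ) : ℝ) / k) / Real.Gamma (((n + 1 : ℕ) : ℝ) / k + 1))) with hF
  have hs : ∀ n : ℕ, 0 < ((n + 1 : ℕ) : ℝ) / k := fun n => by positivity
  have hG : ∀ n : ℕ, 0 < Real.Gamma (((n + 1 : ℕ) : ℝ) / k + 1) :=
    fun n => Real.Gamma_pos_of_pos (by positivity)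
  have hFi : ∀ n, IntegrableOn (F n) (Set.Ioi 0) := by
    intro n
    have h1 := ((integrableOn_exp_mul_rpow hq (hs n)).div_const
      (Real.Gamma (((n + 1 : ℕ) : ℝ) / k + 1))).const_mul (b (n + 1 + k))
    refine h1.congr (ae_of_all _ fun t => ?_)
    simp only [hF, mul_div_assoc]
  have hFint : ∀ n, ∫ t in Set.Ioi (0 : ℝ), F n t =
      b (n + 1 + k) * (q ^ (-(1 / (k : ℝ)))) ^ (n + 1 + k) := by
    intro n
    simp only [hF]
    rw [integral_const_mul, integral_exp_mul_rpow_div_Gamma hq (hs n),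
      rpow_neg_div_add_one k _ hk0 hq]
  have hFabs : ∀ n, ∫ t in Set.Ioi (0 : ℝ), ‖F n t‖ =
      |b (n + 1 + k)| * (q ^ (-(1 / (k : ℝ)))) ^ (n + 1 + k) := by
    intro n
    rw [← rpow_neg_div_add_one k _ hk0 hq, ← integral_exp_mul_rpow_div_Gamma hq (hs n),
      ← integral_const_mul]
    refine setIntegral_congr_fun measurableSet_Ioi fun t ht => ?_
    have ht : 0 < t := ht
    have := hG n
    simp only [hF]
    rw [norm_mul, Real.norm_eq_abs, Real.norm_of_nonneg (by positivity)]
  -- The condition `q^(-1/k) ≤ r` makes the integrals of the absolute values summable, which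
  -- justifies integrating term by term.
  have hsum : Summable fun n => ∫ t in Set.Ioi (0 : ℝ), ‖F n t‖ := by
    simp_rw [hFabs]
    have h1 := (summable_nat_add_iff (1 + k)).2 hb
    simp only [← add_assoc] at h1
    refine Summable.of_nonneg_of_le (fun n => by positivity) (fun n => ?_) h1
    gcongr
  have hFG : ∀ t, Real.exp (-(q * t)) * gammaSeries k b t = ∑' n, F n t := by
    intro t
    rw [gammaSeries, ← tsum_mul_left]
    refine tsum_congr fun n => ?_
    simp only [hF]
    ring
  have h2 := hasSum_integral_of_summable_integral_norm hFi hsum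
  simp_rw [hFint, ← hFG] at h2
  refine ⟨⟨?_, ?_⟩, h2⟩
  · refine ContinuousOn.aestronglyMeasurable ?_ measurableSet_Ioi
    exact (Continuous.continuousOn (by fun_prop)).mul
      ((continuousOn_gammaSeries k hk hr hb).mono Set.Ioi_subset_Ici_self)
  · simp_rw [hFG]
    have h3 : ∀ n, ∫⁻ t in Set.Ioi (0 : ℝ), ‖F n t‖ₑ =
        ENNReal.ofReal (∫ t in Set.Ioi (0 : ℝ), ‖F n t‖) := fun n =>
      (ofReal_integral_norm_eq_lintegral_enorm (hFi n)).symm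
    calc ∫⁻ t in Set.Ioi (0 : ℝ), ‖∑' n, F n t‖ₑ ≤ ∫⁻ t in Set.Ioi (0 : ℝ), ∑' n, ‖F n t‖ₑ :=
          lintegral_mono fun t => enorm_tsum_le_tsum_enorm
      _ = ∑' n, ENNReal.ofReal (∫ t in Set.Ioi (0 : ℝ), ‖F n t‖) := by
          rw [lintegral_tsum fun n => (hFi n).1.enorm]
          simp_rw [h3]
      _ < ∞ := by
          rw [← ENNReal.ofReal_tsum_of_nonneg (fun n => integral_nonneg fun t => norm_nonneg _) hsum]
          exact ENNReal.ofReal_lt_top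

/-- A function with Laplace transform `L(q^(-1/k))`, where `L` is analytic at the origin with
vanishing coefficients up to index `k`, is given by the corresponding series. -/
theorem eqOn_gammaSeries (k : ℕ) (hk : k = 1 ∨ k = 2) {b : ℕ → ℝ} {L : ℂ → ℂ}
    (hL : HasTaylor L (complexSeries b)) (hb0 : ∀ n ≤ k, b n = 0) {f : ℝ → ℝ}
    (hf : ContinuousOn f (Set.Ici 0))
    (hfi : ∀ᶠ q : ℝ in atTop, IntegrableOn (fun t => Real.exp (-(q * t)) * f t) (Set.Ioi 0))
    (h : ∀ᶠ q : ℝ in atTop, ((∫ t in Set.Ioi (0 : ℝ), Real.exp (-(q * t)) * f t : ℝ) : ℂ) =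
      L ((q ^ (-(1 / (k : ℝ))) : ℝ) : ℂ)) :
    Set.EqOn f (gammaSeries k b) (Set.Ici 0) := by
  have hk0 : k ≠ 0 := by rcases hk with rfl | rfl <;> norm_num
  obtain ⟨r, hr, hsum, hb⟩ := hL.exists_summable
  have hw : ∀ᶠ q : ℝ in atTop, q ^ (-(1 / (k : ℝ))) ≤ r :=
    (tendsto_rpow_neg_atTop (by positivity)).eventually_le_const hr
  refine eqOn_of_laplace_eq hf (continuousOn_gammaSeries k hk hr hb) hfi ?_ ?_
  · filter_upwards [hw, eventually_gt_atTop 0] with q hq hq0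
    exact (laplace_gammaSeries k hk hr hb hq0 hq).1
  · filter_upwards [hw, eventually_gt_atTop 0, h] with q hq hq0 hqL
    have h1 := (laplace_gammaSeries k hk hr hb hq0 hq).2
    have h2 := hsum (q ^ (-(1 / (k : ℝ)))) (by rwa [abs_of_pos (by positivity)])
    rw [← hqL] at h2
    have h3 : HasSum (fun n => b n * (q ^ (-(1 / (k : ℝ)))) ^ n)
        (∫ t in Set.Ioi (0 : ℝ), Real.exp (-(q * t)) * f t) := by
      rw [← Complex.hasSum_ofReal]
      simpa using h2
    rw [← hasSum_nat_add_iff' (1 + k)] at h3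
    have h4 : ∑ n ∈ Finset.range (1 + k), b n * (q ^ (-(1 / (k : ℝ)))) ^ n = 0 :=
      Finset.sum_eq_zero fun n hn => by
        rw [hb0 n (by have := Finset.mem_range.1 hn; omega), zero_mul]
    rw [h4, sub_zero] at h3
    simp only [← add_assoc] at h3
    exact h3.unique h1

end LaplaceSeries

/-! ### Vanishing of the leading coefficients, and conclusion -/

theorem mulCoeff_eq_zero {f g : ℕ → ℝ} {j k n : ℕ} (hf : ∀ i < j, f i = 0) (hg : ∀ i < k, g i = 0)
    (hn : n < j + k) : mulCoeff f g n = 0 := by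
  refine Finset.sum_eq_zero fun i hi => ?_
  have hi := Finset.mem_range.1 hi
  rcases lt_or_ge i j with h | h
  · rw [hf i h, zero_mul]
  · rw [hg (n - i) (by omega), mul_zero]

/-- Orders add up: at least `1` for `ξ`, `1` for `ς` and `k - 1` for `ζ'`. Hence no power `q^(-n/k)`
with `n ≤ k` occurs, and the series for the payoff starts at `t^(1/k)`. -/
theorem extraMCoeff_eq_zero {k n : ℕ} (h : ℕ → ℝ) (hn : n < k + 1) :
    extraMCoeff k h n = 0 := by
  have h1 : ∀ i < 1, extraXiCoeff k h i = 0 := by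
    intro i hi
    obtain rfl : i = 0 := by omega
    simp [extraXiCoeff, invCoeff]
  have h2 : ∀ i < 1, extraVarsigmaCoeff k h i = 0 := by
    intro i hi
    obtain rfl : i = 0 := by omega
    simp [extraVarsigmaCoeff]
  have h3 : ∀ i < k - 1, extraZetaDerivCoeff k h i = 0 := by
    intro i hi
    rw [extraZetaDerivCoeff, if_pos (by omega)]
  exact mulCoeff_eq_zero (j := 2) (fun i hi => mulCoeff_eq_zero h1 h2 hi) h3 (by omega)

namespace HyperexpParams

variable (p : HyperexpParams)

theorem mCoeff_eq_zero (ℓ : Fin p.N) {n : ℕ} (hn : n < 2) : p.mCoeff ℓ n = 0 :=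
  mulCoeff_eq_zero (j := 0) (k := 2) (fun i hi => absurd hi (by omega))
    (fun i hi => by rw [zetaDerivCoeff, if_pos hi]) (by omega)

theorem bGauss_eq_zero {n : ℕ} (hn : n ≤ 2) : p.bGauss n = 0 := by
  unfold bGauss
  rw [extraMCoeff_eq_zero _ (by omega),
    Finset.sum_eq_zero fun ℓ _ => p.mCoeff_eq_zero ℓ (n := n / 2) (by omega)]
  simp

theorem bNoGauss_eq_zero {n : ℕ} (hn : n ≤ 1) : p.bNoGauss n = 0 := by
  unfold bNoGauss
  rw [extraMCoeff_eq_zero _ (by omega),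
    Finset.sum_eq_zero fun ℓ _ => p.mCoeff_eq_zero ℓ (n := n) (by omega)]
  simp

variable {p}

/-- The condition `ρ_1 > 1` leaves room for a line between the pole `1` of the payoff kernel and the
first pole of `ψ`; for `N = 0` any abscissa above `1` serves. -/
theorem RiskNeutral.exists_exponent {r : ℝ} (hr : p.RiskNeutral r) :
    ∃ c : ℝ, 1 < c ∧ ∀ ℓ, c < p.ρ ℓ := by
  rcases Nat.eq_zero_or_pos p.N with h | h
  · refine ⟨2, one_lt_two, fun ℓ => ?_⟩
    exact absurd ℓ.2 (by omega)
  · have h1 := hr.2.2 h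
    refine ⟨(1 + p.ρ ⟨0, h⟩) / 2, by linarith, fun ℓ => ?_⟩
    have : p.ρ ⟨0, h⟩ ≤ p.ρ ℓ := p.ρ_strictMono.monotone (Fin.mk_le_of_le_val (Nat.zero_le _))
    linarith

variable (p)

theorem integrableOn_exp_mul_payoffMean {c : ℝ} (hc : 1 < c) (hρ : ∀ ℓ, c < p.ρ ℓ) {q : ℝ}
    (hq : (p.psi c).re < q) :
    IntegrableOn (fun t => Real.exp (-(q * t)) * p.payoffMean t) (Set.Ioi 0) := by
  obtain ⟨C, hC⟩ := p.exists_norm_payoffMean_le hc hρ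
  have h1 : IntegrableOn (fun t : ℝ => Real.exp (-(q - (p.psi c).re) * t)) (Set.Ioi 0) :=
    integrableOn_exp_mul_Ioi (by linarith) 0
  refine Integrable.mono' (h1.const_mul C) ?_ ?_
  · refine ContinuousOn.aestronglyMeasurable ?_ measurableSet_Ioi
    exact (Continuous.continuousOn (by fun_prop)).mul
      ((p.continuousOn_payoffMean hc hρ).mono Set.Ioi_subset_Ici_self)
  · filter_upwards [ae_restrict_mem measurableSet_Ioi] with t ht
    have ht : 0 < t := ht
    rw [norm_mul, Real.norm_of_nonneg (Real.exp_pos _).le, Real.norm_eq_abs]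
    refine (mul_le_mul_of_nonneg_left (hC t ht.le) (Real.exp_pos _).le).trans (le_of_eq ?_)
    rw [mul_left_comm, ← Real.exp_add]
    congr 2
    ring

/-- The series for the expected payoff, given the expansion of the vertical integral. -/
theorem payoffMean_eq_gammaSeries {c : ℝ} (hc : 1 < c) (hρ : ∀ ℓ, c < p.ρ ℓ) (k : ℕ)
    (hk : k = 1 ∨ k = 2) {b : ℕ → ℝ} (hb0 : ∀ n ≤ k, b n = 0) {L : ℂ → ℂ}
    (hL : HasTaylor L (complexSeries b))
    (h : ∀ᶠ q : ℝ in atTop,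
      ∫ y : ℝ, ((c + y * Complex.I) * ((c + y * Complex.I) - 1) *
        (q - p.psi (c + y * Complex.I)) : ℂ)⁻¹ =
        2 * Real.pi * L ((q ^ (-(1 / (k : ℝ))) : ℝ) : ℂ)) {t : ℝ} (ht : 0 ≤ t) :
    p.payoffMean t = gammaSeries k b t := by
  refine eqOn_gammaSeries k hk hL hb0 (p.continuousOn_payoffMean hc hρ) ?_ ?_ ht
  · filter_upwards [eventually_gt_atTop (p.psi c).re] with q hq
    exact p.integrableOn_exp_mul_payoffMean hc hρ hq
  · filter_upwards [eventually_gt_atTop (p.psi c).re, h] with q hq hqL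
    have h1 := p.integral_exp_mul_payoffMean hc hρ hq
    rw [hqL] at h1
    exact mul_left_cancel₀ (by simp [Real.pi_ne_zero]) h1

end HyperexpParams

theorem callPayoff_eq {Ω : Type*} (X : ℝ≥0 → Ω → ℝ) {S₀ : ℝ} (hS₀ : 0 < S₀) (T : ℝ≥0) (ω : Ω) :
    callPayoff X S₀ S₀ T ω = S₀ * max 0 (Real.exp (X T ω) - 1) := by
  rw [callPayoff, mul_max_of_nonneg _ _ hS₀.le, mul_zero, mul_sub, mul_one]

theorem mainTheorem3 {Ω : Type*} [MeasurableSpace Ω] (P : Measure Ω) [IsProbabilityMeasure P]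
    (p : HyperexpParams) (X : ℝ≥0 → Ω → ℝ) (hX : IsHyperexpProcess p X P)
    (r S₀ K : ℝ) (hr : p.RiskNeutral r) (hS₀ : 0 < S₀) (hK : S₀ = K) :
    (∀ T : ℝ≥0, Integrable (callPayoff X S₀ K T) P) ∧
    (0 < p.σ →
      (∀ T : ℂ, Summable fun n : ℕ =>
        (p.bGauss ((n + 1) + 2) : ℂ) * (T ^ (1 / 2 : ℂ)) ^ (n + 1)
          / Complex.Gamma (((n + 1 : ℕ) : ℂ) / 2 + 1)) ∧
      ∀ T : ℝ≥0, callPrice X P r S₀ K T = Real.exp (-r * T) * S₀ *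
        ∑' n : ℕ, p.bGauss ((n + 1) + 2) * (T : ℝ) ^ (((n + 1 : ℕ) : ℝ) / 2)
          / Real.Gamma (((n + 1 : ℕ) : ℝ) / 2 + 1)) ∧
    (p.σ = 0 →
      (∀ T : ℂ, Summable fun n : ℕ =>
        (p.bNoGauss ((n + 1) + 1) : ℂ) * T ^ (n + 1) / ((n + 1).factorial : ℂ)) ∧
      ∀ T : ℝ≥0, callPrice X P r S₀ K T = Real.exp (-r * T) * S₀ *
        ∑' n : ℕ, p.bNoGauss ((n + 1) + 1) * (T : ℝ) ^ (n + 1) / ((n + 1).factorial : ℝ)) := by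
  subst hK
  obtain ⟨c, hc, hρ⟩ := hr.exists_exponent
  have hprice : ∀ T : ℝ≥0, callPrice X P r S₀ S₀ T = Real.exp (-r * T) * S₀ * p.payoffMean T := by
    intro T
    rw [callPrice, HyperexpParams.payoffMean, ← p.map_eq_law hX,
      integral_map (hX.1.measurable T).aemeasurable (Continuous.aestronglyMeasurable (by fun_prop)),
      mul_assoc]
    simp_rw [callPayoff_eq X hS₀]
    rw [integral_const_mul]
  refine ⟨fun T => ?_, fun hσ => ⟨fun T => ?_, fun T => ?_⟩, fun hσ => ⟨fun T => ?_, fun T => ?_⟩⟩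
  · have : IsProbabilityMeasure (P.map (X T)) :=
      Measure.isProbabilityMeasure_map (hX.1.measurable T).aemeasurable
    have h1 := integrable_payoff hc (p.lmgf_map_lt_top hX T (by linarith) hρ)
    have h2 := (h1.comp_measurable (hX.1.measurable T)).const_mul S₀
    exact h2.congr (ae_of_all _ fun ω => (callPayoff_eq X hS₀ T ω).symm)
  · obtain ⟨L, hL, -⟩ := p.exists_integral_eq_gauss c hc hρ hσ
    obtain ⟨s, hs, -, hb⟩ := hL.exists_summable
    -- Convergence at complex `T` is absolute, with `y = |T^(1/2)|`; the function `L` enters only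
    -- through the geometric bound on its coefficients.
    have h1 := summable_coeff_mul_pow_div_Gamma 2 (Or.inr rfl) hs hb
      (norm_nonneg (T ^ (1 / 2 : ℂ)))
    refine Summable.of_norm (h1.congr fun n => ?_)
    have e : (((n + 1 : ℕ) : ℂ) / 2 + 1) = ((((n + 1 : ℕ) : ℝ) / (2 : ℕ) + 1 : ℝ) : ℂ) := by
      push_cast
      rfl
    have hG : 0 < Real.Gamma (((n + 1 : ℕ) : ℝ) / (2 : ℕ) + 1) :=
      Real.Gamma_pos_of_pos (by positivity)
    rw [e, Complex.Gamma_ofReal, norm_div, norm_mul, norm_pow, Complex.norm_real, Complex.norm_real,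
      Real.norm_eq_abs, Real.norm_of_nonneg hG.le]
  · obtain ⟨L, hL, hq⟩ := p.exists_integral_eq_gauss c hc hρ hσ
    rw [hprice, p.payoffMean_eq_gammaSeries hc hρ 2 (Or.inr rfl) (fun n => p.bGauss_eq_zero) hL hq
      T.coe_nonneg]
    rfl
  · obtain ⟨L, hL, -⟩ := p.exists_integral_eq_noGauss c hc hρ hσ
    obtain ⟨s, hs, -, hb⟩ := hL.exists_summable
    have h1 := summable_coeff_mul_pow_div_Gamma 1 (Or.inl rfl) hs hb (norm_nonneg T)
    refine Summable.of_norm (h1.congr fun n => ?_)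
    rw [Nat.cast_one, div_one, Real.Gamma_nat_eq_factorial, norm_div, norm_mul, norm_pow,
      Complex.norm_real, Complex.norm_natCast, Real.norm_eq_abs]
  · obtain ⟨L, hL, hq⟩ := p.exists_integral_eq_noGauss c hc hρ hσ
    rw [hprice, p.payoffMean_eq_gammaSeries hc hρ 1 (Or.inl rfl) (fun n => p.bNoGauss_eq_zero) hL hq
      T.coe_nonneg, gammaSeries]
    congr 1
    refine tsum_congr fun n => ?_
    rw [Nat.cast_one, div_one, Real.Gamma_nat_eq_factorial, Real.rpow_natCast]
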